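/- **Setting.** All Euclidean spaces carry the Euclidean norm, spaces of linear maps the operator norm. For $q\ge 1$, the $q$-variation over $[0,T]$ of a two-parameter function $G$ on $\Delta_T=\{0\le s\le t\le T\}$ is $\|G\|_q=\big(\sup_{\mathcal P}\sum_{[u,v]\in\mathcal P}|G_{u,v}|^q\big)^{1/q}$, the supremum being over all partitions of $[0,T]$; for a path $Y$ write $Y_{s,t}=Y_t-Y_s$ and let $\|Y\|_q$ be the $q$-variation of its increments. Let $p\in(2,3)$ and $T>0$. A càdlàg $p$-rough path over $\mathbb R^d$ is a pair $\mathbf X=(X,\mathbb X)$ with $X:[0,T]\to\mathbb R^d$ càdlàg, $\mathbb X:\Delta_T\to\mathbb R^{d\times d}$ càdlàg in each variable, $\|X\|_p<\infty$, $\|\mathbb X\|_{p/2}<\infty$ and $\mathbb X_{s,t}=\mathbb X_{s,u}+\mathbb X_{u,t}+X_{s,u}\otimes X_{u,t}$ for $s\le u\le t$; put $\|\mathbf X\|_p=\|X\|_p+\|\mathbb X\|_{p/2}$. The space $\mathcal V^p_X([0,T];E)$ of controlled paths consists of the pairs $(Y,Y')$ of càdlàg paths of finite $p$-variation, with values in $E$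 and $\mathcal L(\mathbb R^d;E)$, such that $R^Y_{s,t}=Y_{s,t}-Y'_sX_{s,t}$ is càdlàg in each variable and has finite $p/2$-variation; put $$\|Y,Y'\|_{X,p}=|Y'_0|+\|Y'\|_p+\|R^Y\|_{p/2},\qquad \|Y,Y';\tilde Y,\tilde Y'\|_{X,p}=|Y'_0-\tilde Y'_0|+\|Y'-\tilde Y'\|_p+\|R^Y-R^{\tilde Y}\|_{p/2}.$$ The rough integral $\int_0^tV_s\,\mathrm d\mathbf X_s$ of $(V,V')\in\mathcal V^p_X([0,T];\mathcal L(\mathbb R^d;\mathbb R^k))$ is the limit of $\sum_{[u,v]\in\mathcal P}(V_uX_{u,v}+V'_u\mathbb X_{u,v})$ over partitions $\mathcal P$ of $[0,t]$ as the mesh tends to $0$. For $n\in\mathbb N$, $C^n_b$ is the space of $n$ times continuously differentiable functions that are bounded together with their derivatives up to order $n$, and $\|f\|_{C^n_b}=\sum_{j\le n}\|\mathrm D^jf\|_\infty$. Let $\mathbf X$ be a càdlàg $p$-rough path over $\mathbb R^d$, $(y,y')\in\mathcal V^p_X([0,T];\mathbb R^k)$, $\ell\in\mathbb N$, $r_1<\dots<r_\ell$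 in $[0,T]$ and $f\in C^3_b(\mathbb R^{k(\ell+1)};\mathcal L(\mathbb R^d;\mathbb R^k))$. For $(Y,Y')\in\mathcal V^p_X([0,T];\mathbb R^k)$ put $$\bar Y_s=(Y_s,Y_{s\wedge r_1},\dots,Y_{s\wedge r_\ell}),\qquad \bar Y'_s=(Y'_s,Y'_s\mathbf 1_{\{s<r_1\}},\dots,Y'_s\mathbf 1_{\{s<r_\ell\}}).$$ A solution of the RDE with discrete time dependence and initial path $(y,y')$ is a controlled path $(Y,Y')\in\mathcal V^p_X([0,T];\mathbb R^k)$ with $Y'=y'+f(\bar Y)$ and $$Y_t=y_t+\int_0^tf(Y_s,Y_{s\wedge r_1},\dots,Y_{s\wedge r_\ell})\,\mathrm d\mathbf X_s,\qquad t\in[0,T],$$ where the integrand is the controlled path $(f(\bar Y),\mathrm Df(\bar Y)\bar Y')$. **Proposition.** (i) There exists a unique solution $(Y,Y')$. Moreover, for fixed $p$, $d$, $k$ there is a componentwise non-decreasing function $K_p:\mathbb N\times[0,\infty)^3\to[0,\infty)$, not depending on the other data, such that $$\|Y,Y'\|_{X,p}\le K_p(\ell,\|f\|_{C^2_b},\|y,y'\|_{X,p},\|\mathbf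 X\|_p).$$ (ii) Let $(Y,Y')$ and $(\tilde Y,\tilde Y')$ be the solutions with initial paths $(y,y')$ and $(\tilde y,\tilde y')$ in $\mathcal V^p_X([0,T];\mathbb R^k)$, and suppose that $\|Y,Y'\|_{X,p},\|\tilde Y,\tilde Y'\|_{X,p}\le K$. Then $$|Y_0-\tilde Y_0|+\|Y,Y';\tilde Y,\tilde Y'\|_{X,p}\le C\big(|y_0-\tilde y_0|+\|y,y';\tilde y,\tilde y'\|_{X,p}\big),$$ where, for fixed $d$ and $k$, the constant $C$ depends only on $p$, $\ell$, $\|f\|_{C^3_b}$, $K$ and $\|\mathbf X\|_p$, and is bounded when $(p,\ell,\|f\|_{C^3_b},K,\|\mathbf X\|_p)$ ranges over a compact subset of $(2,3)\times\mathbb N\times[0,\infty)^3$. -/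

import Mathlib

open Set Filter Topology
open scoped NNReal ENNReal

noncomputable section

namespace RoughPath

/-- `ℝⁿ` with the Euclidean norm. -/
abbrev Vec (n : ℕ) : Type := EuclideanSpace ℝ (Fin n)

/-- `ℝ^{d × d}` with the Euclidean norm; it carries the values of `X ⊗ X` and of the second level
of a rough path. -/
abbrev Mat (d : ℕ) : Type := EuclideanSpace ℝ (Fin d × Fin d)

/-- `ℝ^{k (ℓ + 1)}` with the Euclidean norm, its vectors being written as `ℓ + 1` blocks of
length `k`. -/
abbrev BlockVec (k ℓ : ℕ) : Type := PiLp 2 (fun _ : Fin (ℓ + 1) => Vec k)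

/-! ### Partitions -/

/-- A finite partition `a = pt 0 < pt 1 < ⋯ < pt n = b` of the interval `[a, b]`. -/
structure IntervalPartition (a b : ℝ) where
  n : ℕ
  pt : Fin (n + 1) → ℝ
  strictMono : StrictMono pt
  first : pt 0 = a
  last : pt (Fin.last n) = b

/-- The mesh of a partition, i.e. the length of its longest interval (`0` if there is none). -/
def IntervalPartition.mesh {a b : ℝ} (P : IntervalPartition a b) : ℝ :=
  ⨆ i : Fin P.n, (P.pt i.succ - P.pt i.castSucc)

/-! ### Càdlàg paths and variation norms -/

section Variation

variable {E : Type*} [NormedAddCommGroup E]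

/-- Right-continuity and existence of left limits on the interval `[a, b]`. -/
def IsCadlagOn (Y : ℝ → E) (a b : ℝ) : Prop :=
  ∀ t ∈ Icc a b, ContinuousWithinAt Y (Icc t b) t ∧ ∃ l : E, Tendsto Y (𝓝[Ico a t] t) (𝓝 l)

/-- The `q`-variation `(sup_P ∑_{[u,v] ∈ P} |G_{u,v}|^q)^{1/q}` over `[s, t]` of a two-parameter
function, as an extended real. -/
def eVar₂ (q : ℝ) (s t : ℝ) (G : ℝ → ℝ → E) : ℝ≥0∞ :=
  (⨆ P : IntervalPartition s t,
    ∑ i : Fin P.n, ‖G (P.pt i.castSucc) (P.pt i.succ)‖ₑ ^ q) ^ (1 / q)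

/-- The increments of a path. -/
def incr (Y : ℝ → E) (s t : ℝ) : E := Y t - Y s

/-- The `q`-variation over `[0, T]` of a two-parameter function (finite for the functions it is
applied to below). -/
def var₂ (q T : ℝ) (G : ℝ → ℝ → E) : ℝ≥0 := (eVar₂ q 0 T G).toNNReal

/-- The `q`-variation over `[0, T]` of a path. -/
def var (q T : ℝ) (Y : ℝ → E) : ℝ≥0 := var₂ q T (incr Y)

/-- Membership in `D^q([0, T]; E)`: càdlàg paths of finite `q`-variation. -/
structure IsD (q T : ℝ) (Y : ℝ → E) : Prop where
  cadlag : IsCadlagOn Y 0 T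
  finite_var : eVar₂ q 0 T (incr Y) ≠ ∞

/-- Membership in `D_2^q(Δ_T; E)`: two-parameter functions on `{0 ≤ s ≤ t ≤ T}` of finite
`q`-variation that are càdlàg in each variable. -/
structure IsD₂ (q T : ℝ) (G : ℝ → ℝ → E) : Prop where
  cadlag_left : ∀ t ∈ Icc 0 T, IsCadlagOn (fun s => G s t) 0 t
  cadlag_right : ∀ s ∈ Icc 0 T, IsCadlagOn (fun t => G s t) s T
  finite_var : eVar₂ q 0 T G ≠ ∞

end Variation

/-! ### Rough paths -/

/-- The pair `(X, 𝕏)` is a càdlàg `p`-rough path over `ℝ^d` on `[0, T]`; the last field is Chen's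
relation. -/
structure IsRoughPath {d : ℕ} (p T : ℝ) (X : ℝ → Vec d) (𝕏 : ℝ → ℝ → Mat d) : Prop where
  path : IsD p T X
  area : IsD₂ (p / 2) T 𝕏
  chen : ∀ s u t : ℝ, 0 ≤ s → s ≤ u → u ≤ t → t ≤ T → ∀ i j : Fin d,
    𝕏 s t (i, j) = 𝕏 s u (i, j) + 𝕏 u t (i, j) + incr X s u i * incr X u t j

/-- The rough path seminorm `‖X‖_p + ‖𝕏‖_{p/2}` over `[0, T]`. -/
def roughNorm {d : ℕ} (p T : ℝ) (X : ℝ → Vec d) (𝕏 : ℝ → ℝ → Mat d) : ℝ≥0 :=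
  var p T X + var₂ (p / 2) T 𝕏

/-! ### Controlled paths -/

section Controlled

variable {d : ℕ} {E : Type*} [NormedAddCommGroup E] [NormedSpace ℝ E]

/-- The remainder `R_{s,t} = Y_{s,t} - Y'_s X_{s,t}`. -/
def remainder (X : ℝ → Vec d) (Y : ℝ → E) (Y' : ℝ → Vec d →L[ℝ] E) (s t : ℝ) : E :=
  incr Y s t - Y' s (incr X s t)

/-- Membership of `(Y, Y')` in `𝒱^p_X([0, T]; E)`: paths controlled by `X`. -/
structure IsControlled (p T : ℝ) (X : ℝ → Vec d) (Y : ℝ → E) (Y' : ℝ → Vec d →L[ℝ] E) :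
    Prop where
  path : IsD p T Y
  deriv : IsD p T Y'
  rem : IsD₂ (p / 2) T (remainder X Y Y')

/-- `‖Y, Y'‖_{X,p} = |Y'_0| + ‖Y'‖_p + ‖R^Y‖_{p/2}` over `[0, T]`. -/
def ctrlNorm (p T : ℝ) (X : ℝ → Vec d) (Y : ℝ → E) (Y' : ℝ → Vec d →L[ℝ] E) : ℝ≥0 :=
  ‖Y' 0‖₊ + var p T Y' + var₂ (p / 2) T (remainder X Y Y')

/-- `‖Y, Y'; Z, Z'‖_{X,p} = |Y'_0 - Z'_0| + ‖Y' - Z'‖_p + ‖R^Y - R^Z‖_{p/2}` over `[0, T]`. -/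
def ctrlDist (p T : ℝ) (X : ℝ → Vec d) (Y : ℝ → E) (Y' : ℝ → Vec d →L[ℝ] E)
    (Z : ℝ → E) (Z' : ℝ → Vec d →L[ℝ] E) : ℝ≥0 :=
  ‖Y' 0 - Z' 0‖₊ + var p T (fun t => Y' t - Z' t)
    + var₂ (p / 2) T (fun s t => remainder X Y Y' s t - remainder X Z Z' s t)

/-- `A` applied to `M ∈ ℝ^{d × d}` under the identification of `ℒ(ℝ^d; ℒ(ℝ^d; E))` with
`ℒ(ℝ^d ⊗ ℝ^d; E)`, in which `e_i ⊗ e_j` is sent to `A e_i e_j`. -/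
def tensorApply (A : Vec d →L[ℝ] Vec d →L[ℝ] E) (M : Mat d) : E :=
  ∑ i : Fin d, ∑ j : Fin d,
    M (i, j) • A (EuclideanSpace.single i (1 : ℝ)) (EuclideanSpace.single j (1 : ℝ))

/-- The compensated left-point sum `∑_{[u,v] ∈ P} (V_u X_{u,v} + V'_u 𝕏_{u,v})`. -/
def compensatedSum (X : ℝ → Vec d) (𝕏 : ℝ → ℝ → Mat d) (V : ℝ → Vec d →L[ℝ] E)
    (V' : ℝ → Vec d →L[ℝ] Vec d →L[ℝ] E) {a b : ℝ} (P : IntervalPartition a b) : E :=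
  ∑ i : Fin P.n, (V (P.pt i.castSucc) (incr X (P.pt i.castSucc) (P.pt i.succ))
    + tensorApply (V' (P.pt i.castSucc)) (𝕏 (P.pt i.castSucc) (P.pt i.succ)))

/-- The (forward) rough integral `∫_a^b V d(X, 𝕏)` exists and equals `I`: the compensated sums
converge to `I` as the mesh of the partition tends to zero. -/
def HasRoughIntegral (X : ℝ → Vec d) (𝕏 : ℝ → ℝ → Mat d) (V : ℝ → Vec d →L[ℝ] E)
    (V' : ℝ → Vec d →L[ℝ] Vec d →L[ℝ] E) (a b : ℝ) (I : E) : Prop :=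
  Tendsto (fun P : IntervalPartition a b => compensatedSum X 𝕏 V V' P)
    (comap IntervalPartition.mesh (𝓝 0)) (𝓝 I)

end Controlled

/-! ### Coefficients of class `C^n_b` -/

section Coefficients

variable {E F : Type*} [NormedAddCommGroup E] [NormedSpace ℝ E]
  [NormedAddCommGroup F] [NormedSpace ℝ F]

/-- `‖D^j f‖_∞` as an extended real. -/
def supDeriv (j : ℕ) (f : E → F) : ℝ≥0∞ := ⨆ x : E, ‖iteratedFDeriv ℝ j f x‖ₑ

/-- Membership in `C^n_b`: `f` is `n` times continuously differentiable, and `f` and its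
derivatives up to order `n` are bounded. -/
structure IsCb (n : ℕ) (f : E → F) : Prop where
  contDiff : ContDiff ℝ n f
  bounded : ∀ j ≤ n, supDeriv j f ≠ ∞

/-- `‖f‖_{C^n_b} = ‖f‖_∞ + ‖D f‖_∞ + ⋯ + ‖D^n f‖_∞`. -/
def cbNorm (n : ℕ) (f : E → F) : ℝ≥0 := (∑ j ∈ Finset.range (n + 1), supDeriv j f).toNNReal

end Coefficients

/-! ### The equation with discrete time dependence -/

section Equation

variable {d k ℓ : ℕ}

/-- The path `s ↦ (Y_s, Y_{s ∧ r_1}, …, Y_{s ∧ r_ℓ})` in `ℝ^{k (ℓ + 1)}`. -/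
def stopped (r : Fin ℓ → ℝ) (Y : ℝ → Vec k) (s : ℝ) : BlockVec k ℓ :=
  WithLp.toLp 2 (Fin.cons (Y s) (fun i => Y (min s (r i))))

/-- The Gubinelli derivative of `stopped r Y`: the block `Y_{s ∧ r_i}` has derivative `Y'_s` for
`s < r_i`, and `0` from time `r_i` on, where the block is constant. -/
def stoppedDeriv (r : Fin ℓ → ℝ) (Y' : ℝ → Vec d →L[ℝ] Vec k) (s : ℝ) :
    Vec d →L[ℝ] BlockVec k ℓ :=
  (PiLp.continuousLinearEquiv 2 ℝ (fun _ : Fin (ℓ + 1) => Vec k)).symm.toContinuousLinearMap ∘L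
    ContinuousLinearMap.pi
      (Fin.cons (Y' s) (fun i => if s < r i then Y' s else 0) :
        Fin (ℓ + 1) → Vec d →L[ℝ] Vec k)

/-- The coefficient `s ↦ f(Y_s, Y_{s ∧ r_1}, …, Y_{s ∧ r_ℓ})` along `Y`. -/
def coeff (f : BlockVec k ℓ → Vec d →L[ℝ] Vec k) (r : Fin ℓ → ℝ) (Y : ℝ → Vec k) (s : ℝ) :
    Vec d →L[ℝ] Vec k :=
  f (stopped r Y s)

/-- The Gubinelli derivative of `coeff f r Y`, given by the chain rule. -/
def coeffDeriv (f : BlockVec k ℓ → Vec d →L[ℝ] Vec k) (r : Fin ℓ → ℝ) (Y : ℝ → Vec k)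
    (Y' : ℝ → Vec d →L[ℝ] Vec k) (s : ℝ) : Vec d →L[ℝ] Vec d →L[ℝ] Vec k :=
  fderiv ℝ f (stopped r Y s) ∘L stoppedDeriv r Y' s

/-- The controlled path `(Y, Y')` solves
`Y_t = y_t + ∫_0^t f(Y_s, Y_{s ∧ r_1}, …, Y_{s ∧ r_ℓ}) d(X, 𝕏)_s`, `t ∈ [0, T]`, with
`Y' = y' + f(Y, Y_{· ∧ r_1}, …, Y_{· ∧ r_ℓ})`. -/
structure IsSolution (p T : ℝ) (X : ℝ → Vec d) (𝕏 : ℝ → ℝ → Mat d) (r : Fin ℓ → ℝ)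
    (f : BlockVec k ℓ → Vec d →L[ℝ] Vec k) (y : ℝ → Vec k) (y' : ℝ → Vec d →L[ℝ] Vec k)
    (Y : ℝ → Vec k) (Y' : ℝ → Vec d →L[ℝ] Vec k) : Prop where
  controlled : IsControlled p T X Y Y'
  deriv_eq : ∀ t ∈ Icc 0 T, Y' t = y' t + coeff f r Y t
  integral_eq : ∀ t ∈ Icc 0 T,
    HasRoughIntegral X 𝕏 (coeff f r Y) (coeffDeriv f r Y Y') 0 t (Y t - y t)

/-- Admissible data: a horizon `T > 0`, a càdlàg `p`-rough path over `ℝ^d`, times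
`r_1 < ⋯ < r_ℓ` in `[0, T]` and a coefficient `f ∈ C^3_b(ℝ^{k (ℓ + 1)}; ℒ(ℝ^d; ℝ^k))`. -/
structure IsData (p T : ℝ) (X : ℝ → Vec d) (𝕏 : ℝ → ℝ → Mat d) (r : Fin ℓ → ℝ)
    (f : BlockVec k ℓ → Vec d →L[ℝ] Vec k) : Prop where
  pos : 0 < T
  rough : IsRoughPath p T X 𝕏
  strictMono : StrictMono r
  mem : ∀ i, r i ∈ Icc 0 T
  coeff_mem : IsCb 3 f

end Equation

end RoughPath

end

open RoughPath

namespace RoughPath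

/-! ### Quantitative bounds for `C^n_b` coefficients -/

section CoeffBounds

variable {E F : Type*} [NormedAddCommGroup E] [NormedSpace ℝ E]
  [NormedAddCommGroup F] [NormedSpace ℝ F]

/-! The rough path is measured by a control `φ`: the variation of `X` and of `𝕏` accumulated on `[0,
t]`, plus the number of times `r i ≤ t`. With the gauge `h = |φ t - φ s| ^ (1 / p)` one has `|X| ≤
h` and `|𝕏| ≤ h ^ 2`, and an interval with `h < 1` crosses no `r i`, so that over it the stopped
state moves by a fixed linear image of the increment of `Y`. There `f(Ȳ)` obeys the usual chain
rule, and Chen's relation makes the germ `V X + V' 𝕏` additive up to an error of order `h ^ 3`.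
Since `3 / p > 1`, such errors can be sewn.

Because of jumps the gauge need not be small on short time intervals, so sewing is done along finite
grids. A grid interval is split at the midpoint of its control into two outer parts, each carrying
at most half of the control, and one single step. The step may carry a large jump, but the scheme is
exact there and it contributes no sewing error (`IsGauge.sewing`). A bootstrap on intervals of small
gauge gives an a priori bound (`exists_apriori_bound`) and a Lipschitz bound
(`exists_lipschitz_bound`) for the discrete scheme. A number of splittings that depends only on the
given bounds then reaches all intervals (`IsGauge.induction`).

The bridge to continuous time is `IsLocalSolution`: the error of the equation over `[s, t]` is `o(φ
t - φ s)` as `t - s → 0`, uniformly. For controlled paths this is the same as being a solution; the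
nontrivial direction rests on `IsRoughPath.exists_sewing_mesh`, where the càdlàg property makes
sewing errors small over short times. Sampled along a grid, a local solution solves the discrete
scheme exactly, with its accumulated errors added to the initial path. Both discrete estimates
therefore pass to solutions as these errors tend to zero.

Uniqueness is the Lipschitz estimate with equal data. For existence, the Euler schemes indexed by
finite sets of times form a Cauchy net, again by the discrete Lipschitz estimate, and their
pointwise limit inherits all the bounds. The exponent enters the constants only through a number `κ
< 1` with `2 ^ (1 - 3 / p) ≤ κ`, which yields uniformity for `p` in compact subsets of `(2, 3)`. -/

theorem norm_iteratedFDeriv_le_cbNorm {n j : ℕ} (hj : j ≤ n) {f : E → F}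
    (hf : ∀ i ≤ n, supDeriv i f ≠ ∞) (x : E) : ‖iteratedFDeriv ℝ j f x‖ ≤ cbNorm n f := by
  have hsum : ∑ i ∈ Finset.range (n + 1), supDeriv i f ≠ ∞ :=
    ENNReal.sum_ne_top.2 fun i hi => hf i (by simpa [Nat.lt_succ_iff] using hi)
  have h1 : ‖iteratedFDeriv ℝ j f x‖ₑ ≤ supDeriv j f :=
    le_iSup (fun x => ‖iteratedFDeriv ℝ j f x‖ₑ) x
  have h2 : supDeriv j f ≤ ∑ i ∈ Finset.range (n + 1), supDeriv i f :=
    Finset.single_le_sum (f := fun i => supDeriv i f) (fun _ _ => zero_le)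
      (Finset.mem_range.2 (Nat.lt_succ_of_le hj))
  have h3 := ENNReal.toNNReal_mono hsum (h1.trans h2)
  have h4 : ‖iteratedFDeriv ℝ j f x‖ₑ.toNNReal = ‖iteratedFDeriv ℝ j f x‖₊ := by simp
  rw [h4] at h3
  exact_mod_cast h3

/-- First order Taylor bound for a function with Lipschitz derivative. -/
theorem taylor_bound {f : E → F} {M : ℝ} (hM : 0 ≤ M) (hd : Differentiable ℝ f)
    (hl : ∀ a b, ‖fderiv ℝ f b - fderiv ℝ f a‖ ≤ M * ‖b - a‖) (a b : E) :
    ‖f b - f a - fderiv ℝ f a (b - a)‖ ≤ M * ‖b - a‖ ^ 2 := by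
  have := (convex_closedBall a ‖b - a‖).norm_image_sub_le_of_norm_hasFDerivWithin_le'
    (f := f) (f' := fderiv ℝ f) (φ := fderiv ℝ f a) (C := M * ‖b - a‖) (x := a) (y := b)
    (fun x _ => (hd x).hasFDerivAt.hasFDerivWithinAt)
    (fun x hx => (hl a x).trans (mul_le_mul_of_nonneg_left (by simpa [dist_eq_norm] using hx) hM))
    (by simp) (by simp [dist_eq_norm])
  calc _ ≤ _ := this
    _ = _ := by ring

theorem lipschitz_of_fderiv_le {f : E → F} {M : ℝ} (hd : Differentiable ℝ f)
    (hl : ∀ a, ‖fderiv ℝ f a‖ ≤ M) (a b : E) : ‖f b - f a‖ ≤ M * ‖b - a‖ :=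
  convex_univ.norm_image_sub_le_of_norm_fderiv_le (fun x _ => hd x) (fun x _ => hl x)
    (mem_univ a) (mem_univ b)

theorem lipschitz_of_iteratedFDeriv_le {f : E → F} {M : ℝ} (hd : Differentiable ℝ f)
    (hl : ∀ a, ‖iteratedFDeriv ℝ 1 f a‖ ≤ M) (a b : E) : ‖f b - f a‖ ≤ M * ‖b - a‖ :=
  lipschitz_of_fderiv_le hd (fun a => by rw [← norm_iteratedFDeriv_one]; exact hl a) a b

/-- Second difference bound. -/
theorem second_difference_bound {f : E → F} {M : ℝ} (hd : Differentiable ℝ f)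
    (h0 : ∀ a, ‖fderiv ℝ f a‖ ≤ M)
    (hl : ∀ a b, ‖fderiv ℝ f b - fderiv ℝ f a‖ ≤ M * ‖b - a‖) (a b a' b' : E) :
    ‖(f b - f a) - (f b' - f a')‖ ≤
      M * (‖(b - a) - (b' - a')‖ + ‖a - a'‖ * ‖b - a‖) := by
  -- Both increments are compared at the same shift `v`: `x ↦ f (x + v) - f x` has derivative at
  -- most `M ‖v‖`, which accounts for the change of base point. What is left is `f (a' + v) - f b'`,
  -- a plain Lipschitz term.
  set v := b - a with hv
  have h1 : ‖(f (a + v) - f a) - (f (a' + v) - f a')‖ ≤ (M * ‖v‖) * ‖a - a'‖ := by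
    have hdv : ∀ x, HasFDerivAt (fun x => f (x + v) - f x)
        (fderiv ℝ f (x + v) - fderiv ℝ f x) x := fun x => by
      have h := ((hd (x + v)).hasFDerivAt.comp x ((hasFDerivAt_id x).add_const v)).sub
        (hd x).hasFDerivAt
      simpa [Function.comp_def, Pi.sub_def] using h
    exact convex_univ.norm_image_sub_le_of_norm_hasFDerivWithin_le
      (f := fun x => f (x + v) - f x) (x := a') (y := a)
      (fun x _ => (hdv x).hasFDerivWithinAt)
      (fun x _ => by simpa using hl x (x + v)) (mem_univ _) (mem_univ _)
  have h2 : ‖f (a' + v) - f b'‖ ≤ M * ‖v - (b' - a')‖ := by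
    have := lipschitz_of_fderiv_le hd h0 b' (a' + v)
    rwa [show a' + v - b' = v - (b' - a') by abel] at this
  have h3 : f b = f (a + v) := by rw [hv]; congr 1; abel
  calc ‖(f b - f a) - (f b' - f a')‖
      = ‖((f (a + v) - f a) - (f (a' + v) - f a')) + (f (a' + v) - f b')‖ := by
        rw [h3]; congr 1; abel
    _ ≤ (M * ‖v‖) * ‖a - a'‖ + M * ‖v - (b' - a')‖ := (norm_add_le _ _).trans (add_le_add h1 h2)
    _ = _ := by ring

/-- Lipschitz bound for the first order Taylor remainder. -/
theorem taylor_difference_bound {f : E → F} {M : ℝ} (hM : 0 ≤ M) (hd : Differentiable ℝ f)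
    (hd1 : Differentiable ℝ (fderiv ℝ f))
    (h1 : ∀ a, ‖fderiv ℝ (fderiv ℝ f) a‖ ≤ M)
    (h2 : ∀ a b, ‖fderiv ℝ (fderiv ℝ f) b - fderiv ℝ (fderiv ℝ f) a‖ ≤ M * ‖b - a‖)
    (a b a' b' : E) :
    ‖(f b - f a - fderiv ℝ f a (b - a)) - (f b' - f a' - fderiv ℝ f a' (b' - a'))‖ ≤
      M * (‖a - a'‖ * ‖b - a‖ ^ 2 + (‖b - a‖ + ‖b' - a'‖) * ‖(b - a) - (b' - a')‖) := by
  set v := b - a with hv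
  set v' := b' - a' with hv'
  have hline : ∀ (c u : E) (s : ℝ), HasDerivAt (fun s : ℝ => f (c + s • u))
      (fderiv ℝ f (c + s • u) u) s := fun c u s => by
    have h := (hd (c + s • u)).hasFDerivAt.comp_hasDerivAt s
      (((hasDerivAt_id s).smul_const u).const_add c)
    simpa [Function.comp_def] using h
  -- The difference of the two Taylor remainders is the increment over `[0, 1]` of this function of
  -- `s`. Its derivative involves second differences of `fderiv ℝ f` only, so the previous bound
  -- applies with `f` replaced by its derivative.
  have hder : ∀ s : ℝ, HasDerivAt
      (fun s : ℝ => (f (a + s • v) - s • fderiv ℝ f a v) - (f (a' + s • v') - s • fderiv ℝ f a' v'))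
      ((fderiv ℝ f (a + s • v) v - fderiv ℝ f a v)
        - (fderiv ℝ f (a' + s • v') v' - fderiv ℝ f a' v')) s := fun s => by
    have e1 := (hline a v s).sub ((hasDerivAt_id s).smul_const (fderiv ℝ f a v))
    have e2 := (hline a' v' s).sub ((hasDerivAt_id s).smul_const (fderiv ℝ f a' v'))
    simpa [Pi.sub_def] using e1.sub e2
  have key := norm_image_sub_le_of_norm_deriv_le_segment_01'
    (C := M * (‖a - a'‖ * ‖v‖ ^ 2 + (‖v‖ + ‖v'‖) * ‖v - v'‖))
    (fun s _ => (hder s).hasDerivWithinAt) (fun s hs => by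
      have hs0 : 0 ≤ s := hs.1
      have hs1 : s ≤ 1 := hs.2.le
      have e1 := second_difference_bound hd1 h1 h2 a (a + s • v) a' (a' + s • v')
      have e2 := lipschitz_of_fderiv_le hd1 h1 a' (a' + s • v')
      have e3 : ‖a + s • v - a - (a' + s • v' - a')‖ ≤ ‖v - v'‖ := by
        rw [show a + s • v - a - (a' + s • v' - a') = s • (v - v') by module,
          norm_smul, Real.norm_of_nonneg hs0]
        exact mul_le_of_le_one_left (norm_nonneg _) hs1
      have e4 : ‖a + s • v - a‖ ≤ ‖v‖ := by
        rw [add_sub_cancel_left, norm_smul, Real.norm_of_nonneg hs0]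
        exact mul_le_of_le_one_left (norm_nonneg _) hs1
      have e5 : ‖a' + s • v' - a'‖ ≤ ‖v'‖ := by
        rw [add_sub_cancel_left, norm_smul, Real.norm_of_nonneg hs0]
        exact mul_le_of_le_one_left (norm_nonneg _) hs1
      have e6 : (fderiv ℝ f (a + s • v) v - fderiv ℝ f a v)
          - (fderiv ℝ f (a' + s • v') v' - fderiv ℝ f a' v')
          = ((fderiv ℝ f (a + s • v) - fderiv ℝ f a)
            - (fderiv ℝ f (a' + s • v') - fderiv ℝ f a')) v
            + (fderiv ℝ f (a' + s • v') - fderiv ℝ f a') (v - v') := by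
        simp only [map_sub, _root_.sub_apply]; abel
      rw [e6]
      have e7 : M * (‖a + s • v - a - (a' + s • v' - a')‖ + ‖a - a'‖ * ‖a + s • v - a‖)
          ≤ M * (‖v - v'‖ + ‖a - a'‖ * ‖v‖) := by gcongr
      have e8 : M * ‖a' + s • v' - a'‖ ≤ M * ‖v'‖ := by gcongr
      calc _ ≤ _ := norm_add_le _ _
        _ ≤ (M * (‖v - v'‖ + ‖a - a'‖ * ‖v‖)) * ‖v‖ + (M * ‖v'‖) * ‖v - v'‖ :=
          add_le_add (ContinuousLinearMap.le_of_opNorm_le _ (e1.trans e7) _)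
            (ContinuousLinearMap.le_of_opNorm_le _ (e2.trans e8) _)
        _ = _ := by ring)
  have e1 : b = a + v := by rw [hv]; abel
  have e2 : b' = a' + v' := by rw [hv']; abel
  refine le_trans (le_of_eq ?_) key
  simp only [one_smul, zero_smul, add_zero, sub_zero, ← e1, ← e2]
  congr 1; abel

/-- Bounds satisfied by a `C^2_b` function of norm at most `M`. -/
structure Bounds₂ (M : ℝ) (f : E → F) : Prop where
  val : ∀ a, ‖f a‖ ≤ M
  deriv : ∀ a, ‖fderiv ℝ f a‖ ≤ M
  lip : ∀ a b, ‖f b - f a‖ ≤ M * ‖b - a‖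
  deriv_lip : ∀ a b, ‖fderiv ℝ f b - fderiv ℝ f a‖ ≤ M * ‖b - a‖
  taylor : ∀ a b, ‖f b - f a - fderiv ℝ f a (b - a)‖ ≤ M * ‖b - a‖ ^ 2

/-- Bounds satisfied by a `C^3_b` function of norm at most `M`. -/
structure Bounds₃ (M : ℝ) (f : E → F) : Prop extends Bounds₂ M f where
  diff : ∀ a b a' b', ‖(f b - f a) - (f b' - f a')‖ ≤
    M * (‖(b - a) - (b' - a')‖ + ‖a - a'‖ * ‖b - a‖)
  deriv_diff : ∀ a b a' b',
    ‖(fderiv ℝ f b - fderiv ℝ f a) - (fderiv ℝ f b' - fderiv ℝ f a')‖ ≤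
    M * (‖(b - a) - (b' - a')‖ + ‖a - a'‖ * ‖b - a‖)
  taylor_diff : ∀ a b a' b',
    ‖(f b - f a - fderiv ℝ f a (b - a)) - (f b' - f a' - fderiv ℝ f a' (b' - a'))‖ ≤
      M * (‖a - a'‖ * ‖b - a‖ ^ 2 + (‖b - a‖ + ‖b' - a'‖) * ‖(b - a) - (b' - a')‖)

theorem IsCb.bounds₂ {f : E → F} (hf : IsCb 3 f) {M : ℝ} (hM : cbNorm 2 f ≤ M) :
    Bounds₂ M f := by
  have hb : ∀ j ≤ 2, ∀ x, ‖iteratedFDeriv ℝ j f x‖ ≤ M := fun j hj x =>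
    (norm_iteratedFDeriv_le_cbNorm hj (fun i hi => hf.bounded i (by omega)) x).trans hM
  have hM0 : 0 ≤ M := (NNReal.coe_nonneg _).trans hM
  have d0 : Differentiable ℝ f := hf.contDiff.differentiable (by norm_num)
  have c1 : ContDiff ℝ 2 (fderiv ℝ f) := hf.contDiff.fderiv_right (by norm_num)
  have d1 : Differentiable ℝ (fderiv ℝ f) := c1.differentiable (by norm_num)
  have b1 : ∀ a, ‖fderiv ℝ f a‖ ≤ M := fun a => by
    simpa [← norm_iteratedFDeriv_fderiv] using hb 1 (by norm_num) a
  have b2 : ∀ a, ‖fderiv ℝ (fderiv ℝ f) a‖ ≤ M := fun a => by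
    have := hb 2 (by norm_num) a
    rw [← norm_iteratedFDeriv_fderiv, ← norm_iteratedFDeriv_fderiv,
      norm_iteratedFDeriv_zero] at this
    exact this
  have l1 := fun a b => lipschitz_of_fderiv_le d1 b2 a b
  exact ⟨fun a => by simpa using hb 0 (by norm_num) a, b1,
    fun a b => lipschitz_of_fderiv_le d0 b1 a b, l1, fun a b => taylor_bound hM0 d0 l1 a b⟩

theorem cbNorm_mono {f : E → F} (hf : IsCb 3 f) : cbNorm 2 f ≤ cbNorm 3 f := by
  refine ENNReal.toNNReal_mono (ENNReal.sum_ne_top.2 fun i hi => hf.bounded i ?_) ?_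
  · simpa [Nat.lt_succ_iff] using hi
  · exact Finset.sum_le_sum_of_subset (Finset.range_mono (by norm_num))

theorem IsCb.bounds₃ {f : E → F} (hf : IsCb 3 f) {M : ℝ} (hM : cbNorm 3 f ≤ M) :
    Bounds₃ M f := by
  have hb : ∀ j ≤ 3, ∀ x, ‖iteratedFDeriv ℝ j f x‖ ≤ M := fun j hj x =>
    (norm_iteratedFDeriv_le_cbNorm hj (fun i hi => hf.bounded i (by omega)) x).trans hM
  have hM0 : 0 ≤ M := (NNReal.coe_nonneg _).trans hM
  have B := hf.bounds₂ ((NNReal.coe_le_coe.2 (cbNorm_mono hf)).trans hM)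
  have d0 : Differentiable ℝ f := hf.contDiff.differentiable (by norm_num)
  have c1 : ContDiff ℝ 2 (fderiv ℝ f) := hf.contDiff.fderiv_right (by norm_num)
  have d1 : Differentiable ℝ (fderiv ℝ f) := c1.differentiable (by norm_num)
  have c2 : ContDiff ℝ 1 (fderiv ℝ (fderiv ℝ f)) := c1.fderiv_right (by norm_num)
  have d2 : Differentiable ℝ (fderiv ℝ (fderiv ℝ f)) := c2.differentiable (by norm_num)
  have b2 : ∀ a, ‖fderiv ℝ (fderiv ℝ f) a‖ ≤ M := fun a => by
    have := hb 2 (by norm_num) a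
    rw [← norm_iteratedFDeriv_fderiv, ← norm_iteratedFDeriv_fderiv,
      norm_iteratedFDeriv_zero] at this
    exact this
  have b3 : ∀ a, ‖iteratedFDeriv ℝ 1 (fderiv ℝ (fderiv ℝ f)) a‖ ≤ M := fun a => by
    have := hb 3 (by norm_num) a
    rwa [← norm_iteratedFDeriv_fderiv, ← norm_iteratedFDeriv_fderiv] at this
  have l2 := fun a b => lipschitz_of_iteratedFDeriv_le d2 b3 a b
  exact ⟨B, fun a b a' b' => second_difference_bound d0 B.deriv B.deriv_lip a b a' b',
    fun a b a' b' => second_difference_bound d1 b2 l2 a b a' b',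
    fun a b a' b' => taylor_difference_bound hM0 d0 d1 b2 l2 a b a' b'⟩

end CoeffBounds

end RoughPath

namespace RoughPath

/-! ### The contraction `tensorApply` and the local germ -/

section Germ

variable {d : ℕ} {E : Type*} [NormedAddCommGroup E] [NormedSpace ℝ E]

theorem tensorApply_sub_left (A A' : Vec d →L[ℝ] Vec d →L[ℝ] E) (M : Mat d) :
    tensorApply (A - A') M = tensorApply A M - tensorApply A' M := by
  simp only [tensorApply, _root_.sub_apply, smul_sub, Finset.sum_sub_distrib]

theorem norm_tensorApply_le (A : Vec d →L[ℝ] Vec d →L[ℝ] E) (M : Mat d) :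
    ‖tensorApply A M‖ ≤ (d : ℝ) ^ 2 * ‖A‖ * ‖M‖ := by
  have h : ∀ i j : Fin d, ‖M (i, j) • A (EuclideanSpace.single i (1 : ℝ))
      (EuclideanSpace.single j (1 : ℝ))‖ ≤ ‖A‖ * ‖M‖ := fun i j => by
    rw [norm_smul, mul_comm]
    refine mul_le_mul ?_ (PiLp.norm_apply_le M (i, j)) (norm_nonneg _) (norm_nonneg A)
    simpa using A.le_opNorm₂ (EuclideanSpace.single i (1 : ℝ)) (EuclideanSpace.single j (1 : ℝ))
  calc ‖tensorApply A M‖ ≤ ∑ _i : Fin d, ∑ _j : Fin d, ‖A‖ * ‖M‖ :=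
        (norm_sum_le _ _).trans (Finset.sum_le_sum fun i _ =>
          (norm_sum_le _ _).trans (Finset.sum_le_sum fun j _ => h i j))
    _ = _ := by simp; ring

theorem norm_tensorApply_le_of_le {A : Vec d →L[ℝ] Vec d →L[ℝ] E} {M : Mat d} {a m : ℝ}
    (hA : ‖A‖ ≤ a) (hM : ‖M‖ ≤ m) : ‖tensorApply A M‖ ≤ (d : ℝ) ^ 2 * a * m := by
  refine (norm_tensorApply_le A M).trans ?_
  have := (norm_nonneg A).trans hA
  gcongr

theorem tensorApply_chen (A : Vec d →L[ℝ] Vec d →L[ℝ] E) {M M₁ M₂ : Mat d} {u v : Vec d}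
    (h : ∀ i j, M (i, j) = M₁ (i, j) + M₂ (i, j) + u i * v j) :
    tensorApply A M = tensorApply A M₁ + tensorApply A M₂ + A u v := by
  have hu : ∀ w : Vec d, w = ∑ i, w i • EuclideanSpace.single i (1 : ℝ) := fun w => by
    ext j; simp [Pi.single_apply]
  have : A u v = ∑ i, ∑ j, (u i * v j) • A (EuclideanSpace.single i (1 : ℝ))
      (EuclideanSpace.single j (1 : ℝ)) := by
    conv_lhs => rw [hu u, hu v]
    simp only [map_sum, map_smul, _root_.sum_apply, Finset.smul_sum, smul_smul,
      _root_.smul_apply]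
    rw [Finset.sum_comm]
    refine Finset.sum_congr rfl fun i _ => Finset.sum_congr rfl fun j _ => ?_
    rw [mul_comm]
  rw [this]
  simp only [tensorApply, h, add_smul, Finset.sum_add_distrib]

/-- The local approximation `V_i X_{i,j} + V'_i 𝕏_{i,j}` of the rough integral. -/
noncomputable def germ {ι : Type*} (x : ι → Vec d) (𝕩 : ι → ι → Mat d) (V : ι → Vec d →L[ℝ] E)
    (V' : ι → Vec d →L[ℝ] Vec d →L[ℝ] E) (i j : ι) : E :=
  V i (x j - x i) + tensorApply (V' i) (𝕩 i j)

/-- Chen's relation produces the cross term `V' i (x m - x i) (x j - x m)`, which is exactly the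
first-order part of the increment of `V`. What survives has order 2 + 1 and 1 + 2 in the gauge. -/
theorem germ_defect {ι : Type*} {x : ι → Vec d} {𝕩 : ι → ι → Mat d} (V : ι → Vec d →L[ℝ] E)
    (V' : ι → Vec d →L[ℝ] Vec d →L[ℝ] E) {i m j : ι}
    (h : ∀ a b, 𝕩 i j (a, b) = 𝕩 i m (a, b) + 𝕩 m j (a, b) + (x m - x i) a * (x j - x m) b) :
    germ x 𝕩 V V' i m + germ x 𝕩 V V' m j - germ x 𝕩 V V' i j =
      (V m - V i - V' i (x m - x i)) (x j - x m) + tensorApply (V' m - V' i) (𝕩 m j) := by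
  simp only [germ]
  rw [tensorApply_chen (V' i) h, tensorApply_sub_left,
    show x j - x i = (x j - x m) + (x m - x i) by abel]
  simp only [map_add, _root_.sub_apply]
  abel

theorem germ_self {ι : Type*} {x : ι → Vec d} {𝕩 : ι → ι → Mat d} (V : ι → Vec d →L[ℝ] E)
    (V' : ι → Vec d →L[ℝ] Vec d →L[ℝ] E) {i : ι} (h : 𝕩 i i = 0) :
    germ x 𝕩 V V' i i = 0 := by
  simp [germ, h, tensorApply]

theorem norm_comp₃_le {E₁ E₂ E₃ E₄ : Type*} [NormedAddCommGroup E₁] [NormedSpace ℝ E₁]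
    [NormedAddCommGroup E₂] [NormedSpace ℝ E₂] [NormedAddCommGroup E₃] [NormedSpace ℝ E₃]
    [NormedAddCommGroup E₄] [NormedSpace ℝ E₄] {A : E₃ →L[ℝ] E₄} {B : E₂ →L[ℝ] E₃}
    {C : E₁ →L[ℝ] E₂} {a b c : ℝ} (hA : ‖A‖ ≤ a) (hB : ‖B‖ ≤ b) (hC : ‖C‖ ≤ c) :
    ‖A ∘L (B ∘L C)‖ ≤ a * (b * c) := by
  have ha := (norm_nonneg A).trans hA
  have hb := (norm_nonneg B).trans hB
  refine (ContinuousLinearMap.opNorm_comp_le _ _).trans ?_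
  refine mul_le_mul hA ?_ (norm_nonneg _) ha
  exact (ContinuousLinearMap.opNorm_comp_le _ _).trans (mul_le_mul hB hC (norm_nonneg _) hb)

end Germ

/-! ### Gauges and discrete sewing -/

/-- A gauge on the intervals of `ℕ`: a nonnegative monotone function of intervals, every
nontrivial interval `[i, j]` splitting as `[i, m] ∪ [m, m + 1] ∪ [m + 1, j]` with the third power
of the gauge of the two outer parts smaller by the factor `κ / 2`. -/
structure IsGauge (κ : ℝ) (h : ℕ → ℕ → ℝ) : Prop where
  nonneg : ∀ i j, 0 ≤ h i j
  self : ∀ i, h i i = 0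
  mono : ∀ {i i' j' j}, i ≤ i' → i' ≤ j' → j' ≤ j → h i' j' ≤ h i j
  split : ∀ {i j}, i < j → ∃ m, i ≤ m ∧ m < j ∧ h i m ^ 3 ≤ κ / 2 * h i j ^ 3 ∧
    h (m + 1) j ^ 3 ≤ κ / 2 * h i j ^ 3

theorem IsGauge.weaken {κ κ' : ℝ} {h : ℕ → ℕ → ℝ} (hg : IsGauge κ h) (hκ : κ ≤ κ') :
    IsGauge κ' h := by
  refine ⟨hg.nonneg, hg.self, hg.mono, fun {i j} hij => ?_⟩
  obtain ⟨m, h1, h2, h3, h4⟩ := hg.split hij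
  have := pow_nonneg (hg.nonneg i j) 3
  have h5 : κ / 2 * h i j ^ 3 ≤ κ' / 2 * h i j ^ 3 := by gcongr
  exact ⟨m, h1, h2, h3.trans h5, h4.trans h5⟩

/-- The interval is cut at the step `[m, m + 1]` where `φ` crosses the midpoint of its values at the
ends; each outer part then has at most half the control. Halving multiplies the cube of the gauge by
`2 ^ (-3 * β) = κ / 2`, and `κ < 1` precisely when `3 * β > 1`. Nothing is claimed about the middle
step, which may carry a jump. -/
theorem isGauge_rpow {φ : ℕ → ℝ} (hφ : Monotone φ) {β : ℝ} (hβ : 0 < β) :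
    IsGauge (2 ^ (1 - 3 * β)) (fun i j => |φ j - φ i| ^ β) := by
  have half : ∀ {x y : ℝ}, 0 ≤ x → 0 ≤ y → x ≤ y / 2 →
      (x ^ β) ^ 3 ≤ 2 ^ (1 - 3 * β) / 2 * (y ^ β) ^ 3 := fun {x y} hx hy hxy => by
    have e : ∀ z : ℝ, 0 ≤ z → (z ^ β) ^ 3 = z ^ (3 * β) := fun z hz => by
      rw [← Real.rpow_natCast, ← Real.rpow_mul hz]; norm_num [mul_comm]
    rw [e x hx, e y hy, Real.rpow_sub two_pos, Real.rpow_one]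
    calc x ^ (3 * β) ≤ (y / 2) ^ (3 * β) := Real.rpow_le_rpow hx hxy (by positivity)
      _ = _ := by rw [Real.div_rpow hy two_pos.le]; ring
  refine ⟨fun i j => by positivity, fun i => by simp [hβ.ne'], fun {i i' j' j} h1 h2 h3 => ?_, fun {i j} hij => ?_⟩
  · refine Real.rpow_le_rpow (abs_nonneg _) ?_ hβ.le
    have a1 := hφ h1
    have a2 := hφ h2
    have a3 := hφ h3
    rw [abs_of_nonneg (by linarith), abs_of_nonneg (by linarith)]
    linarith
  · have : ∃ m, i ≤ m ∧ m < j ∧ φ m ≤ (φ i + φ j) / 2 ∧ (φ i + φ j) / 2 ≤ φ (m + 1) := by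
      have hij' := hφ hij.le
      by_contra! hcon
      have : ∀ m, i ≤ m → m < j → φ m ≤ (φ i + φ j) / 2 ∧ φ (m + 1) < (φ i + φ j) / 2 := by
        intro m him
        induction m, him using Nat.le_induction with
        | base => exact fun h => ⟨by linarith, hcon i le_rfl h (by linarith)⟩
        | succ m him ih =>
          intro h
          have := (ih (by omega)).2.le
          exact ⟨this, hcon (m + 1) (by omega) h this⟩
      have h1 := (this (j - 1) (by omega) (by omega)).2
      rw [Nat.sub_add_cancel (by omega)] at h1
      linarith
    obtain ⟨m, h1, h2, h3, h4⟩ := this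
    have a1 := hφ h1
    have a2 := hφ (Nat.succ_le_of_lt h2)
    have a3 := hφ hij.le
    simp only [Nat.succ_eq_add_one] at a2
    refine ⟨m, h1, h2, half (abs_nonneg _) (abs_nonneg _) ?_, half (abs_nonneg _) (abs_nonneg _) ?_⟩
    · rw [abs_of_nonneg (by linarith), abs_of_nonneg (by linarith)]; linarith
    · rw [abs_of_nonneg (by linarith), abs_of_nonneg (by linarith)]; linarith

section Sewing

variable {E : Type*} [NormedAddCommGroup E]

/-- Discrete sewing with a bootstrap: the bound on the defect of `J` may use the conclusion on the
left part of the interval. -/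
theorem IsGauge.sewing {κ K Λ : ℝ} {h : ℕ → ℕ → ℝ} (hg : IsGauge κ h) (hΛ : 0 ≤ Λ) (hK : 0 ≤ K)
    (hKΛ : 2 * K ≤ (1 - κ) * Λ) {J : ℕ → ℕ → E} (h0 : ∀ i, J i i = 0)
    (h1 : ∀ i, J i (i + 1) = 0) {a b : ℕ}
    (hdef : ∀ i m j, a ≤ i → i ≤ m → m ≤ j → j ≤ b → ‖J i m‖ ≤ Λ * h i m ^ 3 →
      ‖J i j - J i m - J m j‖ ≤ K * h i j ^ 3) :
    ∀ i j, a ≤ i → i ≤ j → j ≤ b → ‖J i j‖ ≤ Λ * h i j ^ 3 := by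
  have main : ∀ n i j, j - i = n → a ≤ i → i ≤ j → j ≤ b → ‖J i j‖ ≤ Λ * h i j ^ 3 := by
    intro n
    induction n using Nat.strong_induction_on with
    | _ n ih =>
      intro i j hn hai hij hjb
      have hnn : ∀ i j, 0 ≤ h i j ^ 3 := fun i j => pow_nonneg (hg.nonneg i j) 3
      rcases hij.eq_or_lt with rfl | hlt
      · rw [h0, norm_zero]; exact mul_nonneg hΛ (hnn _ _)
      obtain ⟨m, him, hmj, s1, s2⟩ := hg.split hlt
      have b1 := ih (m - i) (by omega) i m rfl hai him (by omega)
      have b2 := ih (j - (m + 1)) (by omega) (m + 1) j rfl (by omega) hmj hjb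
      have d1 := hdef i m j hai him hmj.le hjb b1
      have d2 := hdef m (m + 1) j (by omega) (by omega) hmj hjb
        (by rw [h1, norm_zero]; exact mul_nonneg hΛ (hnn _ _))
      have hmono : h m j ^ 3 ≤ h i j ^ 3 := by
        have := hg.nonneg m j
        have := hg.mono him hmj.le (le_refl j)
        gcongr
      -- Two defects occur, at `m` in `[i, j]` and at `m + 1` in `[m, j]`, while the middle step
      -- contributes zero. The induction closes because `2 * K + κ * Λ ≤ Λ`; the hypothesis that the
      -- defect bound requires on `[i, m]` is the induction hypothesis itself.
      have e : J i j = (J i j - J i m - J m j) + (J m j - J m (m + 1) - J (m + 1) j)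
          + J i m + J (m + 1) j := by rw [h1]; abel
      rw [e]
      calc _ ≤ K * h i j ^ 3 + K * h m j ^ 3 + Λ * h i m ^ 3 + Λ * h (m + 1) j ^ 3 :=
            (norm_add_le _ _).trans (add_le_add ((norm_add_le _ _).trans (add_le_add
              ((norm_add_le _ _).trans (add_le_add d1 d2)) b1)) b2)
        _ ≤ K * h i j ^ 3 + K * h i j ^ 3 + Λ * (κ / 2 * h i j ^ 3) + Λ * (κ / 2 * h i j ^ 3) := by
            gcongr
        _ = (2 * K + κ * Λ) * h i j ^ 3 := by ring
        _ ≤ ((1 - κ) * Λ + κ * Λ) * h i j ^ 3 := by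
            have := hnn i j
            gcongr
        _ = _ := by ring
  exact fun i j => main _ i j rfl

/-- Every property of intervals that holds on short intervals (`h ≤ δ`), on one-step intervals,
and is inherited from the three parts of a splitting with loss of one unit, holds globally with a
controlled number of units. -/
theorem IsGauge.induction {κ δ H : ℝ} {h : ℕ → ℕ → ℝ} (hg : IsGauge κ h) (hκ : 0 ≤ κ) {n : ℕ}
    (hn : (κ / 2) ^ n * H ^ 3 ≤ δ ^ 3) (hδ : 0 ≤ δ) (hH : ∀ i j, i ≤ j → h i j ≤ H)
    {P : ℕ → ℕ → ℕ → Prop}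
    (short : ∀ i j, i ≤ j → h i j ≤ δ → ∀ n, P n i j) (one : ∀ i n, P n i (i + 1))
    (glue : ∀ n i m j, i ≤ m → m + 1 ≤ j → P n i m → P n m (m + 1) → P n (m + 1) j →
      P (n + 1) i j) {i j : ℕ} (hij : i ≤ j) : P n i j := by
  -- The bound is weighted by `(κ / 2) ^ n`: one splitting gains a factor `κ / 2` on the outer parts
  -- and uses up one unit of `n`.
  have main : ∀ n i j, i ≤ j → (κ / 2) ^ n * h i j ^ 3 ≤ δ ^ 3 → P n i j := by
    intro n
    induction n with
    | zero =>
      intro i j hij hh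
      exact short i j hij (le_of_pow_le_pow_left₀ (n := 3) (by norm_num) hδ (by simpa using hh)) _
    | succ n ih =>
      intro i j hij hh
      rcases hij.eq_or_lt with rfl | hlt
      · exact short i i le_rfl (by rw [hg.self]; exact hδ) _
      obtain ⟨m, him, hmj, s1, s2⟩ := hg.split hlt
      have hk : 0 ≤ (κ / 2) ^ n := by positivity
      refine glue n i m j him hmj (ih i m him ?_) (one m n) (ih (m + 1) j hmj ?_)
      · calc _ ≤ (κ / 2) ^ n * (κ / 2 * h i j ^ 3) := by gcongr
          _ = (κ / 2) ^ (n + 1) * h i j ^ 3 := by ring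
          _ ≤ _ := hh
      · calc _ ≤ (κ / 2) ^ n * (κ / 2 * h i j ^ 3) := by gcongr
          _ = (κ / 2) ^ (n + 1) * h i j ^ 3 := by ring
          _ ≤ _ := hh
  refine main n i j hij (le_trans ?_ hn)
  have := hg.nonneg i j
  have := hH i j hij
  gcongr

end Sewing

end RoughPath

/-! ### The discrete scheme: chain rule, germ defect and a priori estimate -/

namespace RoughPath

section Discrete

variable {d : ℕ} {E F : Type*} [NormedAddCommGroup E] [NormedSpace ℝ E]
  [NormedAddCommGroup F] [NormedSpace ℝ F]

theorem Bounds₂.mono {M M' : ℝ} {f : E → F} (hf : Bounds₂ M f) (h : M ≤ M') : Bounds₂ M' f :=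
  ⟨fun a => (hf.val a).trans h, fun a => (hf.deriv a).trans h,
    fun a b => (hf.lip a b).trans (by gcongr), fun a b => (hf.deriv_lip a b).trans (by gcongr),
    fun a b => (hf.taylor a b).trans (by gcongr)⟩

theorem Bounds₃.mono {M M' : ℝ} {f : E → F} (hf : Bounds₃ M f) (h : M ≤ M') : Bounds₃ M' f :=
  ⟨hf.toBounds₂.mono h, fun a b a' b' => (hf.diff a b a' b').trans (by gcongr),
    fun a b a' b' => (hf.deriv_diff a b a' b').trans (by gcongr),
    fun a b a' b' => (hf.taylor_diff a b a' b').trans (by gcongr)⟩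

/-- A rough driver along a sequence of times, with increments controlled by the gauge `h`, and
embeddings `L i` which do not change over intervals of gauge less than one. -/
structure Driver (B κ : ℝ) (h : ℕ → ℕ → ℝ) (x : ℕ → Vec d) (𝕩 : ℕ → ℕ → Mat d)
    (L : ℕ → E →L[ℝ] F) : Prop where
  gauge : IsGauge κ h
  gauge_le : ∀ i j, i ≤ j → h i j ≤ B
  path_le : ∀ i j, i ≤ j → ‖x j - x i‖ ≤ h i j
  area_le : ∀ i j, i ≤ j → ‖𝕩 i j‖ ≤ h i j ^ 2
  chen : ∀ i m j, i ≤ m → m ≤ j → ∀ a b,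
    𝕩 i j (a, b) = 𝕩 i m (a, b) + 𝕩 m j (a, b) + (x m - x i) a * (x j - x m) b
  embed_le : ∀ i, ‖L i‖ ≤ B
  embed_const : ∀ i j, i ≤ j → h i j < 1 → L j = L i

/-- A discrete controlled path with bounds in terms of the gauge `h`. -/
structure GaugeControlled (B : ℝ) (h : ℕ → ℕ → ℝ) (x : ℕ → Vec d) (Y : ℕ → E)
    (Y' : ℕ → Vec d →L[ℝ] E) : Prop where
  deriv_le : ∀ i, ‖Y' i‖ ≤ B
  deriv_incr : ∀ i j, i ≤ j → ‖Y' j - Y' i‖ ≤ B * h i j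
  rem : ∀ i j, i ≤ j → ‖Y j - Y i - Y' i (x j - x i)‖ ≤ B * h i j ^ 2

theorem GaugeControlled.mono {B B' : ℝ} {h : ℕ → ℕ → ℝ} (h0 : ∀ i j, 0 ≤ h i j) {x : ℕ → Vec d}
    {Y : ℕ → E} {Y' : ℕ → Vec d →L[ℝ] E} (hY : GaugeControlled B h x Y Y') (hB : B ≤ B') :
    GaugeControlled B' h x Y Y' :=
  ⟨fun i => (hY.deriv_le i).trans hB, fun i j hij => (hY.deriv_incr i j hij).trans (by
    have := h0 i j; gcongr), fun i j hij => (hY.rem i j hij).trans (by have := h0 i j; gcongr)⟩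

/-- The state `Ȳ` moves by the embedded increments of `Y`. -/
def IsState (L : ℕ → E →L[ℝ] F) (Y : ℕ → E) (Yb : ℕ → F) : Prop :=
  ∀ m, Yb (m + 1) - Yb m = L m (Y (m + 1) - Y m)

theorem IsState.incr {L : ℕ → E →L[ℝ] F} {Y : ℕ → E} {Yb : ℕ → F} (hs : IsState L Y Yb) {i j : ℕ}
    (hij : i ≤ j) (hL : ∀ m, i ≤ m → m < j → L m = L i) : Yb j - Yb i = L i (Y j - Y i) := by
  induction j, hij using Nat.le_induction with
  | base => simp
  | succ j hij ih =>
    have h1 := ih fun m h1 h2 => hL m h1 (by omega)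
    have h2 := hs j
    rw [hL j hij (by omega)] at h2
    calc Yb (j + 1) - Yb i = (Yb (j + 1) - Yb j) + (Yb j - Yb i) := by abel
      _ = _ := by rw [h1, h2, ← map_add]; congr 1; abel

theorem Driver.state_incr {B κ : ℝ} {h : ℕ → ℕ → ℝ} {x : ℕ → Vec d} {𝕩 : ℕ → ℕ → Mat d}
    {L : ℕ → E →L[ℝ] F} (D : Driver B κ h x 𝕩 L) {Y : ℕ → E} {Yb : ℕ → F} (hs : IsState L Y Yb)
    {i j : ℕ} (hij : i ≤ j) (hh : h i j < 1) : Yb j - Yb i = L i (Y j - Y i) :=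
  hs.incr hij fun m h1 h2 =>
    D.embed_const i m h1 ((D.gauge.mono le_rfl h1 h2.le).trans_lt hh)

/-- The Gubinelli derivative of `f(Ȳ)`. -/
noncomputable def chainDeriv {ι : Type*} (f : F → Vec d →L[ℝ] E) (L : ι → E →L[ℝ] F) (Yb : ι → F)
    (Y' : ι → Vec d →L[ℝ] E) (i : ι) : Vec d →L[ℝ] Vec d →L[ℝ] E :=
  fderiv ℝ f (Yb i) ∘L (L i ∘L Y' i)

/-- Controlledness of the composition with `f` over one interval. -/
theorem chain_rule_bound {B : ℝ} (hB : 0 ≤ B) {f : F → Vec d →L[ℝ] E} (hf : Bounds₂ B f)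
    {L : E →L[ℝ] F} (hL : ‖L‖ ≤ B) {a : ℝ} (ha : 0 ≤ a) (haB : a ≤ B) {ξ : Vec d} (hξ : ‖ξ‖ ≤ a)
    {Y₀ Y₁ : E} {Y₀' Y₁' : Vec d →L[ℝ] E} {Yb₀ Yb₁ : F} (hb : Yb₁ - Yb₀ = L (Y₁ - Y₀))
    (h0 : ‖Y₀'‖ ≤ B) (h1 : ‖Y₁'‖ ≤ B) (hd : ‖Y₁' - Y₀'‖ ≤ B * a)
    (hr : ‖Y₁ - Y₀ - Y₀' ξ‖ ≤ B * a ^ 2) :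
    ‖Y₁ - Y₀‖ ≤ (B + B ^ 2) * a ∧ ‖Yb₁ - Yb₀‖ ≤ B * (B + B ^ 2) * a ∧
    ‖f Yb₁ - f Yb₀ - (fderiv ℝ f Yb₀ ∘L (L ∘L Y₀')) ξ‖ ≤
      (B * (B * (B + B ^ 2)) ^ 2 + B * B * B) * a ^ 2 ∧
    ‖fderiv ℝ f Yb₁ ∘L (L ∘L Y₁') - fderiv ℝ f Yb₀ ∘L (L ∘L Y₀')‖ ≤
      (B * (B * (B + B ^ 2)) * (B * B) + B * (B * B)) * a := by
  have e1 : ‖Y₁ - Y₀‖ ≤ (B + B ^ 2) * a := by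
    calc ‖Y₁ - Y₀‖ = ‖Y₀' ξ + (Y₁ - Y₀ - Y₀' ξ)‖ := by congr 1; abel
      _ ≤ B * a + B * a ^ 2 := (norm_add_le _ _).trans (add_le_add
          ((Y₀'.le_opNorm ξ).trans (by gcongr)) hr)
      _ = B * a + B * a * a := by ring
      _ ≤ B * a + B * a * B := by gcongr
      _ = _ := by ring
  have e2 : ‖Yb₁ - Yb₀‖ ≤ B * (B + B ^ 2) * a := by
    rw [hb]
    calc _ ≤ ‖L‖ * ‖Y₁ - Y₀‖ := L.le_opNorm _
      _ ≤ B * ((B + B ^ 2) * a) := by gcongr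
      _ = _ := by ring
  refine ⟨e1, e2, ?_, ?_⟩
  -- The error is the Taylor remainder of `f` plus the derivative of `f` applied to the embedded
  -- remainder of `Y`.
  · have e3 : f Yb₁ - f Yb₀ - (fderiv ℝ f Yb₀ ∘L (L ∘L Y₀')) ξ
        = (f Yb₁ - f Yb₀ - fderiv ℝ f Yb₀ (Yb₁ - Yb₀))
          + fderiv ℝ f Yb₀ (L (Y₁ - Y₀ - Y₀' ξ)) := by
      rw [map_sub L, ← hb]; simp
    rw [e3]
    calc _ ≤ B * (B * (B + B ^ 2) * a) ^ 2 + B * (B * (B * a ^ 2)) := by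
          refine (norm_add_le _ _).trans (add_le_add ((hf.taylor _ _).trans (by gcongr)) ?_)
          refine ContinuousLinearMap.le_of_opNorm_le_of_le _ (hf.deriv _) ?_
          exact ContinuousLinearMap.le_of_opNorm_le_of_le _ hL hr
      _ = _ := by ring
  · have e3 : fderiv ℝ f Yb₁ ∘L (L ∘L Y₁') - fderiv ℝ f Yb₀ ∘L (L ∘L Y₀')
        = (fderiv ℝ f Yb₁ - fderiv ℝ f Yb₀) ∘L (L ∘L Y₁')
          + fderiv ℝ f Yb₀ ∘L (L ∘L (Y₁' - Y₀')) := by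
      ext u v; simp
    rw [e3]
    calc _ ≤ (B * (B * (B + B ^ 2) * a)) * (B * B) + B * (B * (B * a)) :=
          (norm_add_le _ _).trans (add_le_add
            (norm_comp₃_le ((hf.deriv_lip _ _).trans (by gcongr)) hL h1)
            (norm_comp₃_le (hf.deriv _) hL hd))
      _ = _ := by ring

/-- The defect of the germ of `f(Ȳ)` over arbitrary intervals. -/
theorem exists_germ_defect_bound (d : ℕ) {B : ℝ} (hB : 1 ≤ B) : ∃ C, 0 ≤ C ∧
    ∀ {κ : ℝ} {h : ℕ → ℕ → ℝ} {x : ℕ → Vec d} {𝕩 : ℕ → ℕ → Mat d} {L : ℕ → E →L[ℝ] F}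
      {f : F → Vec d →L[ℝ] E} {Y : ℕ → E} {Yb : ℕ → F} {Y' : ℕ → Vec d →L[ℝ] E},
      Driver B κ h x 𝕩 L → Bounds₂ B f → IsState L Y Yb → GaugeControlled B h x Y Y' →
      ∀ i m j, i ≤ m → m ≤ j →
        ‖germ x 𝕩 (fun i => f (Yb i)) (chainDeriv f L Yb Y') i m
          + germ x 𝕩 (fun i => f (Yb i)) (chainDeriv f L Yb Y') m j
          - germ x 𝕩 (fun i => f (Yb i)) (chainDeriv f L Yb Y') i j‖ ≤
        C * (h i m ^ 2 * ‖x j - x m‖ + h i m * ‖𝕩 m j‖) := by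
  have hB0 : 0 ≤ B := by linarith
  -- Each constant adds the chain rule constant, for gauge below one, to a crude one, for gauge at
  -- least one. The factors `‖x j - x m‖` and `‖𝕩 m j‖` are kept in the conclusion, rather than
  -- estimated by the gauge, because `IsRoughPath.exists_sewing_mesh` exploits their smallness.
  set c₁ := (B * (B * (B + B ^ 2)) ^ 2 + B * B * B) + (2 * B + B * (B * B)) with hc₁
  set c₂ := (B * (B * (B + B ^ 2)) * (B * B) + B * (B * B)) + 2 * (B * (B * B)) with hc₂
  refine ⟨c₁ + (d : ℝ) ^ 2 * c₂, by positivity, ?_⟩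
  intro κ h x 𝕩 L f Y Yb Y' D hf hs hY i m j him hmj
  have hh := D.gauge.nonneg i m
  rw [germ_defect _ _ (D.chen i m j him hmj)]
  have key : ‖f (Yb m) - f (Yb i) - chainDeriv f L Yb Y' i (x m - x i)‖ ≤ c₁ * h i m ^ 2 ∧
      ‖chainDeriv f L Yb Y' m - chainDeriv f L Yb Y' i‖ ≤ c₂ * h i m := by
    -- Over an interval of gauge at least one the embeddings may change and the chain rule is lost,
    -- but then `1 ≤ h ≤ h ^ 2` and supremum bounds suffice.
    by_cases h1 : h i m < 1
    · obtain ⟨-, -, k1, k2⟩ := chain_rule_bound hB0 hf (D.embed_le i) hh (D.gauge_le i m him)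
        (D.path_le i m him) (D.state_incr hs him h1) (hY.deriv_le i) (hY.deriv_le m)
        (hY.deriv_incr i m him) (hY.rem i m him)
      have e : chainDeriv f L Yb Y' m = fderiv ℝ f (Yb m) ∘L (L i ∘L Y' m) := by
        rw [chainDeriv, D.embed_const i m him h1]
      rw [e]
      refine ⟨k1.trans ?_, k2.trans ?_⟩
      · exact mul_le_mul_of_nonneg_right (le_add_of_nonneg_right (by positivity)) (by positivity)
      · exact mul_le_mul_of_nonneg_right (le_add_of_nonneg_right (by positivity)) hh
    · have h1 : 1 ≤ h i m := not_lt.1 h1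
      have hc : ∀ i, ‖chainDeriv f L Yb Y' i‖ ≤ B * (B * B) := fun i =>
        norm_comp₃_le (hf.deriv _) (D.embed_le i) (hY.deriv_le i)
      have h2 : h i m ≤ h i m ^ 2 := by nlinarith
      have h3 : 1 ≤ h i m ^ 2 := by nlinarith
      constructor
      · calc _ ≤ (B + B) + B * (B * B) * h i m :=
              (norm_sub_le _ _).trans (add_le_add ((norm_sub_le _ _).trans
                (add_le_add (hf.val _) (hf.val _)))
                (ContinuousLinearMap.le_of_opNorm_le_of_le _ (hc i) (D.path_le i m him)))
          _ ≤ (B + B) * h i m ^ 2 + B * (B * B) * h i m ^ 2 := by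
              gcongr
              exact le_mul_of_one_le_right (by positivity) h3
          _ = (2 * B + B * (B * B)) * h i m ^ 2 := by ring
          _ ≤ c₁ * h i m ^ 2 :=
              mul_le_mul_of_nonneg_right (le_add_of_nonneg_left (by positivity)) (by positivity)
      · calc ‖chainDeriv f L Yb Y' m - chainDeriv f L Yb Y' i‖
            ≤ B * (B * B) + B * (B * B) :=
              (norm_sub_le (chainDeriv f L Yb Y' m) (chainDeriv f L Yb Y' i)).trans
                (add_le_add (hc m) (hc i))
          _ = 2 * (B * (B * B)) * 1 := by ring
          _ ≤ c₂ * h i m := mul_le_mul (le_add_of_nonneg_left (by positivity)) h1 zero_le_one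
              (by positivity)
  have hx := norm_nonneg (x j - x m)
  have h𝕩 := norm_nonneg (𝕩 m j)
  calc _ ≤ c₁ * h i m ^ 2 * ‖x j - x m‖ + (d : ℝ) ^ 2 * (c₂ * h i m) * ‖𝕩 m j‖ :=
        (norm_add_le _ _).trans (add_le_add (ContinuousLinearMap.le_of_opNorm_le _ key.1 _)
          (norm_tensorApply_le_of_le key.2 le_rfl))
    _ ≤ c₁ * h i m ^ 2 * ‖x j - x m‖ + (d : ℝ) ^ 2 * (c₂ * h i m) * ‖𝕩 m j‖
        + (c₁ * (h i m * ‖𝕩 m j‖) + (d : ℝ) ^ 2 * c₂ * (h i m ^ 2 * ‖x j - x m‖)) :=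
        le_add_of_nonneg_right (by positivity)
    _ = _ := by ring

theorem norm_defect_le {A : Vec d →L[ℝ] E} {A' : Vec d →L[ℝ] Vec d →L[ℝ] E} {ξ : Vec d} {M : Mat d}
    {k₁ k₂ u v w : ℝ} (hk₁ : 0 ≤ k₁) (hk₂ : 0 ≤ k₂) (hu : 0 ≤ u) (hv : 0 ≤ v) (huw : u ≤ w)
    (hvw : v ≤ w) (hA : ‖A‖ ≤ k₁ * u ^ 2) (hA' : ‖A'‖ ≤ k₂ * u) (hξ : ‖ξ‖ ≤ v)
    (hM : ‖M‖ ≤ v ^ 2) : ‖A ξ + tensorApply A' M‖ ≤ (k₁ + (d : ℝ) ^ 2 * k₂) * w ^ 3 := by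
  have hw := hu.trans huw
  calc _ ≤ k₁ * u ^ 2 * v + (d : ℝ) ^ 2 * (k₂ * u) * v ^ 2 :=
        (norm_add_le _ _).trans (add_le_add (ContinuousLinearMap.le_of_opNorm_le_of_le _ hA hξ)
          (norm_tensorApply_le_of_le hA' hM))
    _ ≤ k₁ * w ^ 2 * w + (d : ℝ) ^ 2 * (k₂ * w) * w ^ 2 := by gcongr
    _ = _ := by ring

/-- Gluing of controlled bounds from short and one-step intervals to all intervals. -/
theorem IsGauge.glue {κ δ H c : ℝ} {h : ℕ → ℕ → ℝ} (hg : IsGauge κ h) (hκ : 0 ≤ κ) {n : ℕ}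
    (hn : (κ / 2) ^ n * H ^ 3 ≤ δ ^ 3) (hδ : 0 ≤ δ) (hH : ∀ i j, i ≤ j → h i j ≤ H) (hc : 0 ≤ c)
    {x : ℕ → Vec d} (hx : ∀ i j, i ≤ j → ‖x j - x i‖ ≤ h i j) {Y : ℕ → E}
    {A : ℕ → Vec d →L[ℝ] E}
    (hloc : ∀ i j, i ≤ j → (h i j ≤ δ ∨ j = i + 1) → ‖A j - A i‖ ≤ c * h i j ∧
      ‖Y j - Y i - A i (x j - x i)‖ ≤ c * h i j ^ 2) {i j : ℕ} (hij : i ≤ j) :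
    ‖A j - A i‖ ≤ 5 ^ n * c * h i j ∧ ‖Y j - Y i - A i (x j - x i)‖ ≤ 5 ^ n * c * h i j ^ 2 := by
  refine hg.induction hκ hn hδ hH (P := fun n i j => ‖A j - A i‖ ≤ 5 ^ n * c * h i j ∧
    ‖Y j - Y i - A i (x j - x i)‖ ≤ 5 ^ n * c * h i j ^ 2) ?_ ?_ ?_ hij
  · intro i j hij hh n
    have h0 := hg.nonneg i j
    have h5 : c ≤ 5 ^ n * c := le_mul_of_one_le_left hc (one_le_pow₀ (by norm_num))
    obtain ⟨h1, h2⟩ := hloc i j hij (Or.inl hh)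
    exact ⟨h1.trans (by gcongr), h2.trans (by gcongr)⟩
  · intro i n
    have h0 := hg.nonneg i (i + 1)
    have h5 : c ≤ 5 ^ n * c := le_mul_of_one_le_left hc (one_le_pow₀ (by norm_num))
    obtain ⟨h1, h2⟩ := hloc i (i + 1) (Nat.le_succ i) (Or.inr rfl)
    exact ⟨h1.trans (by gcongr), h2.trans (by gcongr)⟩
  · rintro n i m j him hmj ⟨a1, r1⟩ ⟨a2, r2⟩ ⟨a3, r3⟩
    set w := h i j with hw
    have h0 : 0 ≤ w := hg.nonneg i j
    set C := 5 ^ n * c with hC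
    have hC0 : 0 ≤ C := by positivity
    have m1 : h i m ≤ w := hg.mono le_rfl him (by omega)
    have m2 : h m (m + 1) ≤ w := hg.mono him (Nat.le_succ m) hmj
    have m3 : h (m + 1) j ≤ w := hg.mono (by omega) hmj le_rfl
    have n1 := hg.nonneg i m
    have n2 := hg.nonneg m (m + 1)
    have n3 := hg.nonneg (m + 1) j
    have x1 : ‖x j - x m‖ ≤ w := (hx m j (by omega)).trans (hg.mono him (by omega) le_rfl)
    have x2 : ‖x j - x (m + 1)‖ ≤ w := (hx (m + 1) j hmj).trans m3
    have a1' : ‖A m - A i‖ ≤ C * w := a1.trans (by gcongr)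
    have a2' : ‖A (m + 1) - A m‖ ≤ C * w := a2.trans (by gcongr)
    have a3' : ‖A j - A (m + 1)‖ ≤ C * w := a3.trans (by gcongr)
    constructor
    · calc ‖A j - A i‖ = ‖(A m - A i) + (A (m + 1) - A m) + (A j - A (m + 1))‖ := by
            congr 1; abel
        _ ≤ C * w + C * w + C * w := norm_add₃_le.trans (add_le_add (add_le_add a1' a2') a3')
        _ ≤ C * w + C * w + C * w + 2 * (C * w) := le_add_of_nonneg_right (by positivity)
        _ = _ := by rw [hC]; ring
    -- Concatenating three remainders costs two cross terms, from replacing `A i` by `A m` and then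
    -- by `A (m + 1)`. These five terms are the origin of the factor 5 per splitting.
    · have e : Y j - Y i - A i (x j - x i)
          = (Y m - Y i - A i (x m - x i)) + (Y (m + 1) - Y m - A m (x (m + 1) - x m))
            + (Y j - Y (m + 1) - A (m + 1) (x j - x (m + 1)))
            + (A m - A i) (x j - x m) + (A (m + 1) - A m) (x j - x (m + 1)) := by
        simp only [_root_.sub_apply, map_sub]; abel
      rw [e]
      have r1' : ‖Y m - Y i - A i (x m - x i)‖ ≤ C * w ^ 2 := r1.trans (by gcongr)
      have r2' : ‖Y (m + 1) - Y m - A m (x (m + 1) - x m)‖ ≤ C * w ^ 2 := r2.trans (by gcongr)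
      have r3' : ‖Y j - Y (m + 1) - A (m + 1) (x j - x (m + 1))‖ ≤ C * w ^ 2 :=
        r3.trans (by gcongr)
      calc _ ≤ C * w ^ 2 + C * w ^ 2 + C * w ^ 2 + C * w * w + C * w * w :=
            (norm_add_le _ _).trans (add_le_add ((norm_add_le _ _).trans (add_le_add
              (norm_add₃_le.trans (add_le_add (add_le_add r1' r2') r3'))
              (ContinuousLinearMap.le_of_opNorm_le_of_le _ a1' x1)))
              (ContinuousLinearMap.le_of_opNorm_le_of_le _ a2' x2))
        _ = _ := by rw [hC]; ring

/-- A solution of the discrete scheme, with initial path `(y, y')`. -/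
structure IsScheme (x : ℕ → Vec d) (𝕩 : ℕ → ℕ → Mat d) (L : ℕ → E →L[ℝ] F)
    (f : F → Vec d →L[ℝ] E) (y : ℕ → E) (y' : ℕ → Vec d →L[ℝ] E) (Y : ℕ → E) (Yb : ℕ → F)
    (Y' : ℕ → Vec d →L[ℝ] E) : Prop where
  state : IsState L Y Yb
  deriv_eq : ∀ i, Y' i = y' i + f (Yb i)
  step : ∀ i, Y (i + 1) - Y i = y (i + 1) - y i
    + germ x 𝕩 (fun i => f (Yb i)) (chainDeriv f L Yb Y') i (i + 1)

/-- The one-interval a priori estimate. -/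
theorem apriori_local {B : ℝ} (hB : 0 ≤ B) {f : F → Vec d →L[ℝ] E} (hf : Bounds₂ B f)
    {L : E →L[ℝ] F} (hL : ‖L‖ ≤ B) {a : ℝ} (ha : 0 ≤ a) (haB : a ≤ B) {ξ : Vec d} (hξ : ‖ξ‖ ≤ a)
    {M : Mat d} (hM : ‖M‖ ≤ a ^ 2) {Y₀ Y₁ y₀ y₁ : E} {Y₀' Y₁' y₀' y₁' : Vec d →L[ℝ] E}
    {Yb₀ Yb₁ : F} (hb : Yb₁ - Yb₀ = L (Y₁ - Y₀)) (hy0 : ‖y₀'‖ ≤ B)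
    (hyd : ‖y₁' - y₀'‖ ≤ B * a) (hyr : ‖y₁ - y₀ - y₀' ξ‖ ≤ B * a ^ 2)
    (e0 : Y₀' = y₀' + f Yb₀) (e1 : Y₁' = y₁' + f Yb₁)
    (hJ : ‖Y₁ - Y₀ - (y₁ - y₀) - (f Yb₀ ξ + tensorApply (fderiv ℝ f Yb₀ ∘L (L ∘L Y₀')) M)‖
      ≤ a ^ 2) :
    ‖Y₁ - Y₀ - Y₀' ξ‖ ≤ (B + (d : ℝ) ^ 2 * (B * (B * (2 * B))) + 1) * a ^ 2 ∧
    ‖Y₁' - Y₀'‖ ≤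
      (B + B * (B * (2 * B + (B + (d : ℝ) ^ 2 * (B * (B * (2 * B))) + 1) * B))) * a := by
  set c := B + (d : ℝ) ^ 2 * (B * (B * (2 * B))) + 1 with hc
  have hc0 : 0 ≤ c := by positivity
  have h0 : ‖Y₀'‖ ≤ 2 * B := by
    rw [e0, two_mul]; exact (norm_add_le _ _).trans (add_le_add hy0 (hf.val _))
  -- Since `Y₀' = y₀' + f Yb₀`, the first-order terms cancel. As `f` is bounded, `‖Y₀'‖ ≤ 2 * B`, so
  -- no bound on the increments of `Y` is needed; this is what lets the bootstrap close.
  have hr : ‖Y₁ - Y₀ - Y₀' ξ‖ ≤ c * a ^ 2 := by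
    have e : Y₁ - Y₀ - Y₀' ξ = (y₁ - y₀ - y₀' ξ)
        + tensorApply (fderiv ℝ f Yb₀ ∘L (L ∘L Y₀')) M
        + (Y₁ - Y₀ - (y₁ - y₀) - (f Yb₀ ξ + tensorApply (fderiv ℝ f Yb₀ ∘L (L ∘L Y₀')) M)) := by
      generalize tensorApply (fderiv ℝ f Yb₀ ∘L (L ∘L Y₀')) M = t
      rw [e0, _root_.add_apply]; abel
    rw [e]
    calc _ ≤ B * a ^ 2 + (d : ℝ) ^ 2 * (B * (B * (2 * B))) * a ^ 2 + a ^ 2 :=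
          norm_add₃_le.trans (add_le_add (add_le_add hyr
            (norm_tensorApply_le_of_le (norm_comp₃_le (hf.deriv _) hL h0) hM)) hJ)
      _ = _ := by rw [hc]; ring
  refine ⟨hr, ?_⟩
  have h1 : ‖Y₁ - Y₀‖ ≤ (2 * B + c * B) * a := by
    calc ‖Y₁ - Y₀‖ = ‖Y₀' ξ + (Y₁ - Y₀ - Y₀' ξ)‖ := by congr 1; abel
      _ ≤ 2 * B * a + c * a ^ 2 := (norm_add_le _ _).trans (add_le_add
          (ContinuousLinearMap.le_of_opNorm_le_of_le _ h0 hξ) hr)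
      _ = 2 * B * a + c * a * a := by ring
      _ ≤ 2 * B * a + c * a * B := by gcongr
      _ = _ := by ring
  have e : Y₁' - Y₀' = (y₁' - y₀') + (f Yb₁ - f Yb₀) := by rw [e0, e1]; abel
  rw [e]
  calc _ ≤ B * a + B * (B * ((2 * B + c * B) * a)) := by
        refine (norm_add_le _ _).trans (add_le_add hyd ((hf.lip _ _).trans ?_))
        rw [hb]
        gcongr
        exact ContinuousLinearMap.le_of_opNorm_le_of_le _ hL h1
    _ = _ := by ring

/-- The number of splittings that brings a gauge of size `B` below `δ` depends only on `κ`, `δ` and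
`B`, and not on the grid. -/
theorem exists_split_number {κ δ : ℝ} (hκ1 : κ < 1) (_hκ : 0 ≤ κ) (hδ : 0 < δ) (B : ℝ)
    (hB : 0 ≤ B) :
    ∃ n : ℕ, (κ / 2) ^ n * B ^ 3 ≤ δ ^ 3 := by
  obtain ⟨n, hn⟩ := exists_pow_lt_of_lt_one (x := δ ^ 3 / (B ^ 3 + 1)) (y := κ / 2)
    (by positivity) (by linarith)
  refine ⟨n, ?_⟩
  have h3 : 0 ≤ B ^ 3 := by positivity
  calc (κ / 2) ^ n * B ^ 3 ≤ δ ^ 3 / (B ^ 3 + 1) * (B ^ 3 + 1) := by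
        gcongr
        linarith
    _ = δ ^ 3 := by field_simp

/-- The discrete a priori estimate. -/
theorem exists_apriori_bound (d : ℕ) {B κ : ℝ} (hB : 1 ≤ B) (hκ : 0 ≤ κ) (hκ1 : κ < 1) : ∃ C, B ≤ C ∧
    ∀ {h : ℕ → ℕ → ℝ} {x : ℕ → Vec d} {𝕩 : ℕ → ℕ → Mat d} {L : ℕ → E →L[ℝ] F}
      {f : F → Vec d →L[ℝ] E} {y Y : ℕ → E} {Yb : ℕ → F} {y' Y' : ℕ → Vec d →L[ℝ] E},
      Driver B κ h x 𝕩 L → Bounds₂ B f → GaugeControlled B h x y y' →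
      IsScheme x 𝕩 L f y y' Y Yb Y' → GaugeControlled C h x Y Y' := by
  have hB0 : 0 ≤ B := by linarith
  obtain ⟨c₁, hc₁⟩ : ∃ z : ℝ, z = B + (d : ℝ) ^ 2 * (B * (B * (2 * B))) + 1 := ⟨_, rfl⟩
  obtain ⟨c₂, hc₂⟩ : ∃ z : ℝ, z = B + B * (B * (2 * B + c₁ * B)) := ⟨_, rfl⟩
  -- `c` is a controlledness constant for `Y` wherever the sewing error satisfies `‖J‖ ≤ h ^ 2`. The
  -- chain rule is then applied with `c` in place of `B`, giving the defect constant `K`.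
  obtain ⟨c, hc⟩ : ∃ z : ℝ, z = c₁ + c₂ + 2 * B := ⟨_, rfl⟩
  have hc₁0 : 0 ≤ c₁ := by rw [hc₁]; positivity
  have hc₂0 : 0 ≤ c₂ := by rw [hc₂]; positivity
  have hcB : B ≤ c := by linarith
  have hc0 : 0 ≤ c := hB0.trans hcB
  obtain ⟨k₁, hk₁⟩ : ∃ z : ℝ, z = c * (c * (c + c ^ 2)) ^ 2 + c * c * c := ⟨_, rfl⟩
  obtain ⟨k₂, hk₂⟩ : ∃ z : ℝ, z = c * (c * (c + c ^ 2)) * (c * c) + c * (c * c) := ⟨_, rfl⟩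
  obtain ⟨K, hK⟩ : ∃ z : ℝ, z = k₁ + (d : ℝ) ^ 2 * k₂ := ⟨_, rfl⟩
  have hk₁0 : 0 ≤ k₁ := by rw [hk₁]; positivity
  have hk₂0 : 0 ≤ k₂ := by rw [hk₂]; positivity
  have hK0 : 0 ≤ K := by rw [hK]; positivity
  obtain ⟨Λ, hΛ⟩ : ∃ z : ℝ, z = 2 * K / (1 - κ) := ⟨_, rfl⟩
  have hΛ0 : 0 ≤ Λ := hΛ ▸ div_nonneg (by positivity) (by linarith)
  -- `δ < 1` freezes the embeddings, and `Λ * δ ≤ 1` turns the conclusion `‖J‖ ≤ Λ * h ^ 3` of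
  -- sewing into `‖J‖ ≤ h ^ 2`, the condition under which `K` was computed.
  obtain ⟨δ, hδ⟩ : ∃ z : ℝ, z = min (1 / 2) (1 / (Λ + 1)) := ⟨_, rfl⟩
  have hδ0 : 0 < δ := by rw [hδ]; positivity
  have hδ1 : δ < 1 := hδ ▸ (min_le_left _ _).trans_lt (by norm_num)
  have hδΛ : δ ≤ 1 / (Λ + 1) := hδ ▸ min_le_right _ _
  obtain ⟨n, hn⟩ := exists_split_number hκ1 hκ hδ0 B hB0
  refine ⟨5 ^ n * c, hcB.trans (le_mul_of_one_le_left hc0 (one_le_pow₀ (by norm_num))), ?_⟩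
  intro h x 𝕩 L f y Y Yb y' Y' D hf hy hS
  have hY0 : ∀ i, ‖Y' i‖ ≤ 2 * B := fun i => by
    rw [hS.deriv_eq, two_mul]; exact (norm_add_le _ _).trans (add_le_add (hy.deriv_le i) (hf.val _))
  set G := germ x 𝕩 (fun i => f (Yb i)) (chainDeriv f L Yb Y') with hG
  set J : ℕ → ℕ → E := fun i j => Y j - Y i - (y j - y i) - G i j with hJ
  have loc : ∀ i m, i ≤ m → Yb m - Yb i = L i (Y m - Y i) → ‖J i m‖ ≤ h i m ^ 2 →
      ‖Y m - Y i - Y' i (x m - x i)‖ ≤ c * h i m ^ 2 ∧ ‖Y' m - Y' i‖ ≤ c * h i m := by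
    intro i m him hb hJim
    have h0 := D.gauge.nonneg i m
    obtain ⟨l1, l2⟩ := apriori_local hB0 hf (D.embed_le i) h0 (D.gauge_le i m him)
      (D.path_le i m him) (D.area_le i m him) hb (hy.deriv_le i) (hy.deriv_incr i m him)
      (hy.rem i m him) (hS.deriv_eq i) (hS.deriv_eq m) hJim
    rw [← hc₁] at l1 l2
    rw [← hc₂] at l2
    exact ⟨l1.trans (by gcongr; linarith), l2.trans (by gcongr; linarith)⟩
  have J0 : ∀ i, J i i = 0 := fun i => by
    have : 𝕩 i i = 0 := by
      have := D.area_le i i le_rfl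
      rw [D.gauge.self] at this
      simpa using this
    simp [hJ, hG, germ_self _ _ this]
  have J1 : ∀ i, J i (i + 1) = 0 := fun i => by
    simp only [hJ, hS.step i, hG]; abel
  have hsmall : ∀ i m, h i m ≤ δ → Λ * h i m ^ 3 ≤ h i m ^ 2 := fun i m hh => by
    have h0 := D.gauge.nonneg i m
    have h1 : Λ * h i m ≤ 1 := by
      calc Λ * h i m ≤ (Λ + 1) * (1 / (Λ + 1)) := by
            gcongr
            · linarith
            · exact hh.trans hδΛ
        _ = 1 := by field_simp
    calc Λ * h i m ^ 3 = (Λ * h i m) * h i m ^ 2 := by ring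
      _ ≤ 1 * h i m ^ 2 := by gcongr
      _ = _ := one_mul _
  have short : ∀ a b, a ≤ b → h a b ≤ δ → ‖J a b‖ ≤ h a b ^ 2 := by
    intro a b hab hδab
    refine le_trans ?_ (hsmall a b hδab)
    refine D.gauge.sewing hΛ0 hK0 (le_of_eq ?_) J0 J1 (a := a) (b := b) ?_ a b le_rfl hab le_rfl
    · rw [hΛ]; exact (mul_div_cancel₀ _ (by linarith)).symm
    -- Bootstrap: the bound for `J` on the left part makes `Y` controlled there with constant `c`,
    -- and this is all that the defect at `m` depends on.
    intro i m j hai him hmj hjb hJim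
    have hhim : h i m ≤ δ := (D.gauge.mono hai him (hmj.trans hjb)).trans hδab
    have hh1 : h i m < 1 := hhim.trans_lt hδ1
    have hb := D.state_incr hS.state him hh1
    obtain ⟨l1, l2⟩ := loc i m him hb (hJim.trans (hsmall i m hhim))
    have h0 := D.gauge.nonneg i m
    obtain ⟨-, -, k1, k2⟩ := chain_rule_bound hc0 (hf.mono hcB) ((D.embed_le i).trans hcB)
      h0 ((D.gauge_le i m him).trans hcB) (D.path_le i m him) hb ((hY0 i).trans (by linarith))
      ((hY0 m).trans (by linarith)) l2 l1
    have e : J i j - J i m - J m j = G i m + G m j - G i j := by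
      simp only [hJ]; abel
    rw [e, hG, germ_defect _ _ (D.chen i m j him hmj)]
    have e' : chainDeriv f L Yb Y' m = fderiv ℝ f (Yb m) ∘L (L i ∘L Y' m) := by
      rw [chainDeriv, D.embed_const i m him hh1]
    rw [e']
    have m1 : h i m ≤ h i j := D.gauge.mono le_rfl him hmj
    have m2 : h m j ≤ h i j := D.gauge.mono him hmj le_rfl
    rw [← hk₁] at k1
    rw [← hk₂] at k2
    rw [hK]
    exact norm_defect_le hk₁0 hk₂0 h0 (D.gauge.nonneg m j) m1 m2 k1 k2 (D.path_le m j hmj)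
      (D.area_le m j hmj)
  -- Single steps enter the gluing on the same footing as short intervals: there `J` vanishes and
  -- `IsState` gives the state increment, whatever the size of the jump.
  have fin : ∀ i j, i ≤ j → ‖Y' j - Y' i‖ ≤ 5 ^ n * c * h i j ∧
      ‖Y j - Y i - Y' i (x j - x i)‖ ≤ 5 ^ n * c * h i j ^ 2 := fun i j hij =>
    D.gauge.glue hκ hn hδ0.le D.gauge_le hc0 D.path_le (fun i j hij hh => by
      rcases hh with hh | rfl
      · have hh1 : h i j < 1 := hh.trans_lt hδ1
        exact (loc i j hij (D.state_incr hS.state hij hh1) (short i j hij hh)).symm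
      · exact (loc i (i + 1) hij (hS.state i) (by rw [J1, norm_zero]; positivity)).symm) hij
  refine ⟨fun i => (hY0 i).trans ?_, fun i j hij => (fin i j hij).1, fun i j hij => (fin i j hij).2⟩
  calc 2 * B ≤ c := by linarith
    _ ≤ _ := le_mul_of_one_le_left hc0 (one_le_pow₀ (by norm_num))

end Discrete

end RoughPath

/-! ### Difference of two discrete schemes over one interval -/

namespace RoughPath

section DiscreteLipschitz

variable {d : ℕ} {E F : Type*} [NormedAddCommGroup E] [NormedSpace ℝ E]
  [NormedAddCommGroup F] [NormedSpace ℝ F]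

/-- The one-interval Lipschitz estimate. -/
theorem exists_lipschitz_local (d : ℕ) {B : ℝ} (hB : 0 ≤ B) : ∃ C, 0 ≤ C ∧
    ∀ {f : F → Vec d →L[ℝ] E} {L : E →L[ℝ] F} {a Q : ℝ} {ξ : Vec d} {M : Mat d}
      {Y₀ Y₁ Z₀ Z₁ u₀ u₁ : E} {Y₀' Y₁' Z₀' Z₁' u₀' u₁' : Vec d →L[ℝ] E} {Yb₀ Yb₁ Zb₀ Zb₁ : F},
      Bounds₃ B f → ‖L‖ ≤ B → 0 ≤ a → a ≤ B → 0 ≤ Q → ‖ξ‖ ≤ a → ‖M‖ ≤ a ^ 2 →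
      Yb₁ - Yb₀ = L (Y₁ - Y₀) → ‖Y₀'‖ ≤ B → ‖Y₁'‖ ≤ B → ‖Y₁' - Y₀'‖ ≤ B * a →
      ‖Y₁ - Y₀ - Y₀' ξ‖ ≤ B * a ^ 2 →
      Zb₁ - Zb₀ = L (Z₁ - Z₀) → ‖Z₀'‖ ≤ B → ‖Z₁'‖ ≤ B → ‖Z₁' - Z₀'‖ ≤ B * a →
      ‖Z₁ - Z₀ - Z₀' ξ‖ ≤ B * a ^ 2 →
      Y₀' - Z₀' = u₀' + (f Yb₀ - f Zb₀) → Y₁' - Z₁' = u₁' + (f Yb₁ - f Zb₁) →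
      ‖u₀'‖ ≤ Q → ‖u₁' - u₀'‖ ≤ Q * a → ‖u₁ - u₀ - u₀' ξ‖ ≤ Q * a ^ 2 → ‖Yb₀ - Zb₀‖ ≤ Q →
      ‖(Y₁ - Z₁) - (Y₀ - Z₀) - (u₁ - u₀)
        - ((f Yb₀ ξ + tensorApply (fderiv ℝ f Yb₀ ∘L (L ∘L Y₀')) M)
          - (f Zb₀ ξ + tensorApply (fderiv ℝ f Zb₀ ∘L (L ∘L Z₀')) M))‖ ≤ Q * a ^ 2 →
      ‖(Y₁ - Z₁) - (Y₀ - Z₀) - (Y₀' - Z₀') ξ‖ ≤ C * Q * a ^ 2 ∧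
      ‖(Y₁' - Z₁') - (Y₀' - Z₀')‖ ≤ C * Q * a ∧
      ‖(Yb₁ - Yb₀) - (Zb₁ - Zb₀)‖ ≤ C * Q * a ∧
      ‖(f Yb₁ - f Yb₀ - (fderiv ℝ f Yb₀ ∘L (L ∘L Y₀')) ξ)
        - (f Zb₁ - f Zb₀ - (fderiv ℝ f Zb₀ ∘L (L ∘L Z₀')) ξ)‖ ≤ C * Q * a ^ 2 ∧
      ‖(fderiv ℝ f Yb₁ ∘L (L ∘L Y₁') - fderiv ℝ f Yb₀ ∘L (L ∘L Y₀'))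
        - (fderiv ℝ f Zb₁ ∘L (L ∘L Z₁') - fderiv ℝ f Zb₀ ∘L (L ∘L Z₀'))‖ ≤ C * Q * a := by
  -- Up to the factor `Q` and powers of `a`: `p` bounds the difference of the derivatives at the
  -- left end, `v` that of the chain rule derivatives, `r` that of the remainders, `e` that of the
  -- state increments, `p₁` that of the derivative increments, `g` and `q` those of the remainder
  -- and of the derivative increment of `f(Ȳ)`. The constant `y` bounds the increment of each state
  -- separately.
  obtain ⟨p, hp⟩ : ∃ z, z = 1 + B := ⟨_, rfl⟩
  obtain ⟨v, hv⟩ : ∃ z, z = B * (B * B) + B * (B * p) := ⟨_, rfl⟩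
  obtain ⟨r, hr⟩ : ∃ z, z = 1 + (d : ℝ) ^ 2 * v + 1 := ⟨_, rfl⟩
  obtain ⟨e, he⟩ : ∃ z, z = B * (p + r * B) := ⟨_, rfl⟩
  obtain ⟨y, hy⟩ : ∃ z, z = B * (B + B ^ 2) := ⟨_, rfl⟩
  obtain ⟨p₁, hp₁⟩ : ∃ z, z = 1 + B * (e + y) := ⟨_, rfl⟩
  obtain ⟨g, hg⟩ : ∃ z, z = B * (y ^ 2 + (y + y) * e) + (B * (B * B) + B * (B * r)) := ⟨_, rfl⟩
  obtain ⟨q, hq⟩ : ∃ z, z = B * (e + y) * (B * B) + B * y * (B * (p + p₁ * B)) + B * (B * B)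
    + B * (B * p₁) := ⟨_, rfl⟩
  have hp0 : 0 ≤ p := by rw [hp]; positivity
  have hv0 : 0 ≤ v := by rw [hv]; positivity
  have hr0 : 0 ≤ r := by rw [hr]; positivity
  have he0 : 0 ≤ e := by rw [he]; positivity
  have hy0 : 0 ≤ y := by rw [hy]; positivity
  have hp₁0 : 0 ≤ p₁ := by rw [hp₁]; positivity
  have hg0 : 0 ≤ g := by rw [hg]; positivity
  have hq0 : 0 ≤ q := by rw [hq]; positivity
  refine ⟨r + p₁ + e + g + q, by positivity, ?_⟩
  intro f L a Q ξ M Y₀ Y₁ Z₀ Z₁ u₀ u₁ Y₀' Y₁' Z₀' Z₁' u₀' u₁' Yb₀ Yb₁ Zb₀ Zb₁ hf hL ha haB hQ hξ hM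
    bY Y0 Y1 Yd Yr bZ Z0 Z1 Zd Zr e0 e1 u0 ud ur hb hJ
  obtain ⟨-, incY, -, -⟩ := chain_rule_bound hB hf.toBounds₂ hL ha haB hξ bY Y0 Y1 Yd Yr
  obtain ⟨-, incZ, -, -⟩ := chain_rule_bound hB hf.toBounds₂ hL ha haB hξ bZ Z0 Z1 Zd Zr
  rw [← hy] at incY incZ
  have d0 : ‖fderiv ℝ f Yb₀ - fderiv ℝ f Zb₀‖ ≤ B * Q := (hf.deriv_lip _ _).trans (by gcongr)
  have k0 : ‖Y₀' - Z₀'‖ ≤ p * Q := by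
    rw [e0]
    calc _ ≤ Q + B * Q := (norm_add_le _ _).trans
          (add_le_add u0 ((hf.lip _ _).trans (by gcongr)))
      _ = _ := by rw [hp]; ring
  have kv : ‖fderiv ℝ f Yb₀ ∘L (L ∘L Y₀') - fderiv ℝ f Zb₀ ∘L (L ∘L Z₀')‖ ≤ v * Q := by
    have : fderiv ℝ f Yb₀ ∘L (L ∘L Y₀') - fderiv ℝ f Zb₀ ∘L (L ∘L Z₀')
        = (fderiv ℝ f Yb₀ - fderiv ℝ f Zb₀) ∘L (L ∘L Y₀')
          + fderiv ℝ f Zb₀ ∘L (L ∘L (Y₀' - Z₀')) := by ext; simp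
    rw [this]
    calc _ ≤ (B * Q) * (B * B) + B * (B * (p * Q)) := (norm_add_le _ _).trans
          (add_le_add (norm_comp₃_le d0 hL Y0) (norm_comp₃_le (hf.deriv _) hL k0))
      _ = _ := by rw [hv]; ring
  have kr : ‖(Y₁ - Z₁) - (Y₀ - Z₀) - (Y₀' - Z₀') ξ‖ ≤ r * Q * a ^ 2 := by
    have : (Y₁ - Z₁) - (Y₀ - Z₀) - (Y₀' - Z₀') ξ = (u₁ - u₀ - u₀' ξ)
        + tensorApply (fderiv ℝ f Yb₀ ∘L (L ∘L Y₀') - fderiv ℝ f Zb₀ ∘L (L ∘L Z₀')) M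
        + ((Y₁ - Z₁) - (Y₀ - Z₀) - (u₁ - u₀)
        - ((f Yb₀ ξ + tensorApply (fderiv ℝ f Yb₀ ∘L (L ∘L Y₀')) M)
          - (f Zb₀ ξ + tensorApply (fderiv ℝ f Zb₀ ∘L (L ∘L Z₀')) M))) := by
      rw [tensorApply_sub_left]
      generalize tensorApply (fderiv ℝ f Yb₀ ∘L (L ∘L Y₀')) M = t
      generalize tensorApply (fderiv ℝ f Zb₀ ∘L (L ∘L Z₀')) M = t'
      rw [e0]; simp only [_root_.add_apply, _root_.sub_apply]; abel
    rw [this]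
    calc _ ≤ Q * a ^ 2 + (d : ℝ) ^ 2 * (v * Q) * a ^ 2 + Q * a ^ 2 := norm_add₃_le.trans
          (add_le_add (add_le_add ur (norm_tensorApply_le_of_le kv hM)) hJ)
      _ = _ := by rw [hr]; ring
  have kD : ‖(Y₁ - Y₀) - (Z₁ - Z₀)‖ ≤ (p + r * B) * Q * a := by
    calc ‖(Y₁ - Y₀) - (Z₁ - Z₀)‖
        = ‖(Y₀' - Z₀') ξ + ((Y₁ - Z₁) - (Y₀ - Z₀) - (Y₀' - Z₀') ξ)‖ := by congr 1; abel
      _ ≤ p * Q * a + r * Q * a ^ 2 := (norm_add_le _ _).trans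
          (add_le_add (ContinuousLinearMap.le_of_opNorm_le_of_le _ k0 hξ) kr)
      _ = p * Q * a + r * Q * a * a := by ring
      _ ≤ p * Q * a + r * Q * a * B := by gcongr
      _ = _ := by ring
  have kb : ‖(Yb₁ - Yb₀) - (Zb₁ - Zb₀)‖ ≤ e * Q * a := by
    rw [bY, bZ, ← map_sub]
    calc _ ≤ B * ((p + r * B) * Q * a) := ContinuousLinearMap.le_of_opNorm_le_of_le _ hL kD
      _ = _ := by rw [he]; ring
  have kp : ‖(Y₁' - Z₁') - (Y₀' - Z₀')‖ ≤ p₁ * Q * a := by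
    have : (Y₁' - Z₁') - (Y₀' - Z₀')
        = (u₁' - u₀') + ((f Yb₁ - f Yb₀) - (f Zb₁ - f Zb₀)) := by rw [e0, e1]; abel
    rw [this]
    calc _ ≤ Q * a + B * (e * Q * a + Q * (y * a)) := (norm_add_le _ _).trans
          (add_le_add ud ((hf.diff _ _ _ _).trans (by gcongr)))
      _ = _ := by rw [hp₁]; ring
  have kg : ‖(f Yb₁ - f Yb₀ - (fderiv ℝ f Yb₀ ∘L (L ∘L Y₀')) ξ)
        - (f Zb₁ - f Zb₀ - (fderiv ℝ f Zb₀ ∘L (L ∘L Z₀')) ξ)‖ ≤ g * Q * a ^ 2 := by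
    have hLY : L (Y₁ - Y₀ - Y₀' ξ) = (Yb₁ - Yb₀) - L (Y₀' ξ) := by rw [map_sub, bY]
    have hLZ : L ((Y₁ - Z₁) - (Y₀ - Z₀) - (Y₀' - Z₀') ξ)
        = ((Yb₁ - Yb₀) - L (Y₀' ξ)) - ((Zb₁ - Zb₀) - L (Z₀' ξ)) := by
      rw [bY, bZ]; simp only [map_sub, _root_.sub_apply]; abel
    -- Each remainder of `f(Ȳ)` is a Taylor remainder plus the derivative applied to an embedded
    -- remainder; the second product is split so that each term carries one factor `Q`.
    have : (f Yb₁ - f Yb₀ - (fderiv ℝ f Yb₀ ∘L (L ∘L Y₀')) ξ)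
        - (f Zb₁ - f Zb₀ - (fderiv ℝ f Zb₀ ∘L (L ∘L Z₀')) ξ)
        = ((f Yb₁ - f Yb₀ - fderiv ℝ f Yb₀ (Yb₁ - Yb₀))
            - (f Zb₁ - f Zb₀ - fderiv ℝ f Zb₀ (Zb₁ - Zb₀)))
          + ((fderiv ℝ f Yb₀ - fderiv ℝ f Zb₀) (L (Y₁ - Y₀ - Y₀' ξ))
            + fderiv ℝ f Zb₀ (L ((Y₁ - Z₁) - (Y₀ - Z₀) - (Y₀' - Z₀') ξ))) := by
      rw [hLY, hLZ]
      simp only [map_sub, _root_.sub_apply, ContinuousLinearMap.comp_apply]; abel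
    rw [this]
    calc _ ≤ B * (Q * (y * a) ^ 2 + (y * a + y * a) * (e * Q * a))
            + (B * Q * (B * (B * a ^ 2)) + B * (B * (r * Q * a ^ 2))) := (norm_add_le _ _).trans
          (add_le_add ((hf.taylor_diff _ _ _ _).trans (by gcongr)) ((norm_add_le _ _).trans
            (add_le_add
              (ContinuousLinearMap.le_of_opNorm_le_of_le _ d0
                (ContinuousLinearMap.le_of_opNorm_le_of_le _ hL Yr))
              (ContinuousLinearMap.le_of_opNorm_le_of_le _ (hf.deriv _)
                (ContinuousLinearMap.le_of_opNorm_le_of_le _ hL kr)))))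
      _ = _ := by rw [hg]; ring
  have kq : ‖(fderiv ℝ f Yb₁ ∘L (L ∘L Y₁') - fderiv ℝ f Yb₀ ∘L (L ∘L Y₀'))
        - (fderiv ℝ f Zb₁ ∘L (L ∘L Z₁') - fderiv ℝ f Zb₀ ∘L (L ∘L Z₀'))‖ ≤ q * Q * a := by
    have k1 : ‖Y₁' - Z₁'‖ ≤ (p + p₁ * B) * Q := by
      calc ‖Y₁' - Z₁'‖ = ‖(Y₀' - Z₀') + ((Y₁' - Z₁') - (Y₀' - Z₀'))‖ := by congr 1; abel
        _ ≤ p * Q + p₁ * Q * a := (norm_add_le _ _).trans (add_le_add k0 kp)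
        _ ≤ p * Q + p₁ * Q * B := by gcongr
        _ = _ := by ring
    -- Product rule for second differences: each of the four terms is either itself a second
    -- difference or couples a difference between the two solutions with an increment in time. Hence
    -- each is of order `Q * a`.
    have : (fderiv ℝ f Yb₁ ∘L (L ∘L Y₁') - fderiv ℝ f Yb₀ ∘L (L ∘L Y₀'))
        - (fderiv ℝ f Zb₁ ∘L (L ∘L Z₁') - fderiv ℝ f Zb₀ ∘L (L ∘L Z₀'))
        = ((fderiv ℝ f Yb₁ - fderiv ℝ f Yb₀) - (fderiv ℝ f Zb₁ - fderiv ℝ f Zb₀)) ∘L (L ∘L Y₁')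
          + (fderiv ℝ f Zb₁ - fderiv ℝ f Zb₀) ∘L (L ∘L (Y₁' - Z₁'))
          + (fderiv ℝ f Yb₀ - fderiv ℝ f Zb₀) ∘L (L ∘L (Y₁' - Y₀'))
          + fderiv ℝ f Zb₀ ∘L (L ∘L ((Y₁' - Z₁') - (Y₀' - Z₀'))) := by
      ext u w
      simp only [map_sub, _root_.sub_apply, _root_.add_apply, ContinuousLinearMap.comp_apply]
      abel_nf
    rw [this]
    calc _ ≤ (B * (e * Q * a + Q * (y * a))) * (B * B) + (B * (y * a)) * (B * ((p + p₁ * B) * Q))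
            + (B * Q) * (B * (B * a)) + B * (B * (p₁ * Q * a)) := (norm_add_le _ _).trans
          (add_le_add (norm_add₃_le.trans (add_le_add (add_le_add
            (norm_comp₃_le ((hf.deriv_diff _ _ _ _).trans (by gcongr)) hL Y1)
            (norm_comp₃_le ((hf.deriv_lip _ _).trans (by gcongr)) hL k1))
            (norm_comp₃_le d0 hL Yd))) (norm_comp₃_le (hf.deriv _) hL kp))
      _ = _ := by rw [hq]; ring
  refine ⟨kr.trans ?_, kp.trans ?_, kb.trans ?_, kg.trans ?_, kq.trans ?_⟩ <;> gcongr <;> linarith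

end DiscreteLipschitz

end RoughPath

/-! ### The discrete Lipschitz estimate on all intervals -/

namespace RoughPath

section DiscreteLipschitz

variable {d : ℕ} {E F : Type*} [NormedAddCommGroup E] [NormedSpace ℝ E]
  [NormedAddCommGroup F] [NormedSpace ℝ F]

theorem Driver.area_self {B κ : ℝ} {h : ℕ → ℕ → ℝ} {x : ℕ → Vec d} {𝕩 : ℕ → ℕ → Mat d}
    {L : ℕ → E →L[ℝ] F} (D : Driver B κ h x 𝕩 L) (i : ℕ) : 𝕩 i i = 0 := by
  have := D.area_le i i le_rfl
  rw [D.gauge.self] at this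
  simpa using this

set_option maxHeartbeats 1000000 in
/-- The discrete Lipschitz estimate. -/
theorem exists_lipschitz_bound (d : ℕ) {B κ : ℝ} (hB : 1 ≤ B) (hκ : 0 ≤ κ) (hκ1 : κ < 1) : ∃ C, 0 ≤ C ∧
    ∀ {h : ℕ → ℕ → ℝ} {x : ℕ → Vec d} {𝕩 : ℕ → ℕ → Mat d} {L : ℕ → E →L[ℝ] F}
      {f : F → Vec d →L[ℝ] E} {y Y z Z : ℕ → E} {Yb Zb : ℕ → F}
      {y' Y' z' Z' : ℕ → Vec d →L[ℝ] E} {Δ : ℝ},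
      Driver B κ h x 𝕩 L → Bounds₃ B f → IsScheme x 𝕩 L f y y' Y Yb Y' →
      IsScheme x 𝕩 L f z z' Z Zb Z' → GaugeControlled B h x Y Y' → GaugeControlled B h x Z Z' →
      0 ≤ Δ → GaugeControlled Δ h x (fun i => y i - z i) (fun i => y' i - z' i) →
      ‖Yb 0 - Zb 0‖ ≤ Δ →
      (∀ i, ‖Yb i - Zb i‖ ≤ C * Δ) ∧
      GaugeControlled (C * Δ) h x (fun i => Y i - Z i) (fun i => Y' i - Z' i) := by
  have hB0 : 0 ≤ B := by linarith
  obtain ⟨c, hc0, loc⟩ := exists_lipschitz_local (E := E) (F := F) d hB0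
  obtain ⟨K, hK⟩ : ∃ z, z = (1 + (d : ℝ) ^ 2) * c := ⟨_, rfl⟩
  obtain ⟨Λ, hΛ⟩ : ∃ z, z = 2 * K / (1 - κ) := ⟨_, rfl⟩
  have hK0 : 0 ≤ K := by rw [hK]; positivity
  have hΛ0 : 0 ≤ Λ := hΛ ▸ div_nonneg (by positivity) (by linarith)
  -- The first two constraints serve as in the a priori estimate; `c * δ ≤ 1 / 2` is used to absorb
  -- the growth of the state difference over a short interval.
  obtain ⟨δ, hδ⟩ : ∃ z, z = min (1 / 2) (min (1 / (Λ + 1)) (1 / (2 * (c + 1)))) := ⟨_, rfl⟩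
  have hδ0 : 0 < δ := by rw [hδ]; positivity
  have hδ1 : δ < 1 := hδ ▸ (min_le_left _ _).trans_lt (by norm_num)
  have hδΛ : δ ≤ 1 / (Λ + 1) := hδ ▸ (min_le_right _ _).trans (min_le_left _ _)
  have hδc : c * δ ≤ 1 / 2 := by
    calc c * δ ≤ (c + 1) * (1 / (2 * (c + 1))) := by
          gcongr
          · linarith
          · exact hδ ▸ (min_le_right _ _).trans (min_le_right _ _)
      _ = 1 / 2 := by field_simp
  obtain ⟨n, hn⟩ := exists_split_number hκ1 hκ hδ0 B hB0
  -- `q` dominates the growth factor 2 of short intervals and the factor `1 + c * B` of single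
  -- steps. Three consecutive parts multiply their factors, so `n` splittings give the exponent `3 ^
  -- n`; the extra 2 in `s` comes from the initial value `‖Yb 0 - Zb 0‖ + Δ ≤ 2 * Δ`.
  obtain ⟨q, hq⟩ : ∃ z, z = 2 + c * B := ⟨_, rfl⟩
  have hq1 : 1 ≤ q := by rw [hq]; linarith [mul_nonneg hc0 hB0]
  have hq0 : 0 ≤ q := by linarith
  obtain ⟨s, hs⟩ : ∃ z, z = 2 * q ^ 3 ^ n := ⟨_, rfl⟩
  have hs0 : 0 ≤ s := by rw [hs]; positivity
  refine ⟨5 ^ n * (c * (1 + s)) + (1 + (1 + B) * s), by positivity, ?_⟩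
  intro h x 𝕩 L f y Y z Z Yb Zb y' Y' z' Z' Δ D hf hY hZ cY cZ hΔ hu hb0
  set G := germ x 𝕩 (fun i => f (Yb i)) (chainDeriv f L Yb Y') with hG
  set G' := germ x 𝕩 (fun i => f (Zb i)) (chainDeriv f L Zb Z') with hG'
  set J : ℕ → ℕ → E := fun i j => (Y j - Z j) - (Y i - Z i) - ((y j - z j) - (y i - z i))
    - (G i j - G' i j) with hJ
  have J0 : ∀ i, J i i = 0 := fun i => by
    simp [hJ, hG, hG', germ_self _ _ (D.area_self i)]
  have J1 : ∀ i, J i (i + 1) = 0 := fun i => by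
    have e1 := hY.step i
    have e2 := hZ.step i
    simp only [hJ]
    calc _ = (Y (i + 1) - Y i) - (Z (i + 1) - Z i) - ((y (i + 1) - y i) - (z (i + 1) - z i))
          - (G i (i + 1) - G' i (i + 1)) := by abel
      _ = 0 := by rw [e1, e2]; abel
  -- `Q` must dominate the data and the state difference at the left end. The increment of the state
  -- is known when no embedding changes, and on a single step without any smallness.
  have loc' : ∀ i m Q, i ≤ m → 0 ≤ Q → Δ ≤ Q → ‖Yb i - Zb i‖ ≤ Q → (h i m < 1 ∨ m = i + 1) →
      ‖J i m‖ ≤ Q * h i m ^ 2 → _ := fun i m Q him hQ hΔQ hbQ hcase hJQ =>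
    loc hf (D.embed_le i) (D.gauge.nonneg i m) (D.gauge_le i m him) hQ (D.path_le i m him)
      (D.area_le i m him)
      (by rcases hcase with hh | rfl
          · exact D.state_incr hY.state him hh
          · exact hY.state i)
      (cY.deriv_le i) (cY.deriv_le m) (cY.deriv_incr i m him) (cY.rem i m him)
      (by rcases hcase with hh | rfl
          · exact D.state_incr hZ.state him hh
          · exact hZ.state i)
      (cZ.deriv_le i) (cZ.deriv_le m) (cZ.deriv_incr i m him) (cZ.rem i m him)
      (u₀' := y' i - z' i) (u₁' := y' m - z' m) (u₀ := y i - z i) (u₁ := y m - z m)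
      (by rw [hY.deriv_eq, hZ.deriv_eq]; abel) (by rw [hY.deriv_eq, hZ.deriv_eq]; abel)
      ((hu.deriv_le i).trans hΔQ)
      ((hu.deriv_incr i m him).trans (by have := D.gauge.nonneg i m; gcongr))
      ((hu.rem i m him).trans (by have := D.gauge.nonneg i m; gcongr)) hbQ hJQ
  have hsmall : ∀ i m Q, 0 ≤ Q → h i m ≤ δ → Λ * Q * h i m ^ 3 ≤ Q * h i m ^ 2 :=
    fun i m Q hQ hh => by
      have h0 := D.gauge.nonneg i m
      have h1 : Λ * h i m ≤ 1 := by
        calc Λ * h i m ≤ (Λ + 1) * (1 / (Λ + 1)) := by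
              gcongr
              · linarith
              · exact hh.trans hδΛ
          _ = 1 := by field_simp
      calc Λ * Q * h i m ^ 3 = (Λ * h i m) * (Q * h i m ^ 2) := by ring
        _ ≤ 1 * (Q * h i m ^ 2) := by gcongr
        _ = _ := one_mul _
  -- bound for `J` on short intervals in terms of the size of the state
  have short : ∀ a b Q, a ≤ b → h a b ≤ δ → 0 ≤ Q → Δ ≤ Q →
      (∀ i, a ≤ i → i ≤ b → ‖Yb i - Zb i‖ ≤ Q) → ∀ i j, a ≤ i → i ≤ j → j ≤ b →
      ‖J i j‖ ≤ Q * h i j ^ 2 := by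
    intro a b Q hab hδab hQ hΔQ hbQ i j hai hij hjb
    have hsub : ∀ {i j}, a ≤ i → i ≤ j → j ≤ b → h i j ≤ δ := fun hai hij hjb =>
      (D.gauge.mono hai hij hjb).trans hδab
    refine le_trans ?_ (hsmall i j Q hQ (hsub hai hij hjb))
    refine D.gauge.sewing (K := K * Q) (mul_nonneg hΛ0 hQ) (mul_nonneg hK0 hQ) (le_of_eq ?_) J0 J1
      (a := a) (b := b) ?_ i j hai hij hjb
    · rw [hΛ, ← mul_assoc, ← mul_assoc, mul_div_cancel₀ _ (by linarith)]
    intro i m j hai him hmj hjb hJim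
    have hhim : h i m ≤ δ := hsub hai him (hmj.trans hjb)
    have hh1 : h i m < 1 := hhim.trans_lt hδ1
    obtain ⟨-, -, -, k1, k2⟩ := loc' i m Q him hQ hΔQ (hbQ i hai (him.trans (hmj.trans hjb)))
      (Or.inl hh1) (hJim.trans (hsmall i m Q hQ hhim))
    have e : J i j - J i m - J m j = (G i m + G m j - G i j) - (G' i m + G' m j - G' i j) := by
      simp only [hJ]; abel
    have e1 : chainDeriv f L Yb Y' m = fderiv ℝ f (Yb m) ∘L (L i ∘L Y' m) := by
      rw [chainDeriv, D.embed_const i m him hh1]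
    have e2 : chainDeriv f L Zb Z' m = fderiv ℝ f (Zb m) ∘L (L i ∘L Z' m) := by
      rw [chainDeriv, D.embed_const i m him hh1]
    rw [e, hG, hG', germ_defect _ _ (D.chen i m j him hmj), germ_defect _ _ (D.chen i m j him hmj)]
    have e3 : ∀ (A A' : Vec d →L[ℝ] E) (T T' : Vec d →L[ℝ] Vec d →L[ℝ] E) (ξ : Vec d) (M : Mat d),
        (A ξ + tensorApply T M) - (A' ξ + tensorApply T' M)
          = (A - A') ξ + tensorApply (T - T') M := fun A A' T T' ξ M => by
      rw [tensorApply_sub_left, _root_.sub_apply]; abel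
    rw [e3, e1, e2]
    refine (norm_defect_le (mul_nonneg hc0 hQ) (mul_nonneg hc0 hQ) (D.gauge.nonneg i m)
      (D.gauge.nonneg m j) (D.gauge.mono le_rfl him hmj) (D.gauge.mono him hmj le_rfl) k1 k2
      (D.path_le m j hmj) (D.area_le m j hmj)).trans (le_of_eq ?_)
    rw [hK]; ring
  -- growth of the state over short intervals
  have grow : ∀ a b, a ≤ b → h a b ≤ δ → ∀ m, a ≤ m → m ≤ b →
      ‖Yb m - Zb m‖ + Δ ≤ 2 * (‖Yb a - Zb a‖ + Δ) := by
    intro a b hab hδab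
    -- Sewing needs a bound on the state difference over the whole interval, which is the quantity
    -- sought. Its maximum `S` is finite on the grid, satisfies `S ≤ ‖Yb a - Zb a‖ + (Δ + S) / 2`,
    -- and can be absorbed.
    obtain ⟨m₀, hm₀, hmax⟩ := Finset.exists_max_image (Finset.Icc a b) (fun i => ‖Yb i - Zb i‖)
      ⟨a, Finset.mem_Icc.2 ⟨le_rfl, hab⟩⟩
    rw [Finset.mem_Icc] at hm₀
    set S := ‖Yb m₀ - Zb m₀‖ with hS
    have hS0 : 0 ≤ S := norm_nonneg _
    have hle : ∀ i, a ≤ i → i ≤ b → ‖Yb i - Zb i‖ ≤ S := fun i h1 h2 =>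
      hmax i (Finset.mem_Icc.2 ⟨h1, h2⟩)
    have hle' : ∀ i, a ≤ i → i ≤ b → ‖Yb i - Zb i‖ ≤ Δ + S := fun i h1 h2 =>
      (hle i h1 h2).trans (by linarith)
    have hh : h a m₀ ≤ δ := (D.gauge.mono le_rfl hm₀.1 hm₀.2).trans hδab
    obtain ⟨-, -, k, -, -⟩ := loc' a m₀ (Δ + S) hm₀.1 (by linarith) (by linarith)
      (hle' a le_rfl hab) (Or.inl (hh.trans_lt hδ1))
      (short a b (Δ + S) hab hδab (by linarith) (by linarith) hle' a m₀ le_rfl hm₀.1 hm₀.2)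
    have : S ≤ ‖Yb a - Zb a‖ + 1 / 2 * (Δ + S) := by
      calc S = ‖(Yb a - Zb a) + ((Yb m₀ - Yb a) - (Zb m₀ - Zb a))‖ := by rw [hS]; congr 1; abel
        _ ≤ ‖Yb a - Zb a‖ + c * (Δ + S) * h a m₀ := (norm_add_le _ _).trans (by gcongr)
        _ ≤ ‖Yb a - Zb a‖ + c * (Δ + S) * δ := by gcongr
        _ = ‖Yb a - Zb a‖ + (c * δ) * (Δ + S) := by ring
        _ ≤ _ := by gcongr
    intro m h1 h2
    linarith [hle m h1 h2]
  have grow1 : ∀ i, ‖Yb (i + 1) - Zb (i + 1)‖ + Δ ≤ (1 + c * B) * (‖Yb i - Zb i‖ + Δ) := by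
    intro i
    set Q := ‖Yb i - Zb i‖ + Δ with hQ
    have hQ0 : 0 ≤ Q := by positivity
    have h0 := D.gauge.nonneg i (i + 1)
    obtain ⟨-, -, k, -, -⟩ := loc' i (i + 1) Q (Nat.le_succ i) hQ0 (by linarith [norm_nonneg (Yb i - Zb i)])
      (by linarith) (Or.inr rfl) (by rw [J1, norm_zero]; positivity)
    calc ‖Yb (i + 1) - Zb (i + 1)‖ + Δ
        = ‖(Yb i - Zb i) + ((Yb (i + 1) - Yb i) - (Zb (i + 1) - Zb i))‖ + Δ := by
          congr 2; abel
      _ ≤ ‖Yb i - Zb i‖ + c * Q * B + Δ := by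
          gcongr
          refine (norm_add_le _ _).trans (add_le_add le_rfl (k.trans ?_))
          have := D.gauge_le i (i + 1) (Nat.le_succ i)
          gcongr
      _ = _ := by rw [hQ]; ring
  have growth : ∀ i, ‖Yb i - Zb i‖ ≤ s * Δ := by
    intro i
    -- A discrete Gronwall argument: the growth factors over the three parts of a splitting are
    -- multiplied.
    have key := D.gauge.induction hκ hn hδ0.le D.gauge_le
      (P := fun n a b => ∀ m, a ≤ m → m ≤ b →
        ‖Yb m - Zb m‖ + Δ ≤ q ^ 3 ^ n * (‖Yb a - Zb a‖ + Δ)) ?_ ?_ ?_ (Nat.zero_le i) i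
        (Nat.zero_le i) le_rfl
    · calc ‖Yb i - Zb i‖ ≤ ‖Yb i - Zb i‖ + Δ := by linarith
        _ ≤ q ^ 3 ^ n * (‖Yb 0 - Zb 0‖ + Δ) := key
        _ ≤ q ^ 3 ^ n * (Δ + Δ) := by gcongr
        _ = s * Δ := by rw [hs]; ring
    · intro a b hab hh k m h1 h2
      refine (grow a b hab hh m h1 h2).trans ?_
      gcongr
      calc (2 : ℝ) ≤ q := by rw [hq]; linarith [mul_nonneg hc0 hB0]
        _ ≤ q ^ 3 ^ k := le_self_pow₀ hq1 (by positivity)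
    · intro a k m h1 h2
      have hqk : q ≤ q ^ 3 ^ k := le_self_pow₀ hq1 (by positivity)
      rcases (show m = a ∨ m = a + 1 by omega) with rfl | rfl
      · exact le_mul_of_one_le_left (by positivity) (hq1.trans hqk)
      · refine (grow1 a).trans ?_
        gcongr
        exact le_trans (by rw [hq]; linarith) hqk
    · intro k a m b ham hmb p1 p2 p3 l h1 h2
      have hqk : 1 ≤ q ^ 3 ^ k := one_le_pow₀ hq1
      have e : q ^ 3 ^ (k + 1) = q ^ 3 ^ k * (q ^ 3 ^ k * q ^ 3 ^ k) := by
        rw [pow_succ, pow_mul]; ring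
      set w := q ^ 3 ^ k with hw
      have n0 : 0 ≤ ‖Yb a - Zb a‖ + Δ := by positivity
      have b1 := p1 m ham le_rfl
      have b2 := p2 (m + 1) (Nat.le_succ m) le_rfl
      rw [e]
      have hw2 : w * (‖Yb a - Zb a‖ + Δ) ≤ w * w * (‖Yb a - Zb a‖ + Δ) := by
        gcongr; nlinarith
      have hw3 : w * w * (‖Yb a - Zb a‖ + Δ) ≤ w * (w * w) * (‖Yb a - Zb a‖ + Δ) := by
        gcongr; nlinarith
      rcases (show l ≤ m ∨ m + 1 ≤ l by omega) with h3 | h3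
      · exact (p1 l h1 h3).trans (hw2.trans hw3)
      · calc _ ≤ w * (‖Yb (m + 1) - Zb (m + 1)‖ + Δ) := p3 l h3 h2
          _ ≤ w * (w * (‖Yb m - Zb m‖ + Δ)) := by gcongr
          _ ≤ w * (w * (w * (‖Yb a - Zb a‖ + Δ))) := by gcongr
          _ = _ := by ring
  have hQ0 : 0 ≤ (1 + s) * Δ := by positivity
  have hΔQ : Δ ≤ (1 + s) * Δ := by linarith [mul_nonneg hs0 hΔ]
  have hbQ : ∀ i, ‖Yb i - Zb i‖ ≤ (1 + s) * Δ := fun i => (growth i).trans (by linarith)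
  have fin : ∀ i j, i ≤ j → ‖(Y' j - Z' j) - (Y' i - Z' i)‖ ≤ 5 ^ n * (c * (1 + s) * Δ) * h i j ∧
      ‖(Y j - Z j) - (Y i - Z i) - (Y' i - Z' i) (x j - x i)‖ ≤
        5 ^ n * (c * (1 + s) * Δ) * h i j ^ 2 := fun i j hij =>
    D.gauge.glue (c := c * (1 + s) * Δ) (Y := fun i => Y i - Z i) (A := fun i => Y' i - Z' i)
      hκ hn hδ0.le D.gauge_le (by positivity) D.path_le (fun i j hij hh => by
        have hJij : ‖J i j‖ ≤ (1 + s) * Δ * h i j ^ 2 := by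
          rcases hh with hh | rfl
          · exact short i j _ hij hh hQ0 hΔQ (fun l _ _ => hbQ l) i j le_rfl hij le_rfl
          · rw [J1, norm_zero]; have := D.gauge.nonneg i (i + 1); positivity
        obtain ⟨k1, k2, -⟩ := loc' i j _ hij hQ0 hΔQ (hbQ i)
          (hh.imp_left fun hh => hh.trans_lt hδ1) hJij
        exact ⟨by rw [mul_assoc c]; exact k2, by rw [mul_assoc c]; exact k1⟩) hij
  have hC1 : s * Δ ≤ (5 ^ n * (c * (1 + s)) + (1 + (1 + B) * s)) * Δ := by
    gcongr
    have : 0 ≤ 5 ^ n * (c * (1 + s)) := by positivity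
    nlinarith [mul_nonneg hB0 hs0]
  have hC2 : 5 ^ n * (c * (1 + s) * Δ) ≤ (5 ^ n * (c * (1 + s)) + (1 + (1 + B) * s)) * Δ := by
    rw [← mul_assoc]
    gcongr
    exact le_add_of_nonneg_right (by positivity)
  refine ⟨fun i => (growth i).trans hC1, fun i => ?_, fun i j hij => ?_, fun i j hij => ?_⟩
  · have e : Y' i - Z' i = (y' i - z' i) + (f (Yb i) - f (Zb i)) := by
      rw [hY.deriv_eq, hZ.deriv_eq]; abel
    change ‖Y' i - Z' i‖ ≤ _
    rw [e]
    calc _ ≤ Δ + B * (s * Δ) := (norm_add_le _ _).trans (add_le_add (hu.deriv_le i)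
          ((hf.lip _ _).trans (by gcongr; exact growth i)))
      _ = (1 + B * s) * Δ := by ring
      _ ≤ _ := by
        have : 0 ≤ 5 ^ n * (c * (1 + s)) := by positivity
        exact mul_le_mul_of_nonneg_right (by linarith) hΔ
  · have h0 := D.gauge.nonneg i j
    exact (fin i j hij).1.trans (by gcongr)
  · have h0 := D.gauge.nonneg i j
    exact (fin i j hij).2.trans (by gcongr)

end DiscreteLipschitz

end RoughPath

namespace RoughPath

/-! ### Controls -/

section Control

variable {E : Type*} [NormedAddCommGroup E]

theorem IntervalPartition.left_le {a b : ℝ} (P : IntervalPartition a b) (i : Fin (P.n + 1)) :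
    a ≤ P.pt i :=
  P.first.symm.trans_le (P.strictMono.monotone (Fin.zero_le i))

theorem IntervalPartition.le_right {a b : ℝ} (P : IntervalPartition a b) (i : Fin (P.n + 1)) :
    P.pt i ≤ b :=
  (P.strictMono.monotone (Fin.le_last i)).trans_eq P.last

theorem IntervalPartition.pt_le {a b : ℝ} (P : IntervalPartition a b) (i : Fin P.n) :
    P.pt i.castSucc ≤ P.pt i.succ :=
  P.strictMono.monotone (Fin.castSucc_lt_succ (i := i)).le

/-- A partition of `[a, s]` extended by one interval `[s, t]`. -/
noncomputable def IntervalPartition.snoc {a s t : ℝ} (P : IntervalPartition a s) (hst : s < t) :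
    IntervalPartition a t where
  n := P.n + 1
  pt := Fin.snoc P.pt t
  strictMono := by
    rw [Fin.strictMono_iff_lt_succ]
    intro i
    refine Fin.lastCases ?_ (fun i => ?_) i
    · rw [Fin.snoc_castSucc, Fin.succ_last, Fin.snoc_last, P.last]; exact hst
    · rw [Fin.snoc_castSucc, Fin.succ_castSucc, Fin.snoc_castSucc]
      exact P.strictMono (Fin.castSucc_lt_succ (i := i))
  first := by
    rw [show (0 : Fin (P.n + 1 + 1)) = Fin.castSucc 0 from rfl, Fin.snoc_castSucc, P.first]
  last := by rw [Fin.snoc_last]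

theorem IntervalPartition.sum_snoc {a s t : ℝ} (P : IntervalPartition a s) (hst : s < t)
    {M : Type*} [AddCommMonoid M] (g : ℝ → ℝ → M) :
    ∑ i : Fin (P.snoc hst).n, g ((P.snoc hst).pt i.castSucc) ((P.snoc hst).pt i.succ) =
      ∑ i : Fin P.n, g (P.pt i.castSucc) (P.pt i.succ) + g s t := by
  change ∑ i : Fin (P.n + 1), g ((Fin.snoc P.pt t : Fin (P.n + 2) → ℝ) i.castSucc)
    ((Fin.snoc P.pt t : Fin (P.n + 2) → ℝ) i.succ) = _
  rw [Fin.sum_univ_castSucc]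
  congr 1
  · refine Finset.sum_congr rfl fun i _ => ?_
    rw [Fin.snoc_castSucc, Fin.succ_castSucc, Fin.snoc_castSucc]
  · rw [Fin.snoc_castSucc, Fin.succ_last, Fin.snoc_last, P.last]

theorem sum_fin_succ_sub_castSucc {M : Type*} [AddCommGroup M] {n : ℕ} (g : Fin (n + 1) → M) :
    ∑ i : Fin n, (g i.succ - g i.castSucc) = g (Fin.last n) - g 0 := by
  induction n with
  | zero => simp
  | succ n ih =>
    rw [Fin.sum_univ_castSucc]
    have := ih (fun i => g i.castSucc)
    simp only [← Fin.succ_castSucc] at this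
    rw [this, Fin.succ_last, Fin.castSucc_zero]
    abel

/-- The variation sum over all partitions of `[0, t]`. -/
noncomputable def variationSup (q : ℝ) (G : ℝ → ℝ → E) (t : ℝ) : ℝ≥0∞ :=
  ⨆ P : IntervalPartition 0 t, ∑ i : Fin P.n, ‖G (P.pt i.castSucc) (P.pt i.succ)‖ₑ ^ q

/-- The partition of `[a, a]`. -/
def IntervalPartition.trivial (a : ℝ) : IntervalPartition a a where
  n := 0
  pt := fun _ => a
  strictMono := fun i j h => by omega
  first := rfl
  last := rfl

/-- Appending `[s, t]` to any partition of `[0, s]` gives a partition of `[0, t]`. This form of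
superadditivity is all that a control built from variation over `[0, t]` requires. -/
theorem variationSup_add_le {q : ℝ} (G : ℝ → ℝ → E) {s t : ℝ} (hs : 0 ≤ s) (hst : s < t) :
    variationSup q G s + ‖G s t‖ₑ ^ q ≤ variationSup q G t := by
  have hne : Nonempty (IntervalPartition 0 s) := by
    rcases hs.eq_or_lt with rfl | h
    · exact ⟨IntervalPartition.trivial 0⟩
    · exact ⟨(IntervalPartition.trivial 0).snoc h⟩
  rw [variationSup, ENNReal.iSup_add]
  refine iSup_le fun P => ?_
  rw [← P.sum_snoc hst (fun u v => ‖G u v‖ₑ ^ q)]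
  exact le_iSup (fun P : IntervalPartition 0 t =>
    ∑ i : Fin P.n, ‖G (P.pt i.castSucc) (P.pt i.succ)‖ₑ ^ q) (P.snoc hst)

/-- `φ t` is the `q`-th power of the `q`-variation over `[0, t]`. The condition on the diagonal is
needed since partitions have strictly increasing points and do not see `G s s`. -/
theorem exists_control {q T : ℝ} (hq : 0 < q) (hT : 0 ≤ T) {G : ℝ → ℝ → E}
    (hG : eVar₂ q 0 T G ≠ ∞) (hG0 : ∀ s, 0 ≤ s → s ≤ T → G s s = 0) :
    ∃ φ : ℝ → ℝ, Monotone φ ∧ (∀ t, 0 ≤ φ t) ∧ (∀ t, φ t ≤ (var₂ q T G : ℝ) ^ q) ∧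
      ∀ s t, 0 ≤ s → s ≤ t → t ≤ T → ‖G s t‖ ^ q ≤ φ t - φ s := by
  have hVT : variationSup q G T ≠ ∞ := fun h => hG (by
    change (variationSup q G T) ^ (1 / q) = ∞
    rw [h]; exact ENNReal.top_rpow_of_pos (by positivity))
  have hmono : ∀ s t, 0 ≤ s → s ≤ t → variationSup q G s ≤ variationSup q G t := by
    intro s t hs hst
    rcases hst.eq_or_lt with rfl | h
    · exact le_rfl
    · exact le_self_add.trans (variationSup_add_le G hs h)
  have hfin : ∀ s, 0 ≤ s → s ≤ T → variationSup q G s ≠ ∞ := fun s h1 h2 =>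
    ne_top_of_le_ne_top hVT (hmono s T h1 h2)
  -- Times are clamped to `[0, T]` to make the control monotone and bounded on all of `ℝ`.
  set cl : ℝ → ℝ := fun t => max 0 (min t T) with hcl
  have hcl0 : ∀ t, 0 ≤ cl t := fun t => le_max_left _ _
  have hclT : ∀ t, cl t ≤ T := fun t => max_le hT (min_le_right _ _)
  have hcl_eq : ∀ t, 0 ≤ t → t ≤ T → cl t = t := fun t h1 h2 => by
    simp [hcl, min_eq_left h2, max_eq_right h1]
  refine ⟨fun t => (variationSup q G (cl t)).toReal, ?_, fun t => ENNReal.toReal_nonneg, ?_, ?_⟩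
  · intro s t hst
    refine ENNReal.toReal_mono (hfin _ (hcl0 t) (hclT t)) (hmono _ _ (hcl0 s) ?_)
    exact max_le_max le_rfl (min_le_min hst le_rfl)
  · intro t
    have e : (var₂ q T G : ℝ) ^ q = (variationSup q G T).toReal := by
      change ((variationSup q G T ^ (1 / q)).toReal) ^ q = _
      rw [← ENNReal.toReal_rpow, ← Real.rpow_mul ENNReal.toReal_nonneg, one_div,
        inv_mul_cancel₀ hq.ne', Real.rpow_one]
    rw [e]
    exact ENNReal.toReal_mono hVT (hmono _ _ (hcl0 t) (hclT t))
  · intro s t hs hst htT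
    simp only [hcl_eq s hs (hst.trans htT), hcl_eq t (hs.trans hst) htT]
    rcases hst.eq_or_lt with rfl | h
    · rw [hG0 s hs htT]; simp [hq.ne']
    · have key := ENNReal.toReal_mono (hfin t (hs.trans hst) htT) (variationSup_add_le (q := q) G hs h)
      have hf : ‖G s t‖ₑ ^ q ≠ ∞ := by
        exact (ENNReal.rpow_lt_top_of_nonneg hq.le enorm_ne_top).ne
      rw [ENNReal.toReal_add (hfin s hs (hst.trans htT)) hf, ← ENNReal.toReal_rpow, toReal_enorm]
        at key
      linarith

/-- After taking `q`-th powers the increments of `φ` telescope along any partition. -/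
theorem eVar₂_le_of_control {q T : ℝ} (hq : 0 < q) {G : ℝ → ℝ → E} {φ : ℝ → ℝ}
    (hφ : Monotone φ) {C W : ℝ} (hC : 0 ≤ C) (hW : φ T - φ 0 ≤ W)
    (hG : ∀ s t, 0 ≤ s → s ≤ t → t ≤ T → ‖G s t‖ ≤ C * (φ t - φ s) ^ (1 / q)) :
    eVar₂ q 0 T G ≤ ENNReal.ofReal (C * W ^ (1 / q)) := by
  have key : ∀ P : IntervalPartition 0 T, ∑ i : Fin P.n,
      ‖G (P.pt i.castSucc) (P.pt i.succ)‖ₑ ^ q ≤ ENNReal.ofReal (C ^ q * W) := by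
    intro P
    have hm := P.pt_le
    have h0 := P.left_le
    have hT := P.le_right
    calc _ ≤ ∑ i : Fin P.n, ENNReal.ofReal (C ^ q * (φ (P.pt i.succ) - φ (P.pt i.castSucc))) := by
          refine Finset.sum_le_sum fun i _ => ?_
          have hnn : 0 ≤ φ (P.pt i.succ) - φ (P.pt i.castSucc) := sub_nonneg.2 (hφ (hm i))
          rw [← ofReal_norm, ENNReal.ofReal_rpow_of_nonneg (norm_nonneg _) hq.le]
          refine ENNReal.ofReal_le_ofReal ?_
          calc _ ≤ (C * (φ (P.pt i.succ) - φ (P.pt i.castSucc)) ^ (1 / q)) ^ q :=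
                Real.rpow_le_rpow (norm_nonneg _) (hG _ _ (h0 _) (hm i) (hT _)) hq.le
            _ = _ := by
                rw [Real.mul_rpow hC (Real.rpow_nonneg hnn _), ← Real.rpow_mul hnn, one_div,
                  inv_mul_cancel₀ hq.ne', Real.rpow_one]
      _ = ENNReal.ofReal (C ^ q * (φ T - φ 0)) := by
          rw [← ENNReal.ofReal_sum_of_nonneg fun i _ => mul_nonneg (Real.rpow_nonneg hC _)
            (sub_nonneg.2 (hφ (hm i))), ← Finset.mul_sum,
            sum_fin_succ_sub_castSucc (fun i => φ (P.pt i)), P.first, P.last]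
      _ ≤ _ := by gcongr
  -- For `T < 0` there is no partition and the supremum is zero.
  by_cases hT : Nonempty (IntervalPartition 0 T)
  · have hT0 : 0 ≤ T := by
      obtain ⟨P⟩ := hT
      exact (P.left_le 0).trans (P.le_right 0)
    have hW0 : 0 ≤ W := (sub_nonneg.2 (hφ hT0)).trans hW
    calc eVar₂ q 0 T G ≤ ENNReal.ofReal (C ^ q * W) ^ (1 / q) :=
          ENNReal.rpow_le_rpow (iSup_le key) (by positivity)
      _ = _ := by
          rw [ENNReal.ofReal_rpow_of_nonneg (by positivity) (by positivity),
            Real.mul_rpow (by positivity) hW0, ← Real.rpow_mul hC, one_div,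
            mul_inv_cancel₀ hq.ne', Real.rpow_one]
  · have : eVar₂ q 0 T G = 0 := by
      rw [not_nonempty_iff] at hT
      rw [eVar₂, iSup_of_empty]
      simp [hq]
    rw [this]; exact zero_le

theorem var₂_le_of_control {q T : ℝ} (hq : 0 < q) (hT : 0 ≤ T) {G : ℝ → ℝ → E} {φ : ℝ → ℝ}
    (hφ : Monotone φ) {C W : ℝ} (hC : 0 ≤ C) (hW : φ T - φ 0 ≤ W)
    (hG : ∀ s t, 0 ≤ s → s ≤ t → t ≤ T → ‖G s t‖ ≤ C * (φ t - φ s) ^ (1 / q)) :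
    (var₂ q T G : ℝ) ≤ C * W ^ (1 / q) := by
  have h := ENNReal.toReal_mono ENNReal.ofReal_ne_top (eVar₂_le_of_control hq hφ hC hW hG)
  have hW0 : 0 ≤ W := (sub_nonneg.2 (hφ hT)).trans hW
  rwa [ENNReal.toReal_ofReal (by positivity)] at h

/-- A path whose increments are controlled has left limits. -/
theorem exists_left_limit [CompleteSpace E] {φ : ℝ → ℝ} (hφ : Monotone φ) {β C T : ℝ} (hβ : 0 < β)
    {Y : ℝ → E}
    (hY : ∀ s t, 0 ≤ s → s ≤ t → t ≤ T → ‖Y t - Y s‖ ≤ C * (φ t - φ s) ^ β) {t : ℝ} (htT : t ≤ T) :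
    ∃ l, Tendsto Y (𝓝[Ico 0 t] t) (𝓝 l) := by
  by_cases hb : 𝓝[Ico 0 t] t = ⊥
  · exact ⟨0, by rw [hb]; exact tendsto_bot⟩
  have : NeBot (𝓝[Ico 0 t] t) := ⟨hb⟩
  rw [← cauchy_map_iff_exists_tendsto]
  -- A monotone function has left limits, so the increments of `φ` near `t` from the left tend to
  -- zero and `Y` is Cauchy there, even if `φ` jumps at `t`.
  have hlim : Tendsto φ (𝓝[Ico 0 t] t) (𝓝 (Function.leftLim φ t)) :=
    (hφ.tendsto_leftLim t).mono_left (nhdsWithin_mono t fun s hs => hs.2)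
  have h2 : Tendsto (fun z : ℝ × ℝ => max C 0 * |φ z.2 - φ z.1| ^ β)
      (𝓝[Ico 0 t] t ×ˢ 𝓝[Ico 0 t] t) (𝓝 0) := by
    have a1 := (hlim.comp tendsto_snd).sub (hlim.comp (tendsto_fst (f := 𝓝[Ico 0 t] t) (g := 𝓝[Ico 0 t] t)))
    rw [sub_self] at a1
    have a2 := (((continuous_abs.tendsto _).comp a1).rpow_const (p := β) (Or.inr hβ.le)).const_mul (max C 0)
    simpa [hβ.ne'] using a2
  rw [cauchy_map_iff]
  refine ⟨inferInstance, ?_⟩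
  rw [Metric.uniformity_eq_comap_nhds_zero, tendsto_comap_iff]
  refine squeeze_zero' (Eventually.of_forall fun z => dist_nonneg) ?_ h2
  have hm : ∀ᶠ z : ℝ × ℝ in 𝓝[Ico 0 t] t ×ˢ 𝓝[Ico 0 t] t, z.1 ∈ Ico 0 t ∧ z.2 ∈ Ico 0 t :=
    (eventually_mem_nhdsWithin.prod_mk eventually_mem_nhdsWithin)
  filter_upwards [hm] with z hz
  simp only [Function.comp_apply, dist_eq_norm]
  have aux : ∀ s u, 0 ≤ s → s ≤ u → u < t → ‖Y u - Y s‖ ≤ max C 0 * |φ u - φ s| ^ β := by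
    intro s u hs hsu hut
    refine (hY s u hs hsu (hut.le.trans htT)).trans ?_
    rw [abs_of_nonneg (sub_nonneg.2 (hφ hsu))]
    have : 0 ≤ φ u - φ s := sub_nonneg.2 (hφ hsu)
    gcongr
    exact le_max_left _ _
  rcases le_total z.1 z.2 with h | h
  · rw [norm_sub_rev]; exact aux _ _ hz.1.1 h hz.2.2
  · rw [abs_sub_comm]; exact aux _ _ hz.2.1 h hz.1.2

/-- The gauge `|φ t - φ s|^{1/p}` of a control. -/
noncomputable def gaugeOf {ι : Type*} (p : ℝ) (φ : ι → ℝ) (s t : ι) : ℝ := |φ t - φ s| ^ (1 / p)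

theorem gaugeOf_nonneg {ι : Type*} (p : ℝ) (φ : ι → ℝ) (s t : ι) : 0 ≤ gaugeOf p φ s t :=
  Real.rpow_nonneg (abs_nonneg _) _

theorem gaugeOf_sq {ι : Type*} {p : ℝ} {φ : ι → ℝ} {s t : ι} (h : φ s ≤ φ t) :
    gaugeOf p φ s t ^ 2 = (φ t - φ s) ^ (1 / (p / 2)) := by
  rw [gaugeOf, abs_of_nonneg (sub_nonneg.2 h), ← Real.rpow_natCast,
    ← Real.rpow_mul (sub_nonneg.2 h)]
  congr 1; push_cast; rw [one_div_div]; ring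

theorem le_gaugeOf {ι : Type*} {p : ℝ} (hp : 0 < p) {φ : ι → ℝ} {s t : ι} {a : ℝ} (ha : 0 ≤ a)
    (h : a ^ p ≤ φ t - φ s) : a ≤ gaugeOf p φ s t := by
  have h0 : 0 ≤ φ t - φ s := (Real.rpow_nonneg ha p).trans h
  rw [gaugeOf, abs_of_nonneg h0]
  calc a = (a ^ p) ^ (1 / p) := by
        rw [← Real.rpow_mul ha, mul_one_div_cancel hp.ne', Real.rpow_one]
    _ ≤ _ := Real.rpow_le_rpow (Real.rpow_nonneg ha p) h (by positivity)

theorem le_gaugeOf_sq {ι : Type*} {p : ℝ} (hp : 0 < p) {φ : ι → ℝ} {s t : ι} {a : ℝ} (ha : 0 ≤ a)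
    (h : a ^ (p / 2) ≤ φ t - φ s) : a ≤ gaugeOf p φ s t ^ 2 := by
  have h0 : 0 ≤ φ t - φ s := (Real.rpow_nonneg ha _).trans h
  rw [gaugeOf_sq (by linarith)]
  calc a = (a ^ (p / 2)) ^ (1 / (p / 2)) := by
        rw [← Real.rpow_mul ha, mul_one_div_cancel (by positivity), Real.rpow_one]
    _ ≤ _ := Real.rpow_le_rpow (Real.rpow_nonneg ha _) h (by positivity)

theorem gaugeOf_mono {ι : Type*} {p : ℝ} (hp : 0 < p) {φ : ι → ℝ} {s t s' t' : ι}
    (h : |φ t' - φ s'| ≤ |φ t - φ s|) : gaugeOf p φ s' t' ≤ gaugeOf p φ s t :=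
  Real.rpow_le_rpow (abs_nonneg _) h (by positivity)

end Control

end RoughPath

namespace RoughPath

/-! ### Smallness of the germ over fine meshes -/

section Mesh

variable {d : ℕ}

/-- Chen's relation solved for the area of the right-hand interval; the Euclidean norm of `u ⊗ v` is
`‖u‖ * ‖v‖`. -/
theorem norm_area_le {M M₁ M₂ : Mat d} {u v : Vec d}
    (h : ∀ i j, M₁ (i, j) = M₂ (i, j) + M (i, j) + u i * v j) :
    ‖M‖ ≤ ‖M₁‖ + ‖M₂‖ + ‖u‖ * ‖v‖ := by
  set O : Mat d := WithLp.toLp 2 fun ij => u ij.1 * v ij.2 with hO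
  have hn : ‖O‖ = ‖u‖ * ‖v‖ := by
    rw [EuclideanSpace.norm_eq, EuclideanSpace.norm_eq, EuclideanSpace.norm_eq,
      ← Real.sqrt_mul (Finset.sum_nonneg fun _ _ => by positivity), Finset.sum_mul_sum,
      Fintype.sum_prod_type]
    simp [hO, mul_pow]
  have e : M = M₁ - M₂ - O := by
    ext ⟨i, j⟩
    simp only [hO, h i j, PiLp.sub_apply]
    ring
  rw [e, ← hn]
  exact (norm_sub_le _ _).trans (add_le_add (norm_sub_le _ _) le_rfl)

variable {p T : ℝ} {X : ℝ → Vec d} {𝕏 : ℝ → ℝ → Mat d}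

theorem IsRoughPath.area_self (hX : IsRoughPath p T X 𝕏) {s : ℝ} (h0 : 0 ≤ s) (hT : s ≤ T) :
    𝕏 s s = 0 := by
  ext ⟨i, j⟩
  have := hX.chen s s s h0 le_rfl le_rfl hT i j
  simp only [incr, sub_self, PiLp.zero_apply, mul_zero, add_zero] at this
  simp only [PiLp.zero_apply]
  linarith

/-- Right-continuity at `τ` concerns intervals starting at `τ` only; Chen's relation transfers the
smallness to all `[u, t]` to the right of `τ`. -/
theorem IsRoughPath.small_right (hX : IsRoughPath p T X 𝕏) {τ : ℝ} (hτ : τ ∈ Icc 0 T) {ε : ℝ}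
    (hε : 0 < ε) : ∃ ρ > 0, ∀ u t, τ ≤ u → u ≤ t → t < τ + ρ → t ≤ T →
      ‖X t - X u‖ ≤ ε ∧ ‖𝕏 u t‖ ≤ ε := by
  set η := min 1 (ε / 6) with hη
  have hη0 : 0 < η := by positivity
  have c1 := (hX.path.cadlag τ hτ).1
  have c2 := (hX.area.cadlag_right τ hτ τ ⟨le_rfl, hτ.2⟩).1
  rw [Metric.continuousWithinAt_iff] at c1 c2
  obtain ⟨ρ₁, h1, k1⟩ := c1 η hη0
  obtain ⟨ρ₂, h2, k2⟩ := c2 η hη0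
  refine ⟨min ρ₁ ρ₂, lt_min h1 h2, fun u t hτu hut htρ htT => ?_⟩
  have hd : ∀ s, τ ≤ s → s ≤ t → ‖X s - X τ‖ ≤ η ∧ ‖𝕏 τ s‖ ≤ η := fun s hs hst => by
    have hds : dist s τ < min ρ₁ ρ₂ := by
      rw [Real.dist_eq, abs_of_nonneg (by linarith)]; linarith
    have a1 := k1 ⟨hs, hst.trans htT⟩ (hds.trans_le (min_le_left _ _))
    have a2 := k2 ⟨hs, hst.trans htT⟩ (hds.trans_le (min_le_right _ _))
    rw [hX.area_self hτ.1 hτ.2] at a2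
    rw [dist_eq_norm] at a1 a2
    rw [sub_zero] at a2
    exact ⟨a1.le, a2.le⟩
  obtain ⟨u1, u2⟩ := hd u hτu hut
  obtain ⟨t1, t2⟩ := hd t (hτu.trans hut) le_rfl
  have hη6 : η ≤ ε / 6 := min_le_right _ _
  have hη1 : η ≤ 1 := min_le_left _ _
  have hx : ‖X t - X u‖ ≤ 2 * η := by
    calc ‖X t - X u‖ = ‖(X t - X τ) - (X u - X τ)‖ := by congr 1; abel
      _ ≤ η + η := (norm_sub_le _ _).trans (add_le_add t1 u1)
      _ = _ := by ring
  refine ⟨hx.trans (by linarith), ?_⟩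
  have := norm_area_le (M := 𝕏 u t) (M₁ := 𝕏 τ t) (M₂ := 𝕏 τ u) (u := incr X τ u) (v := incr X u t)
    fun i j => hX.chen τ u t hτ.1 hτu hut htT i j
  calc ‖𝕏 u t‖ ≤ ‖𝕏 τ t‖ + ‖𝕏 τ u‖ + ‖X u - X τ‖ * ‖X t - X u‖ := this
    _ ≤ η + η + 1 * (2 * η) := by
        gcongr
        exact u1.trans hη1
    _ ≤ ε := by linarith

/-- Over short intervals `[s, t]` and for `s ≤ u ≤ t`, either the control of `[s, u]` is small or
the driver is small over `[u, t]`. -/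
theorem IsRoughPath.exists_mesh (hX : IsRoughPath p T X 𝕏) {φ : ℝ → ℝ} (hφ : Monotone φ) {ε : ℝ}
    (hε : 0 < ε) : ∃ δ > 0, ∀ s u t, 0 ≤ s → s ≤ u → u ≤ t → t ≤ T → t - s ≤ δ →
      φ u - φ s ≤ ε ∨ (‖X t - X u‖ ≤ ε ∧ ‖𝕏 u t‖ ≤ ε) := by
  -- Near a fixed `τ` the cases are `u < τ`, where `φ s` and `φ u` are both close to the left limit
  -- of `φ`, and `u ≥ τ`, where the driver over `[u, t]` is small by right-continuity. A Lebesgue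
  -- number makes the neighbourhoods uniform.
  have loc : ∀ τ : Icc 0 T, ∃ ρ > 0, ∀ s u t, 0 ≤ s → s ≤ u → u ≤ t → t ≤ T →
      s ∈ Metric.ball (τ : ℝ) ρ → t ∈ Metric.ball (τ : ℝ) ρ →
      φ u - φ s ≤ ε ∨ (‖X t - X u‖ ≤ ε ∧ ‖𝕏 u t‖ ≤ ε) := by
    rintro ⟨τ, hτ⟩
    obtain ⟨ρ, hρ, h1⟩ := hX.small_right hτ hε
    have h2 : ∀ᶠ s in 𝓝[<] τ, Function.leftLim φ τ - ε < φ s :=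
      (hφ.tendsto_leftLim τ).eventually (lt_mem_nhds (by linarith))
    obtain ⟨c, hc, h3⟩ := (mem_nhdsLT_iff_exists_Ioo_subset (a := τ)).1 h2
    refine ⟨min ρ (τ - c), lt_min hρ (sub_pos.2 hc), fun s u t hs hsu hut htT hsb htb => ?_⟩
    rw [Metric.mem_ball, Real.dist_eq, abs_lt] at hsb htb
    have m1 := min_le_left ρ (τ - c)
    have m2 := min_le_right ρ (τ - c)
    rcases lt_or_ge u τ with hu | hu
    · left
      have e1 := h3 (show s ∈ Ioo c τ from ⟨by linarith [hsb.1], by linarith⟩)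
      have e2 := hφ.le_leftLim hu
      simp only [mem_ofPred_eq] at e1
      linarith
    · right
      exact h1 u t hu hut (by linarith [htb.2]) htT
  choose ρ hρ hloc using loc
  obtain ⟨δ, hδ, h⟩ := lebesgue_number_lemma_of_metric (isCompact_Icc (a := (0 : ℝ)) (b := T))
    (c := fun τ : Icc 0 T => Metric.ball (τ : ℝ) (ρ τ)) (fun _ => Metric.isOpen_ball)
    (fun τ hτ => mem_iUnion.2 ⟨⟨τ, hτ⟩, Metric.mem_ball_self (hρ _)⟩)
  refine ⟨δ / 2, by positivity, fun s u t hs hsu hut htT hts => ?_⟩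
  obtain ⟨τ, hτ⟩ := h s ⟨hs, (hsu.trans hut).trans htT⟩
  refine hloc τ s u t hs hsu hut htT (hτ (Metric.mem_ball_self hδ)) (hτ ?_)
  rw [Metric.mem_ball, Real.dist_eq, abs_of_nonneg (by linarith)]
  linarith

/-- A control of the rough path `(X, 𝕏)`. -/
structure IsControlOf (p T : ℝ) (X : ℝ → Vec d) (𝕏 : ℝ → ℝ → Mat d) (φ : ℝ → ℝ) : Prop where
  mono : Monotone φ
  path : ∀ s t, 0 ≤ s → s ≤ t → t ≤ T → ‖X t - X s‖ ≤ gaugeOf p φ s t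
  area : ∀ s t, 0 ≤ s → s ≤ t → t ≤ T → ‖𝕏 s t‖ ≤ gaugeOf p φ s t ^ 2

/-- Sewing errors over intervals of length at most `δ` are small compared to the control. -/
theorem IsRoughPath.exists_sewing_mesh {E : Type*} [NormedAddCommGroup E] (hp : 0 < p) (hp3 : p < 3)
    (hX : IsRoughPath p T X 𝕏) {φ : ℝ → ℝ}
    (hφ : IsControlOf p T X 𝕏 φ) {A : ℝ} (hA : 0 ≤ A) {ε : ℝ} (hε : 0 < ε) :
    ∃ δ > 0, ∀ (t : ℕ → ℝ), Monotone t → (∀ i, t i ∈ Icc 0 T) → ∀ J : ℕ → ℕ → E,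
      (∀ i, J i i = 0) → (∀ i, J i (i + 1) = 0) →
      (∀ i m j, i ≤ m → m ≤ j → ‖J i j - J i m - J m j‖ ≤
        A * (gaugeOf p φ (t i) (t m) ^ 2 * ‖X (t j) - X (t m)‖
          + gaugeOf p φ (t i) (t m) * ‖𝕏 (t m) (t j)‖)) →
      ∀ i j, i ≤ j → t j - t i ≤ δ → ‖J i j‖ ≤ ε * (φ (t j) - φ (t i)) := by
  -- exponents
  set β := (1 / 3 + 1 / p) / 2 with hβ
  have hp3' : 1 / 3 < 1 / p := one_div_lt_one_div_of_lt hp hp3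
  have hβ3 : 1 < 3 * β := by rw [hβ]; linarith
  have hβ0 : 0 < β := by linarith
  -- Interpolation parameter: `β` lies midway between `1 / 3` and `1 / p`, and `3 * β = lam * (3 /
  -- p)`. Giving up part of the exponent `3 / p` while keeping `3 * β > 1` leaves the power `1 -
  -- lam` of the defect to exploit its smallness.
  set lam := p * β with hlam
  have hlam0 : 0 < lam := by positivity
  have hlam1 : lam < 1 := by
    have : lam = (p / 3 + 1) / 2 := by rw [hlam, hβ]; field_simp
    rw [this]; linarith
  set κ : ℝ := 2 ^ (1 - 3 * β) with hκ
  have hκ1 : κ < 1 := Real.rpow_lt_one_of_one_lt_of_neg (by norm_num) (by linarith)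
  -- constants
  set W := |φ T - φ 0| with hW
  set H := W ^ (1 / p) with hH
  have hH0 : 0 ≤ H := Real.rpow_nonneg (abs_nonneg _) _
  have hWβ : 0 ≤ W ^ (3 * β - 1) := Real.rpow_nonneg (abs_nonneg _) _
  -- Chosen so that the sewing constant `2 * K / (1 - κ)`, times the surplus power `W ^ (3 * β - 1)`
  -- of the control, stays below `ε`.
  set K := ε * (1 - κ) / (2 * (W ^ (3 * β - 1) + 1)) with hK
  have hK0 : 0 < K := by
    have : 0 < 1 - κ := by linarith
    positivity
  set a := (2 * A + 1) ^ lam with ha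
  have ha0 : 0 < a := by positivity
  -- The uniform size of the defect for which the interpolated constant `η ^ (1 - lam) * a` equals
  -- `K`.
  set η := (K / a) ^ (1 / (1 - lam)) with hη
  have hη0 : 0 < η := by positivity
  have hηK : η ^ (1 - lam) * a = K := by
    rw [hη, ← Real.rpow_mul (by positivity), one_div, inv_mul_cancel₀ (by linarith), Real.rpow_one]
    field_simp
  set θ := min 1 (η / (A * (H ^ 2 + H) + 1)) with hθ
  have hθ0 : 0 < θ := by positivity
  have hθ1 : θ ≤ 1 := min_le_left _ _
  have hθη : A * (H ^ 2 + H) * θ ≤ η := by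
    calc A * (H ^ 2 + H) * θ ≤ (A * (H ^ 2 + H) + 1) * (η / (A * (H ^ 2 + H) + 1)) := by
          gcongr
          · linarith
          · exact min_le_right _ _
      _ = η := by field_simp
  obtain ⟨δ, hδ, hmesh⟩ := hX.exists_mesh hφ.mono (ε := θ ^ p) (by positivity)
  -- Only `0 < p < 3` is assumed, so `θ ^ p` and `θ` are not ordered. The first mesh makes the gauge
  -- at most `θ` or the driver at most `θ ^ p`; the second one settles the case `θ < θ ^ p`.
  obtain ⟨δ', hδ', hmesh'⟩ := hX.exists_mesh hφ.mono (ε := θ) hθ0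
  refine ⟨min δ δ', lt_min hδ hδ', ?_⟩
  intro t ht htm J J0 J1 hJ i₀ j₀ hij₀ htδ
  have hmono : Monotone fun i => φ (t i) := hφ.mono.comp ht
  -- Sewing is run with the gauge of exponent `β`, weaker than `1 / p` but still with `3 * β > 1`.
  have hg := isGauge_rpow hmono hβ0
  have hgH : ∀ i j, i ≤ j → gaugeOf p φ (t i) (t j) ≤ H := fun i j hij => by
    refine Real.rpow_le_rpow (abs_nonneg _) ?_ (by positivity)
    have e1 := hφ.mono (htm i).1
    have e2 := hφ.mono (htm j).2
    have e3 := hmono hij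
    simp only at e3
    rw [hW, abs_of_nonneg (by linarith), abs_of_nonneg (by linarith)]
    linarith
  set Λ := 2 * K / (1 - κ) with hΛ
  have hΛ0 : 0 ≤ Λ := div_nonneg (by positivity) (by linarith)
  have key := hg.sewing (K := K) hΛ0 hK0.le
    (le_of_eq (by rw [hΛ, mul_div_cancel₀ _ (by linarith)])) J0 J1 (a := i₀) (b := j₀) ?_ i₀ j₀
    le_rfl hij₀ le_rfl
  · refine key.trans ?_
    have hw0 : 0 ≤ φ (t j₀) - φ (t i₀) := sub_nonneg.2 (hmono hij₀)
    rw [abs_of_nonneg hw0]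
    set w := φ (t j₀) - φ (t i₀) with hw
    have hwW : w ≤ W := by
      have e1 := hφ.mono (htm i₀).1
      have e2 := hφ.mono (htm j₀).2
      exact le_trans (by rw [hw]; linarith) (le_abs_self _)
    have e : (w ^ β) ^ 3 = w ^ (3 * β - 1) * w := by
      rw [← Real.rpow_natCast, ← Real.rpow_mul hw0]
      conv_rhs => rw [← Real.rpow_one w, ← Real.rpow_mul hw0]
      rw [one_mul, ← Real.rpow_add' hw0 (by linarith)]
      congr 1; push_cast; ring
    rw [e, ← mul_assoc]
    refine mul_le_mul_of_nonneg_right ?_ hw0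
    have : 1 - κ ≠ 0 := by linarith
    calc Λ * w ^ (3 * β - 1) ≤ Λ * (W ^ (3 * β - 1) + 1) := by
          gcongr
          refine (Real.rpow_le_rpow hw0 hwW (by linarith)).trans (by linarith)
      _ = ε := by rw [hΛ, hK]; field_simp
  · intro i m j hi him hmj hj _
    have hts : t j - t i ≤ min δ δ' := by
      have := ht hi; have := ht hj; linarith
    have h0 := gaugeOf_nonneg p φ (t i) (t m)
    have hdi := hJ i m j him hmj
    have hpath := hφ.path (t m) (t j) (htm m).1 (ht hmj) (htm j).2
    have harea := hφ.area (t m) (t j) (htm m).1 (ht hmj) (htm j).2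
    have g1 := gaugeOf_nonneg p φ (t m) (t j)
    set D := ‖J i j - J i m - J m j‖ with hD
    have hD0 : 0 ≤ D := norm_nonneg _
    -- crude bound
    have b1 : D ≤ (2 * A + 1) * |φ (t j) - φ (t i)| ^ (3 / p) := by
      have e1 := hmono him
      have e2 := hmono hmj
      simp only at e1 e2
      have l1 : gaugeOf p φ (t i) (t m) ≤ gaugeOf p φ (t i) (t j) := gaugeOf_mono hp (by
        rw [abs_of_nonneg (by linarith), abs_of_nonneg (by linarith)]; linarith)
      have l2 : gaugeOf p φ (t m) (t j) ≤ gaugeOf p φ (t i) (t j) := gaugeOf_mono hp (by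
        rw [abs_of_nonneg (by linarith), abs_of_nonneg (by linarith)]; linarith)
      have e3 : |φ (t j) - φ (t i)| ^ (3 / p) = gaugeOf p φ (t i) (t j) ^ 3 := by
        rw [gaugeOf, ← Real.rpow_natCast, ← Real.rpow_mul (abs_nonneg _)]
        congr 1; push_cast; ring
      rw [e3]
      set w := gaugeOf p φ (t i) (t j) with hw
      have hw0 : 0 ≤ w := gaugeOf_nonneg _ _ _ _
      calc D ≤ A * (w ^ 2 * w + w * w ^ 2) := by
            refine hdi.trans ?_
            gcongr
            · exact hpath.trans l2
            · exact harea.trans (by gcongr)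
        _ = 2 * A * w ^ 3 := by ring
        _ ≤ _ := by gcongr; linarith
    -- smallness
    have b2 : D ≤ η := by
      refine le_trans ?_ hθη
      by_cases hsm : φ (t m) - φ (t i) ≤ θ ^ p
      · have l1 : gaugeOf p φ (t i) (t m) ≤ θ := by
          rw [gaugeOf, abs_of_nonneg (sub_nonneg.2 (hmono him))]
          calc _ ≤ (θ ^ p) ^ (1 / p) :=
                Real.rpow_le_rpow (sub_nonneg.2 (hmono him)) hsm (by positivity)
            _ = θ := by rw [← Real.rpow_mul hθ0.le, mul_one_div_cancel hp.ne', Real.rpow_one]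
        have l2 := hgH m j hmj
        calc D ≤ A * (θ * 1 * H + θ * H ^ 2) := by
              refine hdi.trans ?_
              gcongr
              · rw [sq]; gcongr; exact l1.trans hθ1
              · exact hpath.trans l2
              · exact harea.trans (by gcongr)
          _ = _ := by ring
      · have hb : ‖X (t j) - X (t m)‖ ≤ θ ∧ ‖𝕏 (t m) (t j)‖ ≤ θ := by
          rcases hmesh (t i) (t m) (t j) (htm i).1 (ht him) (ht hmj) (htm j).2
            (hts.trans (min_le_left _ _)) with h | ⟨h1, h2⟩
          · exact absurd h hsm
          · have : θ ^ p ≤ θ ∨ ¬ θ ^ p ≤ θ := em _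
            rcases hmesh' (t i) (t m) (t j) (htm i).1 (ht him) (ht hmj) (htm j).2
              (hts.trans (min_le_right _ _)) with h3 | h3
            · rcases this with h4 | h4
              · exact ⟨h1.trans h4, h2.trans h4⟩
              · exact absurd (h3.trans (not_le.1 h4).le) hsm
            · exact h3
        have l2 := hgH i m him
        calc D ≤ A * (H ^ 2 * θ + H * θ) := by
              refine hdi.trans ?_
              gcongr
              · exact hb.1
              · exact hb.2
          _ = _ := by ring
    -- interpolation
    have e4 : (|φ (t j) - φ (t i)| ^ β) ^ 3 = (|φ (t j) - φ (t i)| ^ (3 / p)) ^ lam := by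
      rw [← Real.rpow_natCast, ← Real.rpow_mul (abs_nonneg _), ← Real.rpow_mul (abs_nonneg _)]
      congr 1; rw [hlam]; push_cast; field_simp
    calc D = D ^ (1 - lam) * D ^ lam := by
          rw [← Real.rpow_add' hD0 (by norm_num)]; simp
      _ ≤ η ^ (1 - lam) * ((2 * A + 1) * |φ (t j) - φ (t i)| ^ (3 / p)) ^ lam := by
          gcongr
      _ = (η ^ (1 - lam) * a) * (|φ (t j) - φ (t i)| ^ β) ^ 3 := by
          rw [Real.mul_rpow (by positivity) (by positivity), e4]; ring
      _ = _ := by rw [hηK]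

end Mesh

end RoughPath

namespace RoughPath

/-! ### Stopped paths -/

section Stopped

variable {d k ℓ : ℕ}

/-- The embedding of `ℝ^k` into the blocks which are active at time `s`. -/
noncomputable def embed (r : Fin ℓ → ℝ) (s : ℝ) : Vec k →L[ℝ] BlockVec k ℓ :=
  (PiLp.continuousLinearEquiv 2 ℝ (fun _ : Fin (ℓ + 1) => Vec k)).symm.toContinuousLinearMap ∘L
    ContinuousLinearMap.pi
      (Fin.cons (ContinuousLinearMap.id ℝ _)
        (fun i => if s < r i then ContinuousLinearMap.id ℝ _ else 0) :
        Fin (ℓ + 1) → Vec k →L[ℝ] Vec k)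

@[simp] theorem embed_zero (r : Fin ℓ → ℝ) (s : ℝ) (v : Vec k) : embed r s v 0 = v := by
  simp [embed]

@[simp] theorem embed_succ (r : Fin ℓ → ℝ) (s : ℝ) (v : Vec k) (i : Fin ℓ) :
    embed r s v i.succ = if s < r i then v else 0 := by
  by_cases h : s < r i <;> simp [embed, h]

@[simp] theorem stopped_zero (r : Fin ℓ → ℝ) (Y : ℝ → Vec k) (s : ℝ) : stopped r Y s 0 = Y s := by
  simp [stopped]

@[simp] theorem stopped_succ (r : Fin ℓ → ℝ) (Y : ℝ → Vec k) (s : ℝ) (i : Fin ℓ) :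
    stopped r Y s i.succ = Y (min s (r i)) := by
  simp [stopped]

theorem stoppedDeriv_eq (r : Fin ℓ → ℝ) (Y' : ℝ → Vec d →L[ℝ] Vec k) (s : ℝ) :
    stoppedDeriv r Y' s = embed r s ∘L Y' s := by
  ext v i : 2
  refine Fin.cases ?_ (fun i => ?_) i
  · simp [stoppedDeriv]
  · by_cases h : s < r i <;> simp [stoppedDeriv, h]

theorem coeffDeriv_eq (f : BlockVec k ℓ → Vec d →L[ℝ] Vec k) (r : Fin ℓ → ℝ) (Y : ℝ → Vec k)
    (Y' : ℝ → Vec d →L[ℝ] Vec k) :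
    coeffDeriv f r Y Y' = chainDeriv f (embed r) (stopped r Y) Y' := by
  funext s
  rw [coeffDeriv, stoppedDeriv_eq, chainDeriv]

theorem norm_embed_le (r : Fin ℓ → ℝ) (s : ℝ) :
    ‖(embed r s : Vec k →L[ℝ] BlockVec k ℓ)‖ ≤ ℓ + 1 := by
  refine ContinuousLinearMap.opNorm_le_bound _ (by positivity) fun v => ?_
  rw [PiLp.norm_eq_of_L2]
  refine Real.sqrt_le_iff.2 ⟨by positivity, ?_⟩
  have : ∀ i, ‖embed r s v i‖ ^ 2 ≤ ‖v‖ ^ 2 := fun i => by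
    refine Fin.cases ?_ (fun i => ?_) i
    · simp
    · rw [embed_succ]; split_ifs <;> simp
  calc _ ≤ ∑ _i : Fin (ℓ + 1), ‖v‖ ^ 2 := Finset.sum_le_sum fun i _ => this i
    _ = (ℓ + 1) * ‖v‖ ^ 2 := by simp
    _ ≤ (ℓ + 1) ^ 2 * ‖v‖ ^ 2 := by
        gcongr
        nlinarith [(Nat.cast_nonneg ℓ : (0 : ℝ) ≤ ℓ)]
    _ = _ := by ring

/-- If no `r i` lies strictly inside `(s, t)`, a block is either frozen throughout or moves with
`Y`. The case `t = r i` is allowed, so steps between consecutive grid points qualify. -/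
theorem stopped_sub (r : Fin ℓ → ℝ) (Y : ℝ → Vec k) {s t : ℝ} (hst : s ≤ t)
    (hr : ∀ i, r i ≤ s ∨ t ≤ r i) : stopped r Y t - stopped r Y s = embed r s (Y t - Y s) := by
  ext i : 1
  refine Fin.cases ?_ (fun i => ?_) i
  · simp
  · rw [PiLp.sub_apply, stopped_succ, stopped_succ, embed_succ]
    rcases hr i with h | h
    · rw [min_eq_right h, min_eq_right (h.trans hst), sub_self, if_neg (not_lt.2 h)]
    · rcases hst.eq_or_lt with rfl | hlt
      · simp
      · rw [min_eq_left h, min_eq_left (hst.trans h), if_pos (hlt.trans_le h)]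

/-- In contrast to the increment of the stopped path, `t = r i` has to be excluded: the block ceases
to be active at `r i` itself. -/
theorem embed_eq (r : Fin ℓ → ℝ) {s t : ℝ} (hst : s ≤ t) (hr : ∀ i, r i ≤ s ∨ t < r i) :
    (embed r t : Vec k →L[ℝ] BlockVec k ℓ) = embed r s := by
  ext v i : 2
  refine Fin.cases ?_ (fun i => ?_) i
  · simp
  · rw [embed_succ, embed_succ]
    rcases hr i with h | h
    · rw [if_neg (not_lt.2 (h.trans hst)), if_neg (not_lt.2 h)]
    · rw [if_pos h, if_pos (hst.trans_lt h)]

theorem norm_le_stopped (Yb : BlockVec k ℓ) : ‖Yb 0‖ ≤ ‖Yb‖ := PiLp.norm_apply_le Yb 0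

theorem stopped_start (r : Fin ℓ → ℝ) (hr : ∀ i, 0 ≤ r i) (Y : ℝ → Vec k) :
    stopped r Y 0 = WithLp.toLp 2 (fun _ => Y 0) := by
  ext i : 1
  refine Fin.cases ?_ (fun i => ?_) i
  · simp
  · simp [min_eq_left (hr i)]

theorem norm_stopped_start_sub (r : Fin ℓ → ℝ) (hr : ∀ i, 0 ≤ r i) (Y Z : ℝ → Vec k) :
    ‖stopped r Y 0 - stopped r Z 0‖ ≤ (ℓ + 1) * ‖Y 0 - Z 0‖ := by
  rw [stopped_start r hr, stopped_start r hr, PiLp.norm_eq_of_L2]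
  refine Real.sqrt_le_iff.2 ⟨by positivity, ?_⟩
  simp only [PiLp.sub_apply, Finset.sum_const, Finset.card_univ, Fintype.card_fin, nsmul_eq_mul]
  push_cast
  calc _ ≤ ((ℓ : ℝ) + 1) ^ 2 * ‖Y 0 - Z 0‖ ^ 2 := by
        gcongr
        nlinarith [(Nat.cast_nonneg ℓ : (0 : ℝ) ≤ ℓ)]
    _ = _ := by ring

/-- The control `φ` increases by at least one over every interval `(s, t]` containing some `r i`. -/
def Separates (T : ℝ) (r : Fin ℓ → ℝ) (φ : ℝ → ℝ) : Prop :=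
  ∀ s t, 0 ≤ s → s ≤ t → t ≤ T → φ t - φ s < 1 → ∀ i, r i ≤ s ∨ t < r i

/-- The number of times `r i` up to time `t`. -/
noncomputable def countUpTo (r : Fin ℓ → ℝ) (t : ℝ) : ℝ :=
  ((Finset.univ.filter fun i => r i ≤ t).card : ℝ)

theorem countUpTo_mono (r : Fin ℓ → ℝ) : Monotone (countUpTo r) := fun s t hst => by
  unfold countUpTo
  exact_mod_cast Finset.card_le_card (Finset.monotone_filter_right _ fun i _ h => le_trans h hst)

theorem countUpTo_nonneg (r : Fin ℓ → ℝ) (t : ℝ) : 0 ≤ countUpTo r t := Nat.cast_nonneg _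

theorem countUpTo_le (r : Fin ℓ → ℝ) (t : ℝ) : countUpTo r t ≤ ℓ := by
  unfold countUpTo
  exact_mod_cast (Finset.card_filter_le _ _).trans (by simp)

theorem countUpTo_add_one_le (r : Fin ℓ → ℝ) {s t : ℝ} {i : Fin ℓ} (h1 : s < r i) (h2 : r i ≤ t) :
    countUpTo r s + 1 ≤ countUpTo r t := by
  unfold countUpTo
  have : (Finset.univ.filter fun i => r i ≤ s) ⊂ Finset.univ.filter fun i => r i ≤ t := by
    refine Finset.ssubset_iff_subset_ne.2 ⟨Finset.monotone_filter_right _ fun j _ h =>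
      le_trans h (h1.le.trans h2), fun h => ?_⟩
    have : i ∈ Finset.univ.filter fun i => r i ≤ t := by simp [h2]
    rw [← h] at this
    simp only [Finset.mem_filter, Finset.mem_univ, true_and] at this
    linarith
  exact_mod_cast Finset.card_lt_card this

end Stopped

/-! ### Finite grids in `[0, T]` -/

section Grid

/-- The points of `D` in `[0, T]`, together with the end points. -/
noncomputable def gridSet (T : ℝ) (D : Finset ℝ) : Finset ℝ :=
  insert 0 (insert T (D.filter fun s => 0 ≤ s ∧ s ≤ T))

theorem gridSet_card_pos (T : ℝ) (D : Finset ℝ) : 0 < (gridSet T D).card :=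
  Finset.card_pos.2 ⟨0, by simp [gridSet]⟩

/-- The increasing enumeration of `gridSet T D`, eventually constant equal to its largest
element. -/
noncomputable def grid (T : ℝ) (D : Finset ℝ) (m : ℕ) : ℝ :=
  (gridSet T D).orderEmbOfFin rfl
    ⟨min m ((gridSet T D).card - 1), by have := gridSet_card_pos T D; omega⟩

variable {T : ℝ} {D : Finset ℝ}

theorem mem_gridSet {s : ℝ} (hs : s ∈ D) (h0 : 0 ≤ s) (hT : s ≤ T) : s ∈ gridSet T D := by
  simp [gridSet, hs, h0, hT]

theorem zero_mem_gridSet : (0 : ℝ) ∈ gridSet T D := by simp [gridSet]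

theorem gridSet_subset (hT : 0 ≤ T) {s : ℝ} (hs : s ∈ gridSet T D) : s ∈ Icc 0 T := by
  simp only [gridSet, Finset.mem_insert, Finset.mem_filter] at hs
  rcases hs with rfl | rfl | h
  · exact ⟨le_rfl, hT⟩
  · exact ⟨hT, le_rfl⟩
  · exact h.2

theorem grid_mem (m : ℕ) : grid T D m ∈ gridSet T D := Finset.orderEmbOfFin_mem _ _ _

theorem gridSet_mono {D' : Finset ℝ} (h : D ⊆ D') : gridSet T D ⊆ gridSet T D' :=
  Finset.insert_subset_insert _ (Finset.insert_subset_insert _ (Finset.filter_subset_filter _ h))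

theorem grid_mem_Icc (hT : 0 ≤ T) (m : ℕ) : grid T D m ∈ Icc 0 T := gridSet_subset hT (grid_mem m)

theorem grid_mono : Monotone (grid T D) := fun i j hij => by
  unfold grid
  exact ((gridSet T D).orderEmbOfFin rfl).monotone
    (Fin.mk_le_mk.2 (min_le_min hij le_rfl))

theorem grid_lt {i j : ℕ} (hij : i < j) (hj : j ≤ (gridSet T D).card - 1) :
    grid T D i < grid T D j := by
  unfold grid
  refine ((gridSet T D).orderEmbOfFin rfl).strictMono (Fin.mk_lt_mk.2 ?_)
  rw [min_eq_left hj, min_eq_left (hij.le.trans hj)]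
  exact hij

theorem exists_grid_eq {s : ℝ} (hs : s ∈ gridSet T D) :
    ∃ i ≤ (gridSet T D).card - 1, grid T D i = s := by
  have : s ∈ Set.range ((gridSet T D).orderEmbOfFin rfl) := by
    rw [Finset.range_orderEmbOfFin]; exact hs
  obtain ⟨⟨i, hi⟩, h⟩ := this
  refine ⟨i, by omega, ?_⟩
  rw [← h, grid]
  congr 2
  omega

/-- The position of `s` in the grid. -/
noncomputable def gridIdx (T : ℝ) (D : Finset ℝ) (s : ℝ) : ℕ := sInf {i | grid T D i = s}

theorem grid_gridIdx {s : ℝ} (hs : s ∈ gridSet T D) : grid T D (gridIdx T D s) = s :=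
  Nat.sInf_mem (s := {i | grid T D i = s}) ((exists_grid_eq hs).imp fun _ h => h.2)

theorem gridIdx_le {i : ℕ} {s : ℝ} (h : grid T D i = s) : gridIdx T D s ≤ i := Nat.sInf_le h

theorem gridIdx_le_card {s : ℝ} (hs : s ∈ gridSet T D) :
    gridIdx T D s ≤ (gridSet T D).card - 1 := by
  obtain ⟨i, hi, h⟩ := exists_grid_eq hs
  exact (gridIdx_le h).trans hi

theorem gridIdx_mono {s t : ℝ} (hs : s ∈ gridSet T D) (ht : t ∈ gridSet T D) (hst : s ≤ t) :
    gridIdx T D s ≤ gridIdx T D t := by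
  by_contra! h
  have h1 := grid_mono (T := T) (D := D) h.le
  rw [grid_gridIdx hs, grid_gridIdx ht] at h1
  obtain rfl := le_antisymm hst h1
  exact lt_irrefl _ h

theorem gridIdx_start (hT : 0 ≤ T) : gridIdx T D 0 = 0 := by
  refine Nat.le_zero.1 (gridIdx_le ?_)
  refine le_antisymm ?_ (grid_mem_Icc hT 0).1
  obtain ⟨i, -, h⟩ := exists_grid_eq (zero_mem_gridSet (T := T) (D := D))
  rw [← h]
  exact grid_mono (Nat.zero_le i)

theorem grid_start (hT : 0 ≤ T) : grid T D 0 = 0 := by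
  have := grid_gridIdx (zero_mem_gridSet (T := T) (D := D))
  rwa [gridIdx_start hT] at this

theorem grid_gap {s : ℝ} (hs : s ∈ gridSet T D) (m : ℕ) : s ≤ grid T D m ∨ grid T D (m + 1) ≤ s := by
  obtain ⟨i, -, h⟩ := exists_grid_eq hs
  rw [← h]
  rcases le_or_gt i m with h | h
  · exact Or.inl (grid_mono h)
  · exact Or.inr (grid_mono h)

/-- The grids over large finite sets are fine. -/
theorem exists_fine_grid (hT : 0 ≤ T) {δ : ℝ} (hδ : 0 < δ) : ∃ D₀ : Finset ℝ, ∀ D, D₀ ⊆ D →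
    ∀ m, grid T D (m + 1) - grid T D m ≤ δ := by
  obtain ⟨n, hn⟩ := exists_nat_gt (T / δ)
  have hTn : T < n * δ := by rwa [div_lt_iff₀ hδ] at hn
  refine ⟨(Finset.range (n + 1)).image fun j : ℕ => (j : ℝ) * δ, fun D hD m => ?_⟩
  by_contra! hcon
  set s := grid T D m with hs
  have hs0 : 0 ≤ s := (grid_mem_Icc hT m).1
  have hsT : grid T D (m + 1) ≤ T := (grid_mem_Icc hT (m + 1)).2
  -- `j * δ` is the first multiple of `δ` beyond `s`; a gap longer than `δ` would contain it
  -- strictly inside, although it is a grid point.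
  set j := ⌊s / δ⌋₊ + 1 with hj
  have h1 : s < j * δ := by
    rw [← div_lt_iff₀ hδ, hj]; push_cast; exact Nat.lt_floor_add_one _
  have h2 : j * δ ≤ s + δ := by
    have := Nat.floor_le (div_nonneg hs0 hδ.le)
    rw [le_div_iff₀ hδ] at this
    rw [hj]; push_cast; linarith
  have hjT : j * δ ≤ T := by linarith
  have hjn : j < n + 1 := by
    have : (j : ℝ) < n := by
      have := hjT.trans_lt hTn
      exact lt_of_mul_lt_mul_right this hδ.le
    exact Nat.lt_succ_of_lt (by exact_mod_cast this)
  have hmem : (j : ℝ) * δ ∈ gridSet T D :=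
    mem_gridSet (hD (Finset.mem_image.2 ⟨j, Finset.mem_range.2 hjn, rfl⟩)) (by positivity) hjT
  rcases grid_gap hmem m with h | h
  · linarith
  · linarith

/-- The partition of `[0, t]` by the grid points up to `t`. -/
noncomputable def gridPartition (hT : 0 ≤ T) {t : ℝ} (ht : t ∈ gridSet T D) :
    IntervalPartition 0 t where
  n := gridIdx T D t
  pt := fun i => grid T D i
  strictMono := fun i j hij => grid_lt hij ((Nat.lt_succ_iff.1 j.2).trans (gridIdx_le_card ht))
  first := grid_start hT
  last := by simp [grid_gridIdx ht]

theorem gridPartition_mesh_le (hT : 0 ≤ T) {t : ℝ} (ht : t ∈ gridSet T D) {δ : ℝ} (hδ : 0 ≤ δ)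
    (h : ∀ m, grid T D (m + 1) - grid T D m ≤ δ) : (gridPartition hT ht).mesh ≤ δ :=
  Real.iSup_le (fun i => h i) hδ

/-- Grids over increasing finite sets have mesh tending to zero and eventually contain any given
time. A mesh limit can therefore be taken along them, with one grid serving several end points at
once. -/
theorem tendsto_grid_sum {d : ℕ} {E : Type*} [NormedAddCommGroup E] [NormedSpace ℝ E]
    {X : ℝ → Vec d} {𝕏 : ℝ → ℝ → Mat d} {V : ℝ → Vec d →L[ℝ] E}
    {V' : ℝ → Vec d →L[ℝ] Vec d →L[ℝ] E} (hT : 0 ≤ T) {t : ℝ} (ht : t ∈ Icc 0 T) {I : E}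
    (hI : HasRoughIntegral X 𝕏 V V' 0 t I) :
    Tendsto (fun D : Finset ℝ => ∑ m ∈ Finset.range (gridIdx T D t),
      germ X 𝕏 V V' (grid T D m) (grid T D (m + 1))) atTop (𝓝 I) := by
  rw [Metric.tendsto_nhds]
  intro ε hε
  have h1 := (Metric.tendsto_nhds.1 hI) ε hε
  rw [eventually_comap] at h1
  obtain ⟨ρ, hρ, h2⟩ := Metric.eventually_nhds_iff.1 h1
  obtain ⟨D₀, hD₀⟩ := exists_fine_grid hT (half_pos hρ)
  filter_upwards [eventually_ge_atTop (D₀ ∪ {t})] with D hD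
  have htD : t ∈ gridSet T D :=
    mem_gridSet (hD (Finset.mem_union_right _ (Finset.mem_singleton_self t))) ht.1 ht.2
  have hm := gridPartition_mesh_le hT htD (half_pos hρ).le
    (hD₀ D (Finset.union_subset_left hD))
  have hm0 : 0 ≤ (gridPartition hT htD).mesh :=
    Real.iSup_nonneg fun i => sub_nonneg.2 ((gridPartition hT htD).pt_le i)
  have h3 := h2 (y := (gridPartition hT htD).mesh) (by
    rw [Real.dist_eq, sub_zero, abs_of_nonneg hm0]; linarith) (gridPartition hT htD) rfl
  rw [Finset.sum_range]
  exact h3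

end Grid

end RoughPath

/-! ### Sampling paths along grids; solutions are local solutions -/

namespace RoughPath

section Sampling

variable {d k ℓ : ℕ} {p T : ℝ} {X : ℝ → Vec d} {𝕏 : ℝ → ℝ → Mat d} {r : Fin ℓ → ℝ} {φ : ℝ → ℝ}

/-- A control of the rough path which separates the times `r i`. -/
structure IsRdeControl (p T : ℝ) (X : ℝ → Vec d) (𝕏 : ℝ → ℝ → Mat d) (r : Fin ℓ → ℝ)
    (φ : ℝ → ℝ) : Prop extends IsControlOf p T X 𝕏 φ where
  separates : Separates T r φ

/-- The controlled path `(Y, Y')` is bounded in terms of the control `φ`. -/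
structure PathControlled {E : Type*} [NormedAddCommGroup E] [NormedSpace ℝ E] (B p T : ℝ)
    (φ : ℝ → ℝ) (X : ℝ → Vec d) (Y : ℝ → E) (Y' : ℝ → Vec d →L[ℝ] E) : Prop where
  deriv_le : ∀ s, 0 ≤ s → s ≤ T → ‖Y' s‖ ≤ B
  deriv_incr : ∀ s t, 0 ≤ s → s ≤ t → t ≤ T → ‖Y' t - Y' s‖ ≤ B * gaugeOf p φ s t
  rem : ∀ s t, 0 ≤ s → s ≤ t → t ≤ T →
    ‖Y t - Y s - Y' s (X t - X s)‖ ≤ B * gaugeOf p φ s t ^ 2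

theorem PathControlled.mono {E : Type*} [NormedAddCommGroup E] [NormedSpace ℝ E] {B B' : ℝ}
    {Y : ℝ → E} {Y' : ℝ → Vec d →L[ℝ] E}
    (h : PathControlled B p T φ X Y Y') (hB : B ≤ B') : PathControlled B' p T φ X Y Y' :=
  ⟨fun s h0 hT => (h.deriv_le s h0 hT).trans hB,
    fun s t h0 hst hT => (h.deriv_incr s t h0 hst hT).trans
      (by have := gaugeOf_nonneg p φ s t; gcongr),
    fun s t h0 hst hT => (h.rem s t h0 hst hT).trans (by gcongr)⟩

/-- A sequence of times in `[0, T]` which passes through all the times `r i`. -/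
structure IsTimes (T : ℝ) (r : Fin ℓ → ℝ) (t : ℕ → ℝ) : Prop where
  mono : Monotone t
  mem : ∀ m, t m ∈ Icc 0 T
  passes : ∀ m i, r i ≤ t m ∨ t (m + 1) ≤ r i

/-- The additional discrete control `ψ` leaves room for the local errors that arise when a path is
sampled. -/
theorem gaugeOf_sample_le (hp : 0 < p) (hφ : Monotone φ) {t : ℕ → ℝ} (ht : Monotone t)
    {ψ : ℕ → ℝ} (hψ : Monotone ψ) {i j : ℕ} (hij : i ≤ j) :
    gaugeOf p φ (t i) (t j) ≤ gaugeOf p (fun m => φ (t m) + ψ m) i j := by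
  refine Real.rpow_le_rpow (abs_nonneg _) ?_ (by positivity)
  have h1 := hφ (ht hij)
  have h2 := hψ hij
  rw [abs_of_nonneg (by linarith), abs_of_nonneg (by linarith)]
  linarith

theorem rpow_inv_le_of_le {p x B : ℝ} (hp : 1 ≤ p) (hx : 0 ≤ x) (hB : 1 ≤ B) (h : x ≤ B) :
    x ^ (1 / p) ≤ B := by
  calc x ^ (1 / p) ≤ B ^ (1 / p) := Real.rpow_le_rpow hx h (by positivity)
    _ ≤ B ^ (1 : ℝ) := Real.rpow_le_rpow_of_exponent_le hB (by
        rw [div_le_one (by linarith)]; exact hp)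
    _ = B := Real.rpow_one B

/-- A gauge below one forces the increment of `φ` below one, so no `r i` is crossed and the
embedding is constant. The parameter `κ ≥ 2 ^ (1 - 3 / p)` keeps the later constants independent of
`p`. -/
theorem driver_sample (hp : 1 ≤ p) (hX : IsRoughPath p T X 𝕏) (hφ : IsRdeControl p T X 𝕏 r φ)
    {t : ℕ → ℝ} (ht : IsTimes T r t) {ψ : ℕ → ℝ} (hψ : Monotone ψ) {κ B : ℝ}
    (hκ : 2 ^ (1 - 3 * (1 / p)) ≤ κ) (hℓ : (ℓ : ℝ) + 1 ≤ B)
    (hB : ∀ i j, i ≤ j → φ (t j) + ψ j - (φ (t i) + ψ i) ≤ B) :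
    Driver (E := Vec k) B κ (gaugeOf p (fun m => φ (t m) + ψ m)) (fun m => X (t m))
      (fun i j => 𝕏 (t i) (t j)) (fun m => embed r (t m)) := by
  have hp0 : 0 < p := by linarith
  have hm : Monotone fun m => φ (t m) + ψ m := (hφ.mono.comp ht.mono).add hψ
  have hB1 : 1 ≤ B := le_trans (by linarith [(Nat.cast_nonneg ℓ : (0 : ℝ) ≤ ℓ)]) hℓ
  have hs := fun {i j : ℕ} (hij : i ≤ j) => gaugeOf_sample_le hp0 hφ.mono ht.mono hψ hij
  refine ⟨(isGauge_rpow hm (by positivity)).weaken hκ, fun i j hij => ?_, fun i j hij => ?_,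
    fun i j hij => ?_, fun i m j him hmj a b => ?_, fun i => (norm_embed_le r _).trans hℓ,
    fun i j hij hlt => ?_⟩
  · have h0 : 0 ≤ φ (t j) + ψ j - (φ (t i) + ψ i) := sub_nonneg.2 (hm hij)
    rw [gaugeOf, abs_of_nonneg h0]
    exact rpow_inv_le_of_le hp h0 hB1 (hB i j hij)
  · exact (hφ.path _ _ (ht.mem i).1 (ht.mono hij) (ht.mem j).2).trans (hs hij)
  · have := gaugeOf_nonneg p φ (t i) (t j)
    exact (hφ.area _ _ (ht.mem i).1 (ht.mono hij) (ht.mem j).2).trans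
      (pow_le_pow_left₀ this (hs hij) 2)
  · exact hX.chen _ _ _ (ht.mem i).1 (ht.mono him) (ht.mono hmj) (ht.mem j).2 a b
  · refine embed_eq r (ht.mono hij) (hφ.separates _ _ (ht.mem i).1 (ht.mono hij) (ht.mem j).2 ?_)
    by_contra! h
    refine absurd ((hs hij).trans_lt hlt) (not_lt.2 ?_)
    exact Real.one_le_rpow (h.trans (le_abs_self _)) (by positivity)

theorem PathControlled.sample {E : Type*} [NormedAddCommGroup E] [NormedSpace ℝ E] {B : ℝ}
    (hp : 0 < p) (hB : 0 ≤ B) (hφ : Monotone φ) {Y : ℝ → E} {Y' : ℝ → Vec d →L[ℝ] E}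
    (h : PathControlled B p T φ X Y Y') {t : ℕ → ℝ} (ht : IsTimes T r t) {ψ : ℕ → ℝ}
    (hψ : Monotone ψ) :
    GaugeControlled B (gaugeOf p (fun m => φ (t m) + ψ m)) (fun m => X (t m)) (fun m => Y (t m))
      (fun m => Y' (t m)) := by
  have hs := fun {i j : ℕ} (hij : i ≤ j) => gaugeOf_sample_le hp hφ ht.mono hψ hij
  refine ⟨fun i => h.deriv_le _ (ht.mem i).1 (ht.mem i).2, fun i j hij => ?_, fun i j hij => ?_⟩
  · exact (h.deriv_incr _ _ (ht.mem i).1 (ht.mono hij) (ht.mem j).2).trans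
      (mul_le_mul_of_nonneg_left (hs hij) hB)
  · exact (h.rem _ _ (ht.mem i).1 (ht.mono hij) (ht.mem j).2).trans
      (mul_le_mul_of_nonneg_left (pow_le_pow_left₀ (gaugeOf_nonneg _ _ _ _) (hs hij) 2) hB)

theorem isState_sample {t : ℕ → ℝ} (ht : IsTimes T r t) (Y : ℝ → Vec k) :
    IsState (fun m => embed r (t m)) (fun m => Y (t m)) (fun m => stopped r Y (t m)) :=
  fun m => stopped_sub r Y (ht.mono (Nat.le_succ m)) (ht.passes m)

theorem isTimes_grid (hT : 0 ≤ T) (hr : ∀ i, r i ∈ Icc 0 T) {D : Finset ℝ}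
    (hD : Finset.univ.image r ⊆ D) : IsTimes T r (grid T D) :=
  ⟨grid_mono, grid_mem_Icc hT, fun m i => grid_gap (mem_gridSet
    (hD (Finset.mem_image_of_mem r (Finset.mem_univ i))) (hr i).1 (hr i).2) m⟩

/-- The local approximation of `∫_s^t f(Ȳ) d𝐗`. -/
noncomputable def rdeGerm (X : ℝ → Vec d) (𝕏 : ℝ → ℝ → Mat d) (r : Fin ℓ → ℝ)
    (f : BlockVec k ℓ → Vec d →L[ℝ] Vec k) (Y : ℝ → Vec k) (Y' : ℝ → Vec d →L[ℝ] Vec k)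
    (s t : ℝ) : Vec k :=
  germ X 𝕏 (coeff f r Y) (chainDeriv f (embed r) (stopped r Y) Y') s t

/-- The local error of `(Y, Y')` in the equation. -/
noncomputable def rdeError (X : ℝ → Vec d) (𝕏 : ℝ → ℝ → Mat d) (r : Fin ℓ → ℝ)
    (f : BlockVec k ℓ → Vec d →L[ℝ] Vec k) (y Y : ℝ → Vec k) (Y' : ℝ → Vec d →L[ℝ] Vec k)
    (s t : ℝ) : Vec k :=
  Y t - Y s - (y t - y s) - rdeGerm X 𝕏 r f Y Y' s t

variable {f : BlockVec k ℓ → Vec d →L[ℝ] Vec k} {y Y : ℝ → Vec k} {y' Y' : ℝ → Vec d →L[ℝ] Vec k}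

/-- A path which satisfies the equation up to errors of the order `o(φ t - φ s)`. -/
structure IsLocalSolution (T : ℝ) (X : ℝ → Vec d) (𝕏 : ℝ → ℝ → Mat d) (r : Fin ℓ → ℝ)
    (f : BlockVec k ℓ → Vec d →L[ℝ] Vec k) (φ : ℝ → ℝ) (y : ℝ → Vec k)
    (y' : ℝ → Vec d →L[ℝ] Vec k) (Y : ℝ → Vec k) (Y' : ℝ → Vec d →L[ℝ] Vec k) : Prop where
  deriv_eq : ∀ t ∈ Icc 0 T, Y' t = y' t + coeff f r Y t
  start : Y 0 = y 0
  error : ∀ ε > 0, ∃ δ > 0, ∀ s t, 0 ≤ s → s ≤ t → t ≤ T → t - s ≤ δ →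
    ‖rdeError X 𝕏 r f y Y Y' s t‖ ≤ ε * (φ t - φ s)

/-- Along a sequence of times, a path solves the discrete scheme with the local errors added to
the initial path. -/
theorem isScheme_sample {t : ℕ → ℝ} (ht : IsTimes T r t)
    (hY : ∀ t ∈ Icc 0 T, Y' t = y' t + coeff f r Y t) :
    IsScheme (fun m => X (t m)) (fun i j => 𝕏 (t i) (t j)) (fun m => embed r (t m)) f
      (fun m => y (t m) + ∑ l ∈ Finset.range m, rdeError X 𝕏 r f y Y Y' (t l) (t (l + 1)))
      (fun m => y' (t m)) (fun m => Y (t m)) (fun m => stopped r Y (t m)) (fun m => Y' (t m)) := by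
  refine ⟨isState_sample ht Y, fun i => hY _ (ht.mem i), fun i => ?_⟩
  rw [Finset.sum_range_succ]
  change Y (t (i + 1)) - Y (t i) = _ + rdeGerm X 𝕏 r f Y Y' (t i) (t (i + 1))
  simp only [rdeError]
  abel

/-- The error over `[s, t]` is the limit, along grids through `s` and `t`, of the Riemann sum over
`[s, t]` minus its germ. Each of these differences is a sewing error, bounded by `ε * (φ t - φ s)`
as soon as `t - s ≤ δ`, with `δ` independent of the grid. -/
theorem IsSolution.isLocalSolution (hp : 2 < p) (hp3 : p < 3) (hD : IsData p T X 𝕏 r f)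
    (hY : IsSolution p T X 𝕏 r f y y' Y Y') (hφ : IsRdeControl p T X 𝕏 r φ) {B : ℝ}
    (hYB : PathControlled B p T φ X Y Y') : IsLocalSolution T X 𝕏 r f φ y y' Y Y' := by
  have hT := hD.pos.le
  set S : Finset ℝ → ℝ → Vec k := fun D t => ∑ m ∈ Finset.range (gridIdx T D t),
    rdeGerm X 𝕏 r f Y Y' (grid T D m) (grid T D (m + 1)) with hS
  have hlim : ∀ t ∈ Icc 0 T, Tendsto (fun D => S D t) atTop (𝓝 (Y t - y t)) := fun t ht => by
    have h := hY.integral_eq t ht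
    rw [coeffDeriv_eq] at h
    exact tendsto_grid_sum hT ht h
  refine ⟨hY.deriv_eq, ?_, ?_⟩
  · have h := hlim 0 ⟨le_rfl, hT⟩
    have h0 : (fun D => S D 0) = fun _ => 0 := by
      funext D; simp [hS, gridIdx_start hT]
    rw [h0] at h
    exact sub_eq_zero.1 (tendsto_nhds_unique h tendsto_const_nhds)
  intro ε hε
  set B' := max B (ℓ + 1 + (φ T - φ 0) + cbNorm 2 f) with hB'
  have hφT : 0 ≤ φ T - φ 0 := sub_nonneg.2 (hφ.mono hT)
  have hℓ0 : (0 : ℝ) ≤ ℓ := Nat.cast_nonneg ℓ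
  have hf0 : (0 : ℝ) ≤ cbNorm 2 f := NNReal.coe_nonneg _
  have hB1 : 1 ≤ B' := le_trans (by linarith) (le_max_right _ _)
  obtain ⟨A, hA, hdef⟩ := exists_germ_defect_bound (E := Vec k) (F := BlockVec k ℓ) d hB1
  obtain ⟨δ, hδ, hmesh⟩ := hD.rough.exists_sewing_mesh (E := Vec k) (by linarith) hp3
    hφ.toIsControlOf hA hε
  refine ⟨δ, hδ, fun s t hs hst htT htδ => ?_⟩
  have hev : ∀ᶠ D : Finset ℝ in atTop,
      ‖S D t - S D s - rdeGerm X 𝕏 r f Y Y' s t‖ ≤ ε * (φ t - φ s) := by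
    filter_upwards [eventually_ge_atTop (Finset.univ.image r ∪ {s, t})] with D hDD
    have hsD : s ∈ gridSet T D := mem_gridSet (hDD (by simp)) hs (hst.trans htT)
    have htD : t ∈ gridSet T D := mem_gridSet (hDD (by simp)) (hs.trans hst) htT
    set τ := grid T D with hτ
    have hτt : IsTimes T r τ := isTimes_grid hT hD.mem (Finset.union_subset_left hDD)
    set G : ℕ → ℕ → Vec k := fun i j => rdeGerm X 𝕏 r f Y Y' (τ i) (τ j) with hG
    -- The Riemann sums are additive, so the defect of `J` is that of the germ, and `J` vanishes on
    -- single steps.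
    set J : ℕ → ℕ → Vec k := fun i j =>
      (∑ m ∈ Finset.range j, G m (m + 1)) - (∑ m ∈ Finset.range i, G m (m + 1)) - G i j with hJ
    have key := hmesh τ hτt.mono hτt.mem J (fun i => ?_) (fun i => ?_) (fun i m j him hmj => ?_)
      (gridIdx T D s) (gridIdx T D t) (gridIdx_mono hsD htD hst)
      (by rw [hτ, grid_gridIdx hsD, grid_gridIdx htD]; exact htδ)
    · simp only [hJ, hG, hτ, grid_gridIdx hsD, grid_gridIdx htD] at key
      exact key
    · have : 𝕏 (τ i) (τ i) = 0 := hD.rough.area_self (hτt.mem i).1 (hτt.mem i).2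
      simp [hJ, hG, rdeGerm, germ_self _ _ this]
    · simp [hJ, Finset.sum_range_succ]
    · have e : J i j - J i m - J m j = G i m + G m j - G i j := by simp only [hJ]; abel
      rw [e]
      have hdr := driver_sample (k := k) (κ := 2 ^ (1 - 3 * (1 / p))) (B := B') (by linarith)
        hD.rough hφ hτt (ψ := fun _ => 0) monotone_const le_rfl
        (le_trans (by linarith) (le_max_right _ _)) (fun i j _ => by
          have e1 := hφ.mono (hτt.mem i).1
          have e2 := hφ.mono (hτt.mem j).2
          exact le_trans (by linarith) (le_max_right _ _))
      have hgc := (hYB.mono (le_max_left B _)).sample (by linarith) (by linarith) hφ.mono hτt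
        (ψ := fun _ => 0) monotone_const
      have := hdef hdr (hD.coeff_mem.bounds₂ (le_trans (by linarith) (le_max_right _ _)))
        (isState_sample hτt Y) hgc i m j him hmj
      simp only [add_zero] at this
      exact this
  have hl := ((hlim t ⟨hs.trans hst, htT⟩).sub (hlim s ⟨hs, hst.trans htT⟩)).sub_const
    (rdeGerm X 𝕏 r f Y Y' s t)
  have := le_of_tendsto hl.norm hev
  rw [rdeError]
  refine le_trans (le_of_eq ?_) this
  congr 1; abel

end Sampling

end RoughPath

/-! ### A priori and Lipschitz estimates for local solutions -/

namespace RoughPath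

section LocalSolutions

variable {d k ℓ : ℕ} {p T : ℝ} {X : ℝ → Vec d} {𝕏 : ℝ → ℝ → Mat d} {r : Fin ℓ → ℝ} {φ : ℝ → ℝ}

/-- With `ψ` included in the control, an error of size `η * (ψ j - ψ i)` counts as a second-order
remainder, because increments of `ψ` are at most one and `2 / p ≤ 1`. The derivative need not be
changed. -/
theorem GaugeControlled.add_error {E : Type*} [NormedAddCommGroup E] [NormedSpace ℝ E]
    (hp : 2 ≤ p) {Φ ψ : ℕ → ℝ} (hΦ : Monotone Φ) (hψ : Monotone ψ) {x : ℕ → Vec d} {u : ℕ → E}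
    {u' : ℕ → Vec d →L[ℝ] E} {Δ η : ℝ} (hη : 0 ≤ η)
    (hu : GaugeControlled Δ (gaugeOf p (fun m => Φ m + ψ m)) x u u') {e : ℕ → E}
    (he : ∀ i j, i ≤ j → ‖e j - e i‖ ≤ η * (ψ j - ψ i)) (hψ1 : ∀ i j, i ≤ j → ψ j - ψ i ≤ 1) :
    GaugeControlled (Δ + η) (gaugeOf p (fun m => Φ m + ψ m)) x (fun m => u m + e m) u' := by
  have hnn := gaugeOf_nonneg p (fun m => Φ m + ψ m)
  refine ⟨fun i => (hu.deriv_le i).trans (by linarith), fun i j hij =>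
    (hu.deriv_incr i j hij).trans (by have := hnn i j; gcongr; linarith), fun i j hij => ?_⟩
  have h1 : ψ j - ψ i ≤ gaugeOf p (fun m => Φ m + ψ m) i j ^ 2 := by
    have a1 := hΦ hij
    have a2 := hψ hij
    have a3 : 0 ≤ ψ j - ψ i := sub_nonneg.2 a2
    rw [gaugeOf_sq (by linarith)]
    calc ψ j - ψ i = (ψ j - ψ i) ^ (1 : ℝ) := (Real.rpow_one _).symm
      _ ≤ (ψ j - ψ i) ^ (1 / (p / 2)) := by
          rcases a3.eq_or_lt with h0 | h0
          · rw [← h0, Real.zero_rpow one_ne_zero]; positivity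
          · refine Real.rpow_le_rpow_of_exponent_ge h0 (hψ1 i j hij) ?_
            rw [div_le_one (by linarith)]; linarith
      _ ≤ _ := Real.rpow_le_rpow a3 (by linarith) (by positivity)
  calc ‖u j + e j - (u i + e i) - u' i (x j - x i)‖
      = ‖(u j - u i - u' i (x j - x i)) + (e j - e i)‖ := by congr 1; abel
    _ ≤ Δ * gaugeOf p (fun m => Φ m + ψ m) i j ^ 2 + η * gaugeOf p (fun m => Φ m + ψ m) i j ^ 2 :=
        (norm_add_le _ _).trans (add_le_add (hu.rem i j hij) ((he i j hij).trans (by gcongr)))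
    _ = _ := by ring

theorem sum_range_sub_le {E : Type*} [NormedAddCommGroup E] (g : ℕ → E) {i j : ℕ} (hij : i ≤ j) :
    ‖∑ l ∈ Finset.range j, g l - ∑ l ∈ Finset.range i, g l‖ ≤
      ∑ l ∈ Finset.range j, ‖g l‖ - ∑ l ∈ Finset.range i, ‖g l‖ := by
  rw [← Finset.sum_Ico_eq_sub _ hij, ← Finset.sum_Ico_eq_sub _ hij]
  exact norm_sum_le _ _

theorem sum_range_norm_mono {E : Type*} [NormedAddCommGroup E] (g : ℕ → E) :
    Monotone fun m => ∑ l ∈ Finset.range m, ‖g l‖ := fun _ _ hij =>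
  Finset.sum_le_sum_of_subset_of_nonneg (Finset.range_mono hij) fun _ _ _ => norm_nonneg _

variable {f : BlockVec k ℓ → Vec d →L[ℝ] Vec k} {y Y z Z : ℝ → Vec k}
  {y' Y' z' Z' : ℝ → Vec d →L[ℝ] Vec k}

/-- The local errors along fine grids. -/
theorem IsLocalSolution.eventually_sum_le (hT : 0 ≤ T) (hφ : Monotone φ)
    (hY : IsLocalSolution T X 𝕏 r f φ y y' Y Y') {η : ℝ} (hη : 0 < η) :
    ∀ᶠ D : Finset ℝ in atTop, ∀ m, ∑ l ∈ Finset.range m,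
      ‖rdeError X 𝕏 r f y Y Y' (grid T D l) (grid T D (l + 1))‖ ≤ η := by
  have hφT : 0 ≤ φ T - φ 0 := sub_nonneg.2 (hφ hT)
  obtain ⟨δ, hδ, h⟩ := hY.error (η / (φ T - φ 0 + 1)) (by positivity)
  obtain ⟨D₀, hD₀⟩ := exists_fine_grid hT hδ
  filter_upwards [eventually_ge_atTop D₀] with D hD m
  calc _ ≤ ∑ l ∈ Finset.range m, η / (φ T - φ 0 + 1) * (φ (grid T D (l + 1)) - φ (grid T D l)) :=
        Finset.sum_le_sum fun l _ => h _ _ (grid_mem_Icc hT l).1 (grid_mono (Nat.le_succ l))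
          (grid_mem_Icc hT (l + 1)).2 (hD₀ D hD l)
    _ = η / (φ T - φ 0 + 1) * (φ (grid T D m) - φ (grid T D 0)) := by
        rw [← Finset.mul_sum, Finset.sum_range_sub (fun l => φ (grid T D l))]
    _ ≤ η / (φ T - φ 0 + 1) * (φ T - φ 0 + 1) := by
        have e1 := hφ (grid_mem_Icc hT (D := D) 0).1
        have e2 := hφ (grid_mem_Icc hT (D := D) m).2
        gcongr
        linarith
    _ = η := by field_simp

theorem le_of_forall_perturbation {a c : ℝ} {g : ℝ → ℝ} (hg : ContinuousAt g 0)
    (h : ∀ η, 0 < η → η ≤ 1 → a ≤ c * g η) : a ≤ c * g 0 := by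
  have h1 : Tendsto (fun η => c * g η) (𝓝[>] 0) (𝓝 (c * g 0)) :=
    (hg.tendsto.const_mul c).mono_left nhdsWithin_le_nhds
  refine ge_of_tendsto h1 ?_
  filter_upwards [Ioc_mem_nhdsGT (zero_lt_one' ℝ)] with η hη
  exact h η hη.1 hη.2

theorem continuousAt_perturbation {w Δ β : ℝ} (hβ : 0 < β) :
    ContinuousAt (fun η : ℝ => (Δ + η) * (w + η) ^ β) 0 := by
  have h1 : ContinuousAt (fun η : ℝ => w + η) 0 := by fun_prop
  exact (by fun_prop : ContinuousAt (fun η : ℝ => Δ + η) 0).mul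
    (h1.rpow_const (Or.inr hβ.le))

/-- The a priori estimate. -/
theorem exists_pathControlled_bound (d k ℓ : ℕ) {B κ : ℝ} (hκ : 0 ≤ κ) (hκ1 : κ < 1) :
    ∃ C, 0 ≤ C ∧ ∀ {p T : ℝ} {X : ℝ → Vec d} {𝕏 : ℝ → ℝ → Mat d} {r : Fin ℓ → ℝ}
      {f : BlockVec k ℓ → Vec d →L[ℝ] Vec k} {φ φ' : ℝ → ℝ} {y Y : ℝ → Vec k}
      {y' Y' : ℝ → Vec d →L[ℝ] Vec k}, 2 < p → 2 ^ (1 - 3 * (1 / p)) ≤ κ →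
      IsData p T X 𝕏 r f → Bounds₂ B f → IsRdeControl p T X 𝕏 r φ → φ T - φ 0 ≤ B →
      PathControlled B p T φ X y y' → Monotone φ' → IsLocalSolution T X 𝕏 r f φ' y y' Y Y' →
      PathControlled C p T φ X Y Y' := by
  -- Room for the embeddings, of norm at most `ℓ + 1`, for the control enlarged by `ψ`, and for the
  -- initial path perturbed by the local errors.
  set B' := max B 0 + ℓ + 2 with hB'
  have hℓ0 : (0 : ℝ) ≤ ℓ := Nat.cast_nonneg ℓ
  have hB0 : 0 ≤ max B 0 := le_max_right _ _
  have hBB : B + 1 ≤ B' := by linarith [le_max_left B 0]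
  have hB1 : 1 ≤ B' := by linarith
  obtain ⟨C, hC, hap⟩ := exists_apriori_bound (E := Vec k) (F := BlockVec k ℓ) d hB1 hκ hκ1
  have hC0 : 0 ≤ C := by linarith
  refine ⟨C, hC0, ?_⟩
  intro p T X 𝕏 r f φ φ' y Y y' Y' hp hpκ hD hf hφ hφB hy hφ' hY
  have hT := hD.pos.le
  -- For given `s`, `t` a grid through both is chosen with total local error at most `η`. The
  -- discrete estimate then holds for the control `φ + ψ`, whose increments exceed those of `φ` by
  -- at most `η`, and `η → 0` follows. The error control `φ'` serves only to find the grid, so it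
  -- does not affect the constant.
  have main : ∀ η, 0 < η → η ≤ 1 → ∀ s t, 0 ≤ s → s ≤ t → t ≤ T →
      ‖Y' s‖ ≤ C ∧ ‖Y' t - Y' s‖ ≤ C * (φ t - φ s + η) ^ (1 / p) ∧
      ‖Y t - Y s - Y' s (X t - X s)‖ ≤ C * (φ t - φ s + η) ^ (1 / (p / 2)) := by
    intro η hη hη1 s t hs hst htT
    obtain ⟨D, h1, h2⟩ := ((hY.eventually_sum_le hT hφ' hη).and
      (eventually_ge_atTop (Finset.univ.image r ∪ {s, t}))).exists
    have hsD : s ∈ gridSet T D := mem_gridSet (h2 (by simp)) hs (hst.trans htT)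
    have htD : t ∈ gridSet T D := mem_gridSet (h2 (by simp)) (hs.trans hst) htT
    have hτ : IsTimes T r (grid T D) := isTimes_grid hT hD.mem (Finset.union_subset_left h2)
    set τ := grid T D with hτdef
    set g : ℕ → Vec k := fun l => rdeError X 𝕏 r f y Y Y' (τ l) (τ (l + 1)) with hg
    set ψ : ℕ → ℝ := fun m => ∑ l ∈ Finset.range m, ‖g l‖ with hψ
    have hψm : Monotone ψ := sum_range_norm_mono g
    have hψ0 : ∀ m, 0 ≤ ψ m := fun m => Finset.sum_nonneg fun _ _ => norm_nonneg _
    have hψη : ∀ i j, ψ j - ψ i ≤ η := fun i j => by linarith [h1 j, hψ0 i]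
    have hdr := driver_sample (k := k) (B := B') (by linarith) hD.rough hφ hτ hψm hpκ
      (by linarith) (fun i j _ => by
        have e1 := hφ.mono (hτ.mem i).1
        have e2 := hφ.mono (hτ.mem j).2
        have e3 := hψη i j
        linarith)
    have hyc := (hy.mono (le_max_left B 0)).sample (by linarith) hB0 hφ.mono hτ hψm
    have hye := hyc.add_error hp.le (hφ.mono.comp hτ.mono) hψm (η := 1) zero_le_one
      (e := fun m => ∑ l ∈ Finset.range m, g l) (fun i j hij => by
        rw [one_mul]; exact sum_range_sub_le g hij) (fun i j _ => (hψη i j).trans hη1)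
    have key := hap hdr (hf.mono (by linarith)) (hye.mono (gaugeOf_nonneg _ _) (by linarith))
      (isScheme_sample hτ hY.deriv_eq)
    have hij := gridIdx_mono hsD htD hst
    have es : τ (gridIdx T D s) = s := grid_gridIdx hsD
    have et : τ (gridIdx T D t) = t := grid_gridIdx htD
    have hle : φ s + ψ (gridIdx T D s) ≤ φ t + ψ (gridIdx T D t) :=
      add_le_add (hφ.mono hst) (hψm hij)
    have hw : φ t + ψ (gridIdx T D t) - (φ s + ψ (gridIdx T D s)) ≤ φ t - φ s + η := by
      linarith [hψη (gridIdx T D s) (gridIdx T D t)]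
    have hwn : 0 ≤ φ t + ψ (gridIdx T D t) - (φ s + ψ (gridIdx T D s)) := sub_nonneg.2 hle
    have k1 := key.deriv_le (gridIdx T D s)
    have k2 := key.deriv_incr _ _ hij
    have k3 := key.rem _ _ hij
    rw [gaugeOf_sq (by simp only [es, et]; exact hle)] at k3
    rw [gaugeOf, abs_of_nonneg (by simp only [es, et]; exact hwn)] at k2
    simp only [es, et] at k1 k2 k3
    exact ⟨k1, k2.trans (by gcongr), k3.trans (by gcongr)⟩
  refine ⟨fun s h0 hsT => (main 1 one_pos le_rfl s s h0 le_rfl hsT).1,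
    fun s t h0 hst hT => ?_, fun s t h0 hst hT => ?_⟩
  · rw [gaugeOf, abs_of_nonneg (sub_nonneg.2 (hφ.mono hst))]
    have := le_of_forall_perturbation (c := C) (g := fun η => (φ t - φ s + η) ^ (1 / p))
      ((by fun_prop : ContinuousAt (fun η : ℝ => φ t - φ s + η) 0).rpow_const
        (Or.inr (by positivity)))
      (fun η h1 h2 => (main η h1 h2 s t h0 hst hT).2.1)
    simpa using this
  · rw [gaugeOf_sq (hφ.mono hst)]
    have := le_of_forall_perturbation (c := C) (g := fun η => (φ t - φ s + η) ^ (1 / (p / 2)))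
      ((by fun_prop : ContinuousAt (fun η : ℝ => φ t - φ s + η) 0).rpow_const
        (Or.inr (by positivity)))
      (fun η h1 h2 => (main η h1 h2 s t h0 hst hT).2.2)
    simpa using this

/-- The Lipschitz estimate. -/
theorem exists_pathControlled_sub_bound (d k ℓ : ℕ) {B κ : ℝ} (hκ : 0 ≤ κ) (hκ1 : κ < 1) :
    ∃ C, 0 ≤ C ∧ ∀ {p T : ℝ} {X : ℝ → Vec d} {𝕏 : ℝ → ℝ → Mat d} {r : Fin ℓ → ℝ}
      {f : BlockVec k ℓ → Vec d →L[ℝ] Vec k} {φ φ' φ'' : ℝ → ℝ} {y Y z Z : ℝ → Vec k}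
      {y' Y' z' Z' : ℝ → Vec d →L[ℝ] Vec k} {Δ : ℝ}, 2 < p → 2 ^ (1 - 3 * (1 / p)) ≤ κ →
      IsData p T X 𝕏 r f → Bounds₃ B f → IsRdeControl p T X 𝕏 r φ → φ T - φ 0 ≤ B →
      PathControlled B p T φ X Y Y' → PathControlled B p T φ X Z Z' →
      Monotone φ' → IsLocalSolution T X 𝕏 r f φ' y y' Y Y' →
      Monotone φ'' → IsLocalSolution T X 𝕏 r f φ'' z z' Z Z' →
      0 ≤ Δ → PathControlled Δ p T φ X (fun t => y t - z t) (fun t => y' t - z' t) →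
      ‖stopped r Y 0 - stopped r Z 0‖ ≤ Δ →
      (∀ s, 0 ≤ s → s ≤ T → ‖stopped r Y s - stopped r Z s‖ ≤ C * Δ) ∧
      PathControlled (C * Δ) p T φ X (fun t => Y t - Z t) (fun t => Y' t - Z' t) := by
  set B' := max B 0 + ℓ + 2 with hB'
  have hℓ0 : (0 : ℝ) ≤ ℓ := Nat.cast_nonneg ℓ
  have hB0 : 0 ≤ max B 0 := le_max_right _ _
  have hBB : B + 1 ≤ B' := by linarith [le_max_left B 0]
  have hB1 : 1 ≤ B' := by linarith
  obtain ⟨C, hC0, hap⟩ := exists_lipschitz_bound (E := Vec k) (F := BlockVec k ℓ) d hB1 hκ hκ1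
  refine ⟨C, hC0, ?_⟩
  intro p T X 𝕏 r f φ φ' φ'' y Y z Z y' Y' z' Z' Δ hp hpκ hD hf hφ hφB hYB hZB hφ' hY hφ'' hZ hΔ
    hu hstart
  have hT := hD.pos.le
  have main : ∀ η, 0 < η → η ≤ 1 → ∀ s t, 0 ≤ s → s ≤ t → t ≤ T →
      ‖stopped r Y s - stopped r Z s‖ ≤ C * (Δ + η) ∧
      ‖Y' s - Z' s‖ ≤ C * (Δ + η) ∧
      ‖(Y' t - Z' t) - (Y' s - Z' s)‖ ≤ C * ((Δ + η) * (φ t - φ s + η) ^ (1 / p)) ∧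
      ‖(Y t - Z t) - (Y s - Z s) - (Y' s - Z' s) (X t - X s)‖ ≤
        C * ((Δ + η) * (φ t - φ s + η) ^ (1 / (p / 2))) := by
    intro η hη hη1 s t hs hst htT
    obtain ⟨D, ⟨h1, h1'⟩, h2⟩ := (((hY.eventually_sum_le hT hφ' (η := η ^ 2 / 2)
      (by positivity)).and (hZ.eventually_sum_le hT hφ'' (η := η ^ 2 / 2) (by positivity))).and
      (eventually_ge_atTop (Finset.univ.image r ∪ {s, t}))).exists
    have hsD : s ∈ gridSet T D := mem_gridSet (h2 (by simp)) hs (hst.trans htT)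
    have htD : t ∈ gridSet T D := mem_gridSet (h2 (by simp)) (hs.trans hst) htT
    have hτ : IsTimes T r (grid T D) := isTimes_grid hT hD.mem (Finset.union_subset_left h2)
    set τ := grid T D with hτdef
    set g : ℕ → Vec k := fun l => rdeError X 𝕏 r f y Y Y' (τ l) (τ (l + 1)) with hg
    set g' : ℕ → Vec k := fun l => rdeError X 𝕏 r f z Z Z' (τ l) (τ (l + 1)) with hg'
    -- Both error sums are at most `η ^ 2 / 2`. After division by `η`, the increments of `ψ` are at
    -- most `η`, while the errors are at most `η` times increments of `ψ`; thus the data difference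
    -- becomes `Δ + η`, and both perturbations vanish in the limit.
    set ψ : ℕ → ℝ := fun m =>
      (∑ l ∈ Finset.range m, ‖g l‖ + ∑ l ∈ Finset.range m, ‖g' l‖) / η with hψ
    have hψm : Monotone ψ := fun i j hij =>
      div_le_div_of_nonneg_right (add_le_add (sum_range_norm_mono g hij)
        (sum_range_norm_mono g' hij)) hη.le
    have hψ0 : ∀ m, 0 ≤ ψ m := fun m => div_nonneg (add_nonneg
      (Finset.sum_nonneg fun _ _ => norm_nonneg _) (Finset.sum_nonneg fun _ _ => norm_nonneg _))
      hη.le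
    have hψη : ∀ i j, ψ j - ψ i ≤ η := fun i j => by
      have : ψ j ≤ η := by
        rw [hψ]
        refine (div_le_iff₀ hη).2 ?_
        have := h1 j
        have := h1' j
        simp only [hg, hg']
        nlinarith
      linarith [hψ0 i]
    have hdr := driver_sample (k := k) (B := B') (by linarith) hD.rough hφ hτ hψm hpκ
      (by linarith) (fun i j _ => by
        have e1 := hφ.mono (hτ.mem i).1
        have e2 := hφ.mono (hτ.mem j).2
        have e3 := hψη i j
        linarith)
    have hYc := (hYB.mono (le_max_left B 0)).sample (by linarith) hB0 hφ.mono hτ hψm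
    have hZc := (hZB.mono (le_max_left B 0)).sample (by linarith) hB0 hφ.mono hτ hψm
    have huc := hu.sample (by linarith) hΔ hφ.mono hτ hψm
    have hue := huc.add_error hp.le (hφ.mono.comp hτ.mono) hψm (η := η) hη.le
      (e := fun m => ∑ l ∈ Finset.range m, g l - ∑ l ∈ Finset.range m, g' l) (fun i j hij => by
        have e1 := sum_range_sub_le g hij
        have e2 := sum_range_sub_le g' hij
        calc _ = ‖(∑ l ∈ Finset.range j, g l - ∑ l ∈ Finset.range i, g l)
                - (∑ l ∈ Finset.range j, g' l - ∑ l ∈ Finset.range i, g' l)‖ := by congr 1; abel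
          _ ≤ _ := (norm_sub_le _ _).trans (add_le_add e1 e2)
          _ = _ := by simp only [hψ]; field_simp; ring)
      (fun i j _ => (hψη i j).trans hη1)
    rw [show (fun m => y (τ m) - z (τ m) + (∑ l ∈ Finset.range m, g l - ∑ l ∈ Finset.range m, g' l))
      = fun m => y (τ m) + ∑ l ∈ Finset.range m, g l - (z (τ m) + ∑ l ∈ Finset.range m, g' l) from
      funext fun m => (add_sub_add_comm _ _ _ _).symm] at hue
    have hgn := gaugeOf_nonneg p (fun m => φ (τ m) + ψ m)
    obtain ⟨key0, key⟩ := hap (Δ := Δ + η) hdr (hf.mono (by linarith))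
      (isScheme_sample (y := y) hτ hY.deriv_eq) (isScheme_sample (y := z) hτ hZ.deriv_eq)
      (hYc.mono hgn (by linarith)) (hZc.mono hgn (by linarith)) (by linarith)
      hue
      (by
        have : τ 0 = 0 := grid_start hT
        simp only [this]
        linarith)
    have hij := gridIdx_mono hsD htD hst
    have es : τ (gridIdx T D s) = s := grid_gridIdx hsD
    have et : τ (gridIdx T D t) = t := grid_gridIdx htD
    have hle : φ s + ψ (gridIdx T D s) ≤ φ t + ψ (gridIdx T D t) :=
      add_le_add (hφ.mono hst) (hψm hij)
    have hw : φ t + ψ (gridIdx T D t) - (φ s + ψ (gridIdx T D s)) ≤ φ t - φ s + η := by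
      linarith [hψη (gridIdx T D s) (gridIdx T D t)]
    have hwn : 0 ≤ φ t + ψ (gridIdx T D t) - (φ s + ψ (gridIdx T D s)) := sub_nonneg.2 hle
    have k0 := key0 (gridIdx T D s)
    have k1 := key.deriv_le (gridIdx T D s)
    have k2 := key.deriv_incr _ _ hij
    have k3 := key.rem _ _ hij
    rw [gaugeOf_sq (by simp only [es, et]; exact hle)] at k3
    rw [gaugeOf, abs_of_nonneg (by simp only [es, et]; exact hwn)] at k2
    simp only [es, et] at k0 k1 k2 k3
    rw [mul_assoc] at k2 k3
    have hΔη : 0 ≤ Δ + η := by linarith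
    exact ⟨k0, k1, k2.trans (by gcongr), k3.trans (by gcongr)⟩
  have lim1 : ∀ a, (∀ η, 0 < η → η ≤ 1 → a ≤ C * (Δ + η)) → a ≤ C * Δ := fun a h => by
    have := le_of_forall_perturbation (c := C) (g := fun η => Δ + η) (by fun_prop) h
    simpa using this
  refine ⟨fun s h0 hsT => lim1 _ fun η h1 h2 => (main η h1 h2 s s h0 le_rfl hsT).1,
    fun s h0 hsT => lim1 _ fun η h1 h2 => (main η h1 h2 s s h0 le_rfl hsT).2.1,
    fun s t h0 hst hT => ?_, fun s t h0 hst hT => ?_⟩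
  · rw [gaugeOf, abs_of_nonneg (sub_nonneg.2 (hφ.mono hst)), mul_assoc]
    have := le_of_forall_perturbation (c := C)
      (continuousAt_perturbation (w := φ t - φ s) (Δ := Δ) (β := 1 / p) (by positivity))
      (fun η h1 h2 => (main η h1 h2 s t h0 hst hT).2.2.1)
    simpa using this
  · rw [gaugeOf_sq (hφ.mono hst), mul_assoc]
    have := le_of_forall_perturbation (c := C)
      (continuousAt_perturbation (w := φ t - φ s) (Δ := Δ) (β := 1 / (p / 2)) (by positivity))
      (fun η h1 h2 => (main η h1 h2 s t h0 hst hT).2.2.2)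
    simpa using this

end LocalSolutions

end RoughPath

namespace RoughPath

/-! ### Existence -/

section Existence

/-- The increment over a step depends only on the current state, so path and state are generated
jointly by recursion. -/
theorem exists_scheme {d : ℕ} {E F : Type*} [NormedAddCommGroup E] [NormedSpace ℝ E]
    [NormedAddCommGroup F] [NormedSpace ℝ F] (x : ℕ → Vec d) (𝕩 : ℕ → ℕ → Mat d)
    (L : ℕ → E →L[ℝ] F) (f : F → Vec d →L[ℝ] E) (y : ℕ → E) (y' : ℕ → Vec d →L[ℝ] E) (a : E)
    (b : F) : ∃ Y Yb Y', IsScheme x 𝕩 L f y y' Y Yb Y' ∧ Y 0 = a ∧ Yb 0 = b := by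
  let st : ℕ → F → E := fun m q => y (m + 1) - y m + (f q (x (m + 1) - x m)
    + tensorApply (fderiv ℝ f q ∘L (L m ∘L (y' m + f q))) (𝕩 m (m + 1)))
  let Q : ℕ → E × F := fun m => Nat.rec (a, b) (fun m q => (q.1 + st m q.2, q.2 + L m (st m q.2))) m
  have h1 : ∀ m, (Q (m + 1)).1 - (Q m).1 = st m (Q m).2 := fun m =>
    add_sub_cancel_left (Q m).1 (st m (Q m).2)
  have h2 : ∀ m, (Q (m + 1)).2 - (Q m).2 = L m (st m (Q m).2) := fun m =>
    add_sub_cancel_left (Q m).2 (L m (st m (Q m).2))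
  exact ⟨fun m => (Q m).1, fun m => (Q m).2, fun m => y' m + f (Q m).2,
    ⟨fun m => by rw [h2, ← h1], fun _ => rfl, h1⟩, rfl, rfl⟩

variable {d k ℓ : ℕ} {p T : ℝ} {X : ℝ → Vec d} {𝕏 : ℝ → ℝ → Mat d} {r : Fin ℓ → ℝ} {φ : ℝ → ℝ}
  {f : BlockVec k ℓ → Vec d →L[ℝ] Vec k} {y : ℝ → Vec k} {y' : ℝ → Vec d →L[ℝ] Vec k}

/-- The path `Y` satisfies the equation without error over the steps of the grid of `D`. -/
structure IsEuler (T : ℝ) (X : ℝ → Vec d) (𝕏 : ℝ → ℝ → Mat d) (r : Fin ℓ → ℝ)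
    (f : BlockVec k ℓ → Vec d →L[ℝ] Vec k) (y : ℝ → Vec k) (y' : ℝ → Vec d →L[ℝ] Vec k)
    (D : Finset ℝ) (Y : ℝ → Vec k) : Prop where
  start : Y 0 = y 0
  step : ∀ m, rdeError X 𝕏 r f y Y (fun s => y' s + coeff f r Y s)
    (grid T D m) (grid T D (m + 1)) = 0

/-- The scheme along the grid is read back as a function of time. The enumeration repeats its last
point for ever, but steps of zero length do not move the scheme, so its value depends on the time
alone. -/
theorem exists_euler (hD : IsData p T X 𝕏 r f) {D : Finset ℝ} (hDr : Finset.univ.image r ⊆ D)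
    (y : ℝ → Vec k) (y' : ℝ → Vec d →L[ℝ] Vec k) : ∃ Y, IsEuler T X 𝕏 r f y y' D Y := by
  have hT := hD.pos.le
  have hτ := isTimes_grid hT hD.mem hDr
  have hτ0 : grid T D 0 = 0 := grid_start hT
  obtain ⟨S, Sb, S', hS, hS0, hSb0⟩ := exists_scheme (fun m => X (grid T D m))
    (fun i j => 𝕏 (grid T D i) (grid T D j)) (fun m => embed r (grid T D m)) f
    (fun m => y (grid T D m)) (fun m => y' (grid T D m)) (y 0) (WithLp.toLp 2 fun _ => y 0)
  have hstep : ∀ m, grid T D m = grid T D (m + 1) → S m = S (m + 1) := fun m h => by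
    have h1 := hS.step m
    have h2 : 𝕏 (grid T D m) (grid T D m) = 0 := hD.rough.area_self (hτ.mem m).1 (hτ.mem m).2
    rw [germ, ← h, h2] at h1
    simp only [sub_self, map_zero, tensorApply, PiLp.zero_apply, zero_smul, Finset.sum_const_zero,
      add_zero] at h1
    exact (sub_eq_zero.1 h1).symm
  have hfac : ∀ i j, i ≤ j → grid T D i = grid T D j → S i = S j := by
    intro i j hij
    induction j, hij using Nat.le_induction with
    | base => exact fun _ => rfl
    | succ j hij ih =>
      intro h
      have h1 : grid T D i ≤ grid T D j := hτ.mono hij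
      have h2 : grid T D j ≤ grid T D (j + 1) := hτ.mono (Nat.le_succ j)
      exact (ih (by linarith)).trans (hstep j (by linarith))
  -- Values away from the grid are irrelevant: since every `r i` is a grid point, the stopped path
  -- at grid times only sees grid values.
  set Y : ℝ → Vec k := fun s => S (gridIdx T D s) with hY
  have hYS : ∀ m, Y (grid T D m) = S m := fun m =>
    hfac _ _ (gridIdx_le rfl) (grid_gridIdx (grid_mem m))
  have hY0 : Y 0 = y 0 := by rw [← hτ0, hYS, hS0, hτ0]
  have hb : ∀ m, stopped r Y (grid T D m) = Sb m := fun m => by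
    induction m with
    | zero => rw [hτ0, stopped_start r (fun i => (hD.mem i).1), hSb0, hY0]
    | succ m ih =>
      have h1 := isState_sample hτ Y m
      have h2 := hS.state m
      simp only [hYS, ih] at h1
      rw [← h1] at h2
      simpa using h2.symm
  refine ⟨Y, hY0, fun m => ?_⟩
  have h1 := hS.step m
  rw [rdeError, rdeGerm, hYS, hYS, h1]
  simp only [germ, chainDeriv, coeff, hb, hS.deriv_eq]
  abel

/-- Bounds in terms of the control `φ` over the intervals with end points in `S`. -/
structure ControlledOn {E : Type*} [NormedAddCommGroup E] [NormedSpace ℝ E] (B p : ℝ)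
    (S : Set ℝ) (φ : ℝ → ℝ) (X : ℝ → Vec d) (Y : ℝ → E) (Y' : ℝ → Vec d →L[ℝ] E) : Prop where
  deriv_le : ∀ s ∈ S, ‖Y' s‖ ≤ B
  deriv_incr : ∀ s ∈ S, ∀ t ∈ S, s ≤ t → ‖Y' t - Y' s‖ ≤ B * gaugeOf p φ s t
  rem : ∀ s ∈ S, ∀ t ∈ S, s ≤ t → ‖Y t - Y s - Y' s (X t - X s)‖ ≤ B * gaugeOf p φ s t ^ 2

theorem ControlledOn.sample {E : Type*} [NormedAddCommGroup E] [NormedSpace ℝ E] {B : ℝ}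
    {S : Set ℝ} (hp : 0 < p) (hB : 0 ≤ B) (hφ : Monotone φ) {Y : ℝ → E} {Y' : ℝ → Vec d →L[ℝ] E}
    (h : ControlledOn B p S φ X Y Y') {t : ℕ → ℝ} (ht : Monotone t) (htS : ∀ m, t m ∈ S)
    {ψ : ℕ → ℝ} (hψ : Monotone ψ) :
    GaugeControlled B (gaugeOf p (fun m => φ (t m) + ψ m)) (fun m => X (t m)) (fun m => Y (t m))
      (fun m => Y' (t m)) := by
  have hs := fun {i j : ℕ} (hij : i ≤ j) => gaugeOf_sample_le hp hφ ht hψ hij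
  refine ⟨fun i => h.deriv_le _ (htS i), fun i j hij => ?_, fun i j hij => ?_⟩
  · exact (h.deriv_incr _ (htS i) _ (htS j) (ht hij)).trans
      (mul_le_mul_of_nonneg_left (hs hij) hB)
  · exact (h.rem _ (htS i) _ (htS j) (ht hij)).trans
      (mul_le_mul_of_nonneg_left (pow_le_pow_left₀ (gaugeOf_nonneg _ _ _ _) (hs hij) 2) hB)

theorem driver_grid (hp : 1 ≤ p) (hD : IsData p T X 𝕏 r f) (hφ : IsRdeControl p T X 𝕏 r φ)
    {D : Finset ℝ} (hDr : Finset.univ.image r ⊆ D) {ψ : ℕ → ℝ} (hψ : Monotone ψ) {B : ℝ}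
    (hB : ℓ + 1 + (φ T - φ 0) ≤ B) (hψB : ∀ i j, ψ j - ψ i ≤ B - (φ T - φ 0)) :
    Driver (E := Vec k) B (2 ^ (1 - 3 * (1 / p))) (gaugeOf p (fun m => φ (grid T D m) + ψ m))
      (fun m => X (grid T D m)) (fun i j => 𝕏 (grid T D i) (grid T D j))
      (fun m => embed r (grid T D m)) := by
  have hτ := isTimes_grid hD.pos.le hD.mem hDr
  refine driver_sample hp hD.rough hφ hτ hψ le_rfl
    (by linarith [hφ.mono hD.pos.le]) (fun i j _ => ?_)
  have e1 := hφ.mono (hτ.mem i).1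
  have e2 := hφ.mono (hτ.mem j).2
  linarith [hψB i j]

theorem rpow_sub_lt_one {p : ℝ} (hp : 2 < p) (hp3 : p < 3) : (2 : ℝ) ^ (1 - 3 * (1 / p)) < 1 := by
  refine Real.rpow_lt_one_of_one_lt_of_neg one_lt_two ?_
  have : 1 / 3 < 1 / p := one_div_lt_one_div_of_lt (by linarith) hp3
  linarith

/-- The discrete a priori estimate applied without local errors; the constant does not depend on the
grid. -/
theorem exists_euler_bound (hp : 2 < p) (hp3 : p < 3) (hD : IsData p T X 𝕏 r f)
    (hφ : IsRdeControl p T X 𝕏 r φ) {B : ℝ} (hy : PathControlled B p T φ X y y') :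
    ∃ C, 0 ≤ C ∧ ∀ D Y, Finset.univ.image r ⊆ D → IsEuler T X 𝕏 r f y y' D Y →
      ControlledOn C p (gridSet T D) φ X Y (fun s => y' s + coeff f r Y s) := by
  have hT := hD.pos.le
  set B' := max B (ℓ + 1 + (φ T - φ 0) + cbNorm 2 f) with hB'
  have hφT : 0 ≤ φ T - φ 0 := sub_nonneg.2 (hφ.mono hT)
  have hℓ0 : (0 : ℝ) ≤ ℓ := Nat.cast_nonneg ℓ
  have hf0 : (0 : ℝ) ≤ cbNorm 2 f := NNReal.coe_nonneg _
  have hBr : ℓ + 1 + (φ T - φ 0) + cbNorm 2 f ≤ B' := le_max_right _ _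
  have hB1 : 1 ≤ B' := by linarith
  have hκ1 := rpow_sub_lt_one hp hp3
  obtain ⟨C, hC, hap⟩ := exists_apriori_bound (E := Vec k) (F := BlockVec k ℓ) d hB1
    (by positivity) hκ1
  refine ⟨C, by linarith, fun D Y hDr hY => ?_⟩
  have hτ := isTimes_grid hT hD.mem hDr
  have hdr := driver_grid (k := k) (by linarith) hD hφ hDr (ψ := fun _ => 0) monotone_const
    (B := B') (by linarith) (fun i j => by linarith)
  have hyc := (hy.mono (le_max_left B _)).sample (by linarith) (by linarith) hφ.mono hτ
    (ψ := fun _ => 0) monotone_const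
  have hsch := isScheme_sample (X := X) (𝕏 := 𝕏) (f := f) (y := y) (Y := Y) (y' := y')
    (Y' := fun s => y' s + coeff f r Y s) hτ (fun _ _ => rfl)
  simp only [hY.step, Finset.sum_const_zero, add_zero] at hsch
  have key := hap hdr (hD.coeff_mem.bounds₂ (by linarith)) hyc hsch
  simp only [add_zero] at key
  refine ⟨fun s hs => ?_, fun s hs t ht hst => ?_, fun s hs t ht hst => ?_⟩
  · simpa only [grid_gridIdx hs] using key.deriv_le (gridIdx T D s)
  · have := key.deriv_incr _ _ (gridIdx_mono hs ht hst)
    simpa only [gaugeOf, grid_gridIdx hs, grid_gridIdx ht] using this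
  · have := key.rem _ _ (gridIdx_mono hs ht hst)
    simpa only [gaugeOf, grid_gridIdx hs, grid_gridIdx ht] using this

/-- The error is itself a sewing error: it vanishes on single steps because the scheme is exact
there, and its defect is minus that of the germ. Hence it is small over short times between any two
grid points, uniformly over all grids. -/
theorem exists_euler_error (hp : 2 < p) (hp3 : p < 3) (hD : IsData p T X 𝕏 r f)
    (hφ : IsRdeControl p T X 𝕏 r φ) (C : ℝ) {ε : ℝ} (hε : 0 < ε) :
    ∃ δ > 0, ∀ D Y, Finset.univ.image r ⊆ D → IsEuler T X 𝕏 r f y y' D Y →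
      ControlledOn C p (gridSet T D) φ X Y (fun s => y' s + coeff f r Y s) →
      ∀ s ∈ gridSet T D, ∀ t ∈ gridSet T D, s ≤ t → t - s ≤ δ →
        ‖rdeError X 𝕏 r f y Y (fun s => y' s + coeff f r Y s) s t‖ ≤ ε * (φ t - φ s) := by
  have hT := hD.pos.le
  set B' := max C (ℓ + 1 + (φ T - φ 0) + cbNorm 2 f) with hB'
  have hφT : 0 ≤ φ T - φ 0 := sub_nonneg.2 (hφ.mono hT)
  have hℓ0 : (0 : ℝ) ≤ ℓ := Nat.cast_nonneg ℓ
  have hf0 : (0 : ℝ) ≤ cbNorm 2 f := NNReal.coe_nonneg _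
  have hBr : ℓ + 1 + (φ T - φ 0) + cbNorm 2 f ≤ B' := le_max_right _ _
  have hB1 : 1 ≤ B' := by linarith
  obtain ⟨A, hA, hdef⟩ := exists_germ_defect_bound (E := Vec k) (F := BlockVec k ℓ) d hB1
  obtain ⟨δ, hδ, hmesh⟩ := hD.rough.exists_sewing_mesh (E := Vec k) (by linarith) hp3
    hφ.toIsControlOf hA hε
  refine ⟨δ, hδ, fun D Y hDr hY hYC s hs t ht hst htδ => ?_⟩
  have hτ := isTimes_grid hT hD.mem hDr
  have hdr := driver_grid (k := k) (by linarith) hD hφ hDr (ψ := fun _ => 0) monotone_const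
    (B := B') (by linarith) (fun i j => by linarith)
  have hYC' : ControlledOn B' p (gridSet T D) φ X Y (fun s => y' s + coeff f r Y s) := by
    have hle : C ≤ B' := le_max_left _ _
    have hn := gaugeOf_nonneg p φ
    exact ⟨fun s hs => (hYC.deriv_le s hs).trans hle, fun s hs t ht h =>
      (hYC.deriv_incr s hs t ht h).trans (mul_le_mul_of_nonneg_right hle (hn s t)),
      fun s hs t ht h => (hYC.rem s hs t ht h).trans
        (mul_le_mul_of_nonneg_right hle (pow_nonneg (hn s t) 2))⟩
  have hgc := hYC'.sample (by linarith) (by linarith) hφ.mono hτ.mono (fun m => grid_mem m)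
    (ψ := fun _ => 0) monotone_const
  have hd := hdef hdr (hD.coeff_mem.bounds₂ (by linarith)) (isState_sample hτ Y) hgc
  simp only [add_zero] at hd
  have key := hmesh (grid T D) hτ.mono hτ.mem
    (fun i j => rdeError X 𝕏 r f y Y (fun s => y' s + coeff f r Y s) (grid T D i) (grid T D j))
    (fun i => ?_) hY.step (fun i m j him hmj => ?_) (gridIdx T D s) (gridIdx T D t)
    (gridIdx_mono hs ht hst) (by rw [grid_gridIdx hs, grid_gridIdx ht]; exact htδ)
  · simpa only [grid_gridIdx hs, grid_gridIdx ht] using key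
  · have : 𝕏 (grid T D i) (grid T D i) = 0 := hD.rough.area_self (hτ.mem i).1 (hτ.mem i).2
    simp [rdeError, rdeGerm, germ_self _ _ this]
  · refine le_trans (le_of_eq ?_) (hd i m j him hmj)
    congr 1
    simp only [rdeError]
    change _ = rdeGerm X 𝕏 r f Y (fun s => y' s + coeff f r Y s) (grid T D i) (grid T D m)
      + rdeGerm X 𝕏 r f Y (fun s => y' s + coeff f r Y s) (grid T D m) (grid T D j)
      - rdeGerm X 𝕏 r f Y (fun s => y' s + coeff f r Y s) (grid T D i) (grid T D j)
    abel

/-- The Euler schemes form a Cauchy net. -/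
theorem exists_euler_close (hp : 2 < p) (hp3 : p < 3) (hD : IsData p T X 𝕏 r f)
    (hφ : IsRdeControl p T X 𝕏 r φ) {C : ℝ} (hC : 0 ≤ C) {ε : ℝ} (hε : 0 < ε) :
    ∃ D₀ : Finset ℝ, ∀ D D' Y Z, D₀ ⊆ D → D ⊆ D' → Finset.univ.image r ⊆ D →
      IsEuler T X 𝕏 r f y y' D Y → IsEuler T X 𝕏 r f y y' D' Z →
      ControlledOn C p (gridSet T D) φ X Y (fun s => y' s + coeff f r Y s) →
      ControlledOn C p (gridSet T D') φ X Z (fun s => y' s + coeff f r Z s) →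
      ∀ s ∈ gridSet T D, ‖Y s - Z s‖ ≤ ε := by
  have hT := hD.pos.le
  set B' := max C (ℓ + 2 + (φ T - φ 0) + cbNorm 3 f) with hB'
  have hφT : 0 ≤ φ T - φ 0 := sub_nonneg.2 (hφ.mono hT)
  have hℓ0 : (0 : ℝ) ≤ ℓ := Nat.cast_nonneg ℓ
  have hf0 : (0 : ℝ) ≤ cbNorm 3 f := NNReal.coe_nonneg _
  have hBr : ℓ + 2 + (φ T - φ 0) + cbNorm 3 f ≤ B' := le_max_right _ _
  have hB1 : 1 ≤ B' := by linarith
  have hκ1 := rpow_sub_lt_one hp hp3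
  obtain ⟨K, hK, hap⟩ := exists_lipschitz_bound (E := Vec k) (F := BlockVec k ℓ) d hB1
    (by positivity) hκ1
  -- On the coarse grid, the finer scheme `Z` solves the same scheme as `Y` with its local errors
  -- added to `y`. With total error at most `η ^ 2` and `ψ` scaled by `1 / η`, the data differ by
  -- `η`, so the Lipschitz estimate gives `K * η ≤ ε`.
  set η := min 1 (ε / (K + 1)) with hη'
  have hη : 0 < η := by positivity
  have hη1 : η ≤ 1 := min_le_left _ _
  have hηK : K * η ≤ ε := by
    have : η ≤ ε / (K + 1) := min_le_right _ _
    calc K * η ≤ (K + 1) * (ε / (K + 1)) := by gcongr; linarith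
      _ = ε := by field_simp
  set W := φ T - φ 0 with hW
  obtain ⟨δ, hδ, herr⟩ := exists_euler_error (y := y) (y' := y') hp hp3 hD hφ C
    (ε := η ^ 2 / (W + 1)) (by positivity)
  obtain ⟨D₀, hD₀⟩ := exists_fine_grid hT hδ
  refine ⟨D₀, fun D D' Y Z h0 hDD hDr hY hZ hYC hZC s hs => ?_⟩
  have hτ := isTimes_grid hT hD.mem hDr
  set τ := grid T D with hτdef
  have hτD' : ∀ m, τ m ∈ gridSet T D' := fun m => gridSet_mono hDD (grid_mem m)
  set g : ℕ → Vec k := fun l => rdeError X 𝕏 r f y Z (fun s => y' s + coeff f r Z s)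
    (τ l) (τ (l + 1)) with hg
  set ψ : ℕ → ℝ := fun m => (∑ l ∈ Finset.range m, ‖g l‖) / η with hψ
  have hψm : Monotone ψ := fun i j hij =>
    div_le_div_of_nonneg_right (sum_range_norm_mono g hij) hη.le
  have hψ0 : ∀ m, 0 ≤ ψ m := fun m => div_nonneg
    (Finset.sum_nonneg fun _ _ => norm_nonneg _) hη.le
  have hψη : ∀ i j, ψ j - ψ i ≤ 1 := fun i j => by
    have h1 : ∑ l ∈ Finset.range j, ‖g l‖ ≤ η ^ 2 := by
      calc _ ≤ ∑ l ∈ Finset.range j, η ^ 2 / (W + 1) * (φ (τ (l + 1)) - φ (τ l)) :=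
            Finset.sum_le_sum fun l _ => herr D' Z (hDr.trans hDD) hZ hZC _ (hτD' l) _
              (hτD' (l + 1)) (hτ.mono (Nat.le_succ l)) (hD₀ D h0 l)
        _ = η ^ 2 / (W + 1) * (φ (τ j) - φ (τ 0)) := by
            rw [← Finset.mul_sum, Finset.sum_range_sub (fun l => φ (τ l))]
        _ ≤ η ^ 2 / (W + 1) * (W + 1) := by
            have e1 := hφ.mono (hτ.mem 0).1
            have e2 := hφ.mono (hτ.mem j).2
            gcongr
            linarith
        _ = η ^ 2 := by field_simp
    have : ψ j ≤ 1 := by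
      refine (div_le_iff₀ hη).2 ?_
      nlinarith
    linarith [hψ0 i]
  have hdr := driver_grid (k := k) (by linarith) hD hφ hDr hψm (B := B') (by linarith)
    (fun i j => by linarith [hψη i j])
  have hcon : ∀ {S : Set ℝ} {U : ℝ → Vec k} {U' : ℝ → Vec d →L[ℝ] Vec k},
      ControlledOn C p S φ X U U' → (∀ m, τ m ∈ S) →
      GaugeControlled B' (gaugeOf p (fun m => φ (τ m) + ψ m)) (fun m => X (τ m))
        (fun m => U (τ m)) (fun m => U' (τ m)) := fun hU hS =>
    (hU.sample (by linarith) hC hφ.mono hτ.mono hS hψm).mono (gaugeOf_nonneg _ _)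
      (le_max_left _ _)
  have hzero : GaugeControlled 0 (gaugeOf p (fun m => φ (τ m) + ψ m)) (fun m => X (τ m))
      (fun _ => (0 : Vec k)) (fun _ => 0) :=
    ⟨fun i => by simp, fun i j _ => by simp, fun i j _ => by simp⟩
  have hu := hzero.add_error hp.le (hφ.mono.comp hτ.mono) hψm (η := η) hη.le
    (e := fun m => -∑ l ∈ Finset.range m, g l) (fun i j hij => by
      have e1 := sum_range_sub_le g hij
      calc _ = ‖∑ l ∈ Finset.range j, g l - ∑ l ∈ Finset.range i, g l‖ := by
            rw [← norm_neg]; congr 1; abel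
        _ ≤ _ := e1
        _ = _ := by simp only [hψ]; field_simp)
    (fun i j _ => hψη i j)
  rw [show (fun m => (0 : Vec k) + -∑ l ∈ Finset.range m, g l) =
    fun m => y (τ m) - (y (τ m) + ∑ l ∈ Finset.range m, g l) from funext fun m => by abel,
    show (fun _ : ℕ => (0 : Vec d →L[ℝ] Vec k)) = fun m => y' (τ m) - y' (τ m) from
    funext fun m => (sub_self _).symm, zero_add] at hu
  have hschY := isScheme_sample (X := X) (𝕏 := 𝕏) (f := f) (y := y) (Y := Y) (y' := y')
    (Y' := fun s => y' s + coeff f r Y s) hτ (fun _ _ => rfl)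
  simp only [hτdef, hY.step, Finset.sum_const_zero, add_zero] at hschY
  have hschZ := isScheme_sample (X := X) (𝕏 := 𝕏) (f := f) (y := y) (Y := Z) (y' := y')
    (Y' := fun s => y' s + coeff f r Z s) hτ (fun _ _ => rfl)
  obtain ⟨key, -⟩ := hap (Δ := η) hdr (hD.coeff_mem.bounds₃ (by linarith)) hschY hschZ
    (hcon hYC fun m => grid_mem m) (hcon hZC hτD') hη.le
    hu
    (by
      have : τ 0 = 0 := grid_start hT
      have h := norm_stopped_start_sub r (fun i => (hD.mem i).1) Y Z
      rw [hY.start, hZ.start, sub_self, norm_zero, mul_zero] at h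
      simp only [← hτdef, this]
      linarith)
  have h1 := key (gridIdx T D s)
  simp only [← hτdef, show τ (gridIdx T D s) = s from grid_gridIdx hs] at h1
  have h2 := norm_le_stopped (stopped r Y s - stopped r Z s)
  simp only [PiLp.sub_apply, stopped_zero] at h2
  linarith

theorem continuous_tensorApply {E V : Type*} [NormedAddCommGroup E] [NormedSpace ℝ E]
    [TopologicalSpace V] {A : V → Vec d →L[ℝ] Vec d →L[ℝ] E} (hA : Continuous A) (M : Mat d) :
    Continuous fun v => tensorApply (A v) M := by
  unfold tensorApply
  fun_prop

/-- Pointwise limits of paths: convergence of the quantities occurring in the equation. -/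
theorem tendsto_stopped {ι : Type*} {l : Filter ι} {Yn : ι → ℝ → Vec k} {Y : ℝ → Vec k}
    (hr : ∀ i, r i ∈ Icc 0 T) (h : ∀ t ∈ Icc 0 T, Tendsto (fun n => Yn n t) l (𝓝 (Y t))) {t : ℝ}
    (ht : t ∈ Icc 0 T) : Tendsto (fun n => stopped r (Yn n) t) l (𝓝 (stopped r Y t)) := by
  refine ((PiLp.continuous_toLp 2 _).tendsto _).comp (tendsto_pi_nhds.2 fun i => ?_)
  refine Fin.cases ?_ (fun i => ?_) i
  · simpa using h t ht
  · simpa using h (min t (r i)) ⟨le_min ht.1 (hr i).1, (min_le_left _ _).trans ht.2⟩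

/-- The error over `[s, t]` is a continuous function of the values of the path at finitely many
times, so pointwise convergence is enough. -/
theorem tendsto_rdeError {ι : Type*} {l : Filter ι} {Yn : ι → ℝ → Vec k} {Y : ℝ → Vec k}
    (hf : ContDiff ℝ 3 f) (hr : ∀ i, r i ∈ Icc 0 T)
    (h : ∀ t ∈ Icc 0 T, Tendsto (fun n => Yn n t) l (𝓝 (Y t))) {s t : ℝ}
    (hs : s ∈ Icc 0 T) (ht : t ∈ Icc 0 T) :
    Tendsto (fun n => rdeError X 𝕏 r f y (Yn n) (fun s => y' s + coeff f r (Yn n) s) s t) l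
      (𝓝 (rdeError X 𝕏 r f y Y (fun s => y' s + coeff f r Y s) s t)) := by
  have hfc := hf.continuous
  have hfd : Continuous (fderiv ℝ f) := hf.continuous_fderiv (by norm_num)
  have hc : Continuous fun b : BlockVec k ℓ => f b (X t - X s)
      + tensorApply (fderiv ℝ f b ∘L (embed r s ∘L (y' s + f b))) (𝕏 s t) :=
    Continuous.add (by fun_prop) (continuous_tensorApply (by fun_prop) _)
  exact (((h t ht).sub (h s hs)).sub_const _).sub
    ((hc.tendsto (stopped r Y s)).comp (tendsto_stopped hr h hs))

/-- The Euler schemes converge pointwise along the net of finite sets. Any two given times belong to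
all large grids, so the controlled bounds and the error bounds, being uniform in the grid, hold in
the limit for every pair of times. -/
theorem exists_isLocalSolution (hp : 2 < p) (hp3 : p < 3) (hD : IsData p T X 𝕏 r f)
    (hφ : IsRdeControl p T X 𝕏 r φ) {B : ℝ} (hy : PathControlled B p T φ X y y') :
    ∃ Y Y' C, 0 ≤ C ∧ IsLocalSolution T X 𝕏 r f φ y y' Y Y' ∧ PathControlled C p T φ X Y Y' := by
  have hT := hD.pos.le
  obtain ⟨C, hC, hbd⟩ := exists_euler_bound hp hp3 hD hφ hy
  have hex : ∀ D : Finset ℝ, ∃ Y, Finset.univ.image r ⊆ D → IsEuler T X 𝕏 r f y y' D Y :=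
    fun D => by
      by_cases h : Finset.univ.image r ⊆ D
      · exact (exists_euler hD h y y').imp fun _ h _ => h
      · exact ⟨0, fun h' => absurd h' h⟩
  choose Yn hYn using hex
  have hlim : ∀ t, ∃ l, t ∈ Icc 0 T → Tendsto (fun D => Yn D t) atTop (𝓝 l) := fun t => by
    by_cases ht : t ∈ Icc 0 T
    swap
    · exact ⟨0, fun h => absurd h ht⟩
    have hcau : CauchySeq fun D => Yn D t := by
      rw [Metric.cauchySeq_iff']
      intro ε hε
      obtain ⟨D₀, h⟩ := exists_euler_close (y := y) (y' := y') hp hp3 hD hφ hC (half_pos hε)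
      -- For a net indexed by a directed set it suffices to compare every larger grid with this one;
      -- including `t` makes it a common grid point.
      refine ⟨D₀ ∪ Finset.univ.image r ∪ {t}, fun D hDD => ?_⟩
      have h1 : D₀ ∪ Finset.univ.image r ∪ {t} ⊆ D := hDD
      have hr1 : Finset.univ.image r ⊆ D₀ ∪ Finset.univ.image r ∪ {t} :=
        Finset.subset_union_right.trans Finset.subset_union_left
      have hr2 := hr1.trans h1
      have := h _ D _ _ (Finset.subset_union_left.trans Finset.subset_union_left) h1 hr1
        (hYn _ hr1) (hYn D hr2) (hbd _ _ hr1 (hYn _ hr1)) (hbd _ _ hr2 (hYn _ hr2)) t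
        (mem_gridSet (by simp) ht.1 ht.2)
      rw [dist_comm, dist_eq_norm]
      linarith
    obtain ⟨l, hl⟩ := cauchySeq_tendsto_of_complete hcau
    exact ⟨l, fun _ => hl⟩
  choose Y hY using hlim
  have hfc := hD.coeff_mem.contDiff.continuous
  have hY' : ∀ t ∈ Icc 0 T, Tendsto (fun D => y' t + coeff f r (Yn D) t) atTop
      (𝓝 (y' t + coeff f r Y t)) := fun t ht =>
    tendsto_const_nhds.add ((hfc.tendsto _).comp (tendsto_stopped hD.mem hY ht))
  have hev : ∀ s ∈ Icc 0 T, ∀ t ∈ Icc 0 T, ∀ᶠ D : Finset ℝ in atTop,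
      Finset.univ.image r ⊆ D ∧ s ∈ gridSet T D ∧ t ∈ gridSet T D := fun s hs t ht => by
    filter_upwards [eventually_ge_atTop (Finset.univ.image r ∪ {s, t})] with D hDD
    exact ⟨Finset.union_subset_left hDD, mem_gridSet (hDD (by simp)) hs.1 hs.2,
      mem_gridSet (hDD (by simp)) ht.1 ht.2⟩
  refine ⟨Y, fun s => y' s + coeff f r Y s, C, hC, ⟨fun _ _ => rfl, ?_, fun ε hε => ?_⟩,
    ⟨fun s h0 hsT => ?_, fun s t h0 hst htT => ?_, fun s t h0 hst htT => ?_⟩⟩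
  · refine tendsto_nhds_unique (hY 0 ⟨le_rfl, hT⟩) (tendsto_const_nhds.congr' ?_)
    filter_upwards [eventually_ge_atTop (Finset.univ.image r)] with D hDD
    exact (hYn D hDD).start.symm
  · obtain ⟨δ, hδ, h⟩ := exists_euler_error (y := y) (y' := y') hp hp3 hD hφ C hε
    refine ⟨δ, hδ, fun s t h0 hst htT htδ => ?_⟩
    have hs : s ∈ Icc 0 T := ⟨h0, hst.trans htT⟩
    have ht : t ∈ Icc 0 T := ⟨h0.trans hst, htT⟩
    refine le_of_tendsto (tendsto_rdeError hD.coeff_mem.contDiff hD.mem hY hs ht).norm ?_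
    filter_upwards [hev s hs t ht] with D ⟨h1, h2, h3⟩
    exact h D _ h1 (hYn D h1) (hbd _ _ h1 (hYn D h1)) s h2 t h3 hst htδ
  · have hs : s ∈ Icc 0 T := ⟨h0, hsT⟩
    refine le_of_tendsto (hY' s hs).norm ?_
    filter_upwards [hev s hs s hs] with D ⟨h1, h2, h3⟩
    exact (hbd _ _ h1 (hYn D h1)).deriv_le s h2
  · have hs : s ∈ Icc 0 T := ⟨h0, hst.trans htT⟩
    have ht : t ∈ Icc 0 T := ⟨h0.trans hst, htT⟩
    refine le_of_tendsto ((hY' t ht).sub (hY' s hs)).norm ?_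
    filter_upwards [hev s hs t ht] with D ⟨h1, h2, h3⟩
    exact (hbd _ _ h1 (hYn D h1)).deriv_incr s h2 t h3 hst
  · have hs : s ∈ Icc 0 T := ⟨h0, hst.trans htT⟩
    have ht : t ∈ Icc 0 T := ⟨h0.trans hst, htT⟩
    have hev' : Continuous fun A : Vec d →L[ℝ] Vec k => A (X t - X s) := by fun_prop
    refine le_of_tendsto (((hY t ht).sub (hY s hs)).sub
      ((hev'.tendsto _).comp (hY' s hs))).norm ?_
    filter_upwards [hev s hs t ht] with D ⟨h1, h2, h3⟩
    exact (hbd _ _ h1 (hYn D h1)).rem s h2 t h3 hst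

end Existence

end RoughPath

namespace RoughPath

/-! ### Càdlàg paths -/

section Cadlag

variable {E F : Type*} [NormedAddCommGroup E] [NormedAddCommGroup F]

theorem IsCadlagOn.mono {Y : ℝ → E} {a b a' b' : ℝ} (hY : IsCadlagOn Y a b) (ha : a ≤ a')
    (hb : b' ≤ b) : IsCadlagOn Y a' b' := fun t ht => by
  obtain ⟨h1, l, h2⟩ := hY t ⟨ha.trans ht.1, ht.2.trans hb⟩
  exact ⟨h1.mono (Icc_subset_Icc le_rfl hb), l,
    h2.mono_left (nhdsWithin_mono t (Ico_subset_Ico ha le_rfl))⟩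

theorem IsCadlagOn.comp {Y : ℝ → E} {a b : ℝ} (hY : IsCadlagOn Y a b) {g : E → F}
    (hg : Continuous g) : IsCadlagOn (fun t => g (Y t)) a b := fun t ht => by
  obtain ⟨h1, l, h2⟩ := hY t ht
  exact ⟨hg.continuousAt.comp_continuousWithinAt h1, g l, (hg.tendsto l).comp h2⟩

theorem IsCadlagOn.prodMk {Y : ℝ → E} {Z : ℝ → F} {a b : ℝ} (hY : IsCadlagOn Y a b)
    (hZ : IsCadlagOn Z a b) : IsCadlagOn (fun t => (Y t, Z t)) a b := fun t ht => by
  obtain ⟨h1, l, h2⟩ := hY t ht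
  obtain ⟨h3, l', h4⟩ := hZ t ht
  exact ⟨h1.prodMk h3, (l, l'), h2.prodMk_nhds h4⟩

theorem isCadlagOn_remainder {d : ℕ} [NormedSpace ℝ E] {T : ℝ} {X : ℝ → Vec d} {Y : ℝ → E}
    {Y' : ℝ → Vec d →L[ℝ] E} (hX : IsCadlagOn X 0 T) (hY : IsCadlagOn Y 0 T)
    (hY' : IsCadlagOn Y' 0 T) :
    (∀ t ∈ Icc 0 T, IsCadlagOn (fun s => remainder X Y Y' s t) 0 t) ∧
      ∀ s ∈ Icc 0 T, IsCadlagOn (fun t => remainder X Y Y' s t) s T := by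
  constructor
  · intro t ht
    have h := ((hY.prodMk (hY'.prodMk hX)).mono le_rfl ht.2).comp
      (g := fun q : E × (Vec d →L[ℝ] E) × Vec d => Y t - q.1 - q.2.1 (X t - q.2.2)) (by fun_prop)
    exact h
  · intro s hs
    have h := ((hY.prodMk hX).mono hs.1 le_rfl).comp
      (g := fun q : E × Vec d => q.1 - Y s - Y' s (q.2 - X s)) (by fun_prop)
    exact h

end Cadlag

/-! ### Local solutions are controlled paths and solve the equation -/

section Solutions

variable {d k ℓ : ℕ} {p T : ℝ} {X : ℝ → Vec d} {𝕏 : ℝ → ℝ → Mat d} {r : Fin ℓ → ℝ} {φ : ℝ → ℝ}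

theorem PathControlled.norm_incr_le {E : Type*} [NormedAddCommGroup E] [NormedSpace ℝ E] {C : ℝ}
    (hp : 0 < p) (hφ : IsControlOf p T X 𝕏 φ) {Y : ℝ → E} {Y' : ℝ → Vec d →L[ℝ] E} (hC : 0 ≤ C)
    (hY : PathControlled C p T φ X Y Y') {s t : ℝ} (h0 : 0 ≤ s) (hst : s ≤ t) (hT : t ≤ T) :
    ‖Y t - Y s‖ ≤ C * (1 + (φ T - φ 0) ^ (1 / p)) * (φ t - φ s) ^ (1 / p) := by
  have h1 := hY.rem s t h0 hst hT
  have h2 := hφ.path s t h0 hst hT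
  have hnn : 0 ≤ φ t - φ s := sub_nonneg.2 (hφ.mono hst)
  have hle : φ t - φ s ≤ φ T - φ 0 := by linarith [hφ.mono h0, hφ.mono hT]
  have hg : gaugeOf p φ s t = (φ t - φ s) ^ (1 / p) := by rw [gaugeOf, abs_of_nonneg hnn]
  rw [hg] at h1 h2
  have h3 : (φ t - φ s) ^ (1 / p) ≤ (φ T - φ 0) ^ (1 / p) :=
    Real.rpow_le_rpow hnn hle (by positivity)
  have h4 : 0 ≤ (φ t - φ s) ^ (1 / p) := Real.rpow_nonneg hnn _
  calc ‖Y t - Y s‖ = ‖Y' s (X t - X s) + (Y t - Y s - Y' s (X t - X s))‖ := by congr 1; abel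
    _ ≤ C * (φ t - φ s) ^ (1 / p) + C * ((φ t - φ s) ^ (1 / p)) ^ 2 :=
        (norm_add_le _ _).trans (add_le_add (ContinuousLinearMap.le_of_opNorm_le_of_le _
          (hY.deriv_le s h0 (hst.trans hT)) h2) h1)
    _ = C * (1 + (φ t - φ s) ^ (1 / p)) * (φ t - φ s) ^ (1 / p) := by ring
    _ ≤ _ := by gcongr

variable {f : BlockVec k ℓ → Vec d →L[ℝ] Vec k} {y Y : ℝ → Vec k} {y' Y' : ℝ → Vec d →L[ℝ] Vec k}

/-- The increment of `Y` is that of `y` plus the germ plus the error. The first two tend to zero by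
right-continuity of the data. The error tends to zero because the factor in front of the increment
of `φ` is arbitrarily small, although `φ` need not be right-continuous. -/
theorem IsLocalSolution.continuousWithinAt (hX : IsRoughPath p T X 𝕏) (hφ : Monotone φ)
    (hy : IsCadlagOn y 0 T) (hY : IsLocalSolution T X 𝕏 r f φ y y' Y Y') {t : ℝ}
    (ht : t ∈ Icc 0 T) : ContinuousWithinAt Y (Icc t T) t := by
  have hT : 0 ≤ T := ht.1.trans ht.2
  have hg : Tendsto (fun u => rdeGerm X 𝕏 r f Y Y' t u) (𝓝[Icc t T] t) (𝓝 0) := by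
    have h1 := (hX.path.cadlag t ht).1
    have h2 := (hX.area.cadlag_right t ht t ⟨le_rfl, ht.2⟩).1
    have h3 : ContinuousWithinAt (fun u => rdeGerm X 𝕏 r f Y Y' t u) (Icc t T) t := by
      unfold rdeGerm germ tensorApply
      have h4 : ∀ i j, ContinuousWithinAt (fun u => 𝕏 t u (i, j)) (Icc t T) t := fun i j =>
        (show Continuous fun M : Mat d => M (i, j) by fun_prop).continuousAt.comp_continuousWithinAt
          h2
      refine ContinuousWithinAt.add ?_ ?_
      · exact (show Continuous fun v : Vec d => (coeff f r Y t) (v - X t) by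
          fun_prop).continuousAt.comp_continuousWithinAt h1
      · exact tendsto_finsetSum _ fun i _ => tendsto_finsetSum _ fun j _ =>
          (h4 i j).smul continuousWithinAt_const
    have h4 : rdeGerm X 𝕏 r f Y Y' t t = 0 := germ_self _ _ (hX.area_self ht.1 ht.2)
    rw [ContinuousWithinAt, h4] at h3
    exact h3
  have he : Tendsto (fun u => rdeError X 𝕏 r f y Y Y' t u) (𝓝[Icc t T] t) (𝓝 0) := by
    rw [Metric.tendsto_nhds]
    intro ε hε
    have hφT : 0 ≤ φ T - φ 0 := sub_nonneg.2 (hφ hT)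
    obtain ⟨δ, hδ, h⟩ := hY.error (ε / (φ T - φ 0 + 1)) (by positivity)
    have hb : Metric.ball t δ ∈ 𝓝[Icc t T] t := mem_nhdsWithin_of_mem_nhds (Metric.ball_mem_nhds t hδ)
    filter_upwards [hb, self_mem_nhdsWithin] with u hu hu'
    rw [Metric.mem_ball, Real.dist_eq] at hu
    rw [dist_zero_right]
    calc _ ≤ ε / (φ T - φ 0 + 1) * (φ u - φ t) :=
          h t u ht.1 hu'.1 hu'.2 ((le_abs_self _).trans hu.le)
      _ ≤ ε / (φ T - φ 0 + 1) * (φ T - φ 0) := by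
          have e1 := hφ ht.1
          have e2 := hφ hu'.2
          gcongr
      _ < ε := by
          rw [div_mul_eq_mul_div, div_lt_iff₀ (by positivity)]
          nlinarith
  have hyc := (hy t ht).1
  have hsum := ((hyc.sub_const (y t)).add hg).add he |>.const_add (Y t)
  have e0 : Y t + (y t - y t + 0 + 0) = Y t := by abel
  rw [e0] at hsum
  refine hsum.congr fun u => ?_
  rw [rdeError]
  abel

theorem continuousWithinAt_stopped (hr : ∀ i, r i ∈ Icc 0 T)
    (hY : ∀ t ∈ Icc 0 T, ContinuousWithinAt Y (Icc t T) t) {t : ℝ} (ht : t ∈ Icc 0 T) :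
    ContinuousWithinAt (stopped r Y) (Icc t T) t := by
  refine (PiLp.continuous_toLp 2 _).continuousAt.comp_continuousWithinAt
    (continuousWithinAt_pi.2 fun i => ?_)
  refine Fin.cases ?_ (fun i => ?_) i
  · simpa using hY t ht
  · simp only [Fin.cons_succ]
    have h := hY (min t (r i)) ⟨le_min ht.1 (hr i).1, (min_le_left _ _).trans ht.2⟩
    exact h.comp (t := Icc (min t (r i)) T)
      (f := fun s => min s (r i)) (by fun_prop : Continuous fun s => min s (r i)).continuousWithinAt
      fun s hs => ⟨min_le_min hs.1 le_rfl, (min_le_left _ _).trans hs.2⟩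

/-- Right-continuity comes from the equation; left limits and finite variation come from the
control. -/
theorem IsLocalSolution.isControlled (hp : 0 < p) (hD : IsData p T X 𝕏 r f)
    (hφ : IsRdeControl p T X 𝕏 r φ) (hy : IsControlled p T X y y') {C : ℝ} (hC : 0 ≤ C)
    (hY : IsLocalSolution T X 𝕏 r f φ y y' Y Y') (hYC : PathControlled C p T φ X Y Y') :
    IsControlled p T X Y Y' := by
  have hrc := fun t (ht : t ∈ Icc 0 T) =>
    hY.continuousWithinAt hD.rough hφ.mono hy.path.cadlag ht
  have hφT : 0 ≤ φ T - φ 0 := sub_nonneg.2 (hφ.mono hD.pos.le)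
  have hincr : ∀ s t, 0 ≤ s → s ≤ t → t ≤ T → ‖Y t - Y s‖ ≤
      C * (1 + (φ T - φ 0) ^ (1 / p)) * (φ t - φ s) ^ (1 / p) := fun s t h0 hst hT =>
    hYC.norm_incr_le hp hφ.toIsControlOf hC h0 hst hT
  have hincr' : ∀ s t, 0 ≤ s → s ≤ t → t ≤ T → ‖Y' t - Y' s‖ ≤ C * (φ t - φ s) ^ (1 / p) :=
    fun s t h0 hst hT => by
      have := hYC.deriv_incr s t h0 hst hT
      rwa [gaugeOf, abs_of_nonneg (sub_nonneg.2 (hφ.mono hst))] at this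
  have hcY : IsCadlagOn Y 0 T := fun t ht =>
    ⟨hrc t ht, exists_left_limit hφ.mono (by positivity) hincr ht.2⟩
  have hcY' : IsCadlagOn Y' 0 T := fun t ht => by
    refine ⟨?_, exists_left_limit hφ.mono (by positivity) hincr' ht.2⟩
    have h1 : ContinuousWithinAt (fun s => y' s + coeff f r Y s) (Icc t T) t :=
      (hy.deriv.cadlag t ht).1.add
        (hD.coeff_mem.contDiff.continuous.continuousAt.comp_continuousWithinAt
          (continuousWithinAt_stopped hD.mem hrc ht))
    exact h1.congr (fun s hs => hY.deriv_eq s ⟨ht.1.trans hs.1, hs.2⟩) (hY.deriv_eq t ht)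
  obtain ⟨h1, h2⟩ := isCadlagOn_remainder hD.rough.path.cadlag hcY hcY'
  refine ⟨⟨hcY, ?_⟩, ⟨hcY', ?_⟩, ⟨h1, h2, ?_⟩⟩
  · exact ne_top_of_le_ne_top ENNReal.ofReal_ne_top
      (eVar₂_le_of_control hp hφ.mono (by positivity) le_rfl hincr)
  · exact ne_top_of_le_ne_top ENNReal.ofReal_ne_top
      (eVar₂_le_of_control hp hφ.mono hC le_rfl hincr')
  · refine ne_top_of_le_ne_top ENNReal.ofReal_ne_top
      (eVar₂_le_of_control (by positivity) hφ.mono hC le_rfl fun s t h0 hst hT => ?_)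
    have := hYC.rem s t h0 hst hT
    rwa [gaugeOf_sq (hφ.mono hst)] at this

theorem IntervalPartition.sub_le_mesh {a b : ℝ} (P : IntervalPartition a b) (i : Fin P.n) :
    P.pt i.succ - P.pt i.castSucc ≤ P.mesh :=
  le_ciSup (f := fun i : Fin P.n => P.pt i.succ - P.pt i.castSucc) (finite_range _).bddAbove i

/-- Along a fine partition the compensated sum differs from `Y t - y t` by the sum of the local
errors, and these are bounded by a small multiple of the telescoping increments of `φ`. -/
theorem IsLocalSolution.hasRoughIntegral (hφ : Monotone φ)
    (hY : IsLocalSolution T X 𝕏 r f φ y y' Y Y') {t : ℝ} (ht : t ∈ Icc 0 T) :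
    HasRoughIntegral X 𝕏 (coeff f r Y) (coeffDeriv f r Y Y') 0 t (Y t - y t) := by
  rw [coeffDeriv_eq, HasRoughIntegral, Metric.tendsto_nhds]
  intro ε hε
  have hφT : 0 ≤ φ t - φ 0 := sub_nonneg.2 (hφ ht.1)
  obtain ⟨δ, hδ, h⟩ := hY.error (ε / (φ t - φ 0 + 1)) (by positivity)
  have hev := preimage_mem_comap (m := IntervalPartition.mesh (a := 0) (b := t))
    (Metric.ball_mem_nhds (0 : ℝ) hδ)
  filter_upwards [hev] with P hP
  have hP' : P.mesh ≤ δ := by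
    have : |P.mesh - 0| < δ := hP
    rw [sub_zero] at this
    exact (le_abs_self _).trans this.le
  have hbd : ∀ i : Fin P.n,
      ‖rdeError X 𝕏 r f y Y Y' (P.pt i.castSucc) (P.pt i.succ)‖ ≤
        ε / (φ t - φ 0 + 1) * (φ (P.pt i.succ) - φ (P.pt i.castSucc)) := fun i =>
    h _ _ (P.left_le _) (P.pt_le i) ((P.le_right _).trans ht.2) ((P.sub_le_mesh i).trans hP')
  have e : compensatedSum X 𝕏 (coeff f r Y) (chainDeriv f (embed r) (stopped r Y) Y') P
      - (Y t - y t) = -∑ i : Fin P.n, rdeError X 𝕏 r f y Y Y' (P.pt i.castSucc) (P.pt i.succ) := by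
    have h1 := sum_fin_succ_sub_castSucc fun i => Y (P.pt i) - y (P.pt i)
    rw [P.first, P.last, hY.start, sub_self, sub_zero] at h1
    rw [← h1, compensatedSum, ← Finset.sum_sub_distrib, ← Finset.sum_neg_distrib]
    refine Finset.sum_congr rfl fun i _ => ?_
    simp only [rdeError, rdeGerm, germ, incr]
    abel
  rw [dist_eq_norm, e, norm_neg]
  calc _ ≤ ∑ i : Fin P.n, ε / (φ t - φ 0 + 1) * (φ (P.pt i.succ) - φ (P.pt i.castSucc)) :=
        (norm_sum_le _ _).trans (Finset.sum_le_sum fun i _ => hbd i)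
    _ = ε / (φ t - φ 0 + 1) * (φ t - φ 0) := by
        rw [← Finset.mul_sum, sum_fin_succ_sub_castSucc fun i => φ (P.pt i), P.first, P.last]
    _ < ε := by
        rw [div_mul_eq_mul_div, div_lt_iff₀ (by positivity)]
        nlinarith

theorem IsLocalSolution.isSolution (hp : 0 < p) (hD : IsData p T X 𝕏 r f)
    (hφ : IsRdeControl p T X 𝕏 r φ) (hy : IsControlled p T X y y') {C : ℝ} (hC : 0 ≤ C)
    (hY : IsLocalSolution T X 𝕏 r f φ y y' Y Y') (hYC : PathControlled C p T φ X Y Y') :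
    IsSolution p T X 𝕏 r f y y' Y Y' :=
  ⟨hY.isControlled hp hD hφ hy hC hYC, hY.deriv_eq, fun _ ht => hY.hasRoughIntegral hφ.mono ht⟩

end Solutions

end RoughPath

namespace RoughPath

/-! ### Controls from variation norms -/

section VariationBounds

variable {d k ℓ : ℕ} {p T : ℝ} {X : ℝ → Vec d} {𝕏 : ℝ → ℝ → Mat d} {r : Fin ℓ → ℝ} {φ : ℝ → ℝ}
  {E : Type*} [NormedAddCommGroup E]

/-- Replaces the exponents `p` and `p / 2` by 3, so that the size of the control is bounded
independently of `p`. -/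
theorem rpow_le_cube {q v b : ℝ} (hq : 0 ≤ q) (hq3 : q ≤ 3) (hv : 0 ≤ v) (hvb : v ≤ b)
    (hb : 1 ≤ b) : v ^ q ≤ b ^ 3 := by
  calc v ^ q ≤ b ^ q := Real.rpow_le_rpow hv hvb hq
    _ ≤ b ^ (3 : ℝ) := Real.rpow_le_rpow_of_exponent_le hb hq3
    _ = b ^ 3 := by norm_cast

/-- Dividing the control by `Δ ^ q` bounds its total increment by one and moves the size `Δ` into
the prefactor. Thus a small difference of data gives a small constant, while the control, on which
the other constants depend, keeps a fixed size. -/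
theorem exists_scaled_control {q Δ : ℝ} (hq : 0 < q) (hT : 0 ≤ T) {G : ℝ → ℝ → E}
    (hG : eVar₂ q 0 T G ≠ ∞) (hG0 : ∀ s, 0 ≤ s → s ≤ T → G s s = 0) (hΔ : 0 < Δ)
    (hv : (var₂ q T G : ℝ) ≤ Δ) :
    ∃ φ : ℝ → ℝ, Monotone φ ∧ φ T - φ 0 ≤ 1 ∧
      ∀ s t, 0 ≤ s → s ≤ t → t ≤ T → ‖G s t‖ ≤ Δ * (φ t - φ s) ^ (1 / q) := by
  obtain ⟨φ, h1, h2, h3, h4⟩ := exists_control hq hT hG hG0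
  have hΔq : 0 < Δ ^ q := by positivity
  refine ⟨fun t => φ t / Δ ^ q, fun s t hst => div_le_div_of_nonneg_right (h1 hst) hΔq.le, ?_,
    fun s t h0 hst htT => ?_⟩
  · have e1 : φ T ≤ Δ ^ q := (h3 T).trans (Real.rpow_le_rpow (NNReal.coe_nonneg _) hv hq.le)
    have e2 : φ T / Δ ^ q ≤ 1 := (div_le_one hΔq).2 e1
    have e3 : 0 ≤ φ 0 / Δ ^ q := div_nonneg (h2 0) hΔq.le
    linarith
  · have hd : 0 ≤ φ t - φ s := sub_nonneg.2 (h1 hst)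
    calc ‖G s t‖ = (‖G s t‖ ^ q) ^ (1 / q) := by
          rw [← Real.rpow_mul (norm_nonneg _), mul_one_div_cancel hq.ne', Real.rpow_one]
      _ ≤ (φ t - φ s) ^ (1 / q) :=
          Real.rpow_le_rpow (by positivity) (h4 s t h0 hst htT) (by positivity)
      _ = (Δ ^ q * ((φ t - φ s) / Δ ^ q)) ^ (1 / q) := by congr 1; field_simp
      _ = Δ * ((φ t - φ s) / Δ ^ q) ^ (1 / q) := by
          rw [Real.mul_rpow hΔq.le (by positivity), ← Real.rpow_mul hΔ.le,
            mul_one_div_cancel hq.ne', Real.rpow_one]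
      _ = _ := by rw [sub_div]

variable [NormedSpace ℝ E] {Y Z : ℝ → E} {Y' Z' : ℝ → Vec d →L[ℝ] E}

theorem PathControlled.mono_control {B : ℝ} (hp : 0 < p) (hB : 0 ≤ B) (hφ : Monotone φ)
    (h : PathControlled B p T φ X Y Y') {φ' : ℝ → ℝ}
    (hφ' : ∀ s t, s ≤ t → φ t - φ s ≤ φ' t - φ' s) : PathControlled B p T φ' X Y Y' := by
  have hs : ∀ s t, s ≤ t → gaugeOf p φ s t ≤ gaugeOf p φ' s t := fun s t hst => by
    have h1 := sub_nonneg.2 (hφ hst)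
    have h2 := hφ' s t hst
    refine Real.rpow_le_rpow (abs_nonneg _) ?_ (by positivity)
    rwa [abs_of_nonneg h1, abs_of_nonneg (h1.trans h2)]
  exact ⟨h.deriv_le, fun s t h0 hst hT => (h.deriv_incr s t h0 hst hT).trans
    (mul_le_mul_of_nonneg_left (hs s t hst) hB), fun s t h0 hst hT => (h.rem s t h0 hst hT).trans
    (mul_le_mul_of_nonneg_left (pow_le_pow_left₀ (gaugeOf_nonneg _ _ _ _) (hs s t hst) 2) hB)⟩

theorem IsRdeControl.mono_control (hp : 0 < p) (h : IsRdeControl p T X 𝕏 r φ) {φ' : ℝ → ℝ}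
    (hφ' : ∀ s t, s ≤ t → φ t - φ s ≤ φ' t - φ' s) : IsRdeControl p T X 𝕏 r φ' := by
  have hs : ∀ s t, s ≤ t → gaugeOf p φ s t ≤ gaugeOf p φ' s t := fun s t hst => by
    have h1 := sub_nonneg.2 (h.mono hst)
    have h2 := hφ' s t hst
    refine Real.rpow_le_rpow (abs_nonneg _) ?_ (by positivity)
    rwa [abs_of_nonneg h1, abs_of_nonneg (h1.trans h2)]
  refine ⟨⟨fun s t hst => ?_, fun s t h0 hst hT => (h.path s t h0 hst hT).trans (hs s t hst),
    fun s t h0 hst hT => (h.area s t h0 hst hT).trans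
      (pow_le_pow_left₀ (gaugeOf_nonneg _ _ _ _) (hs s t hst) 2)⟩,
    fun s t h0 hst hT hlt => h.separates s t h0 hst hT ((hφ' s t hst).trans_lt hlt)⟩
  linarith [hφ' s t hst, h.mono hst]

theorem PathControlled.sub {B : ℝ} (hY : PathControlled B p T φ X Y Y')
    (hZ : PathControlled B p T φ X Z Z') :
    PathControlled (2 * B) p T φ X (fun t => Y t - Z t) (fun t => Y' t - Z' t) := by
  refine ⟨fun s h0 hT => ?_, fun s t h0 hst hT => ?_, fun s t h0 hst hT => ?_⟩
  · calc ‖Y' s - Z' s‖ ≤ B + B :=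
          (norm_sub_le _ _).trans (add_le_add (hY.deriv_le s h0 hT) (hZ.deriv_le s h0 hT))
      _ = _ := by ring
  · calc ‖Y' t - Z' t - (Y' s - Z' s)‖ = ‖(Y' t - Y' s) - (Z' t - Z' s)‖ := by congr 1; abel
      _ ≤ B * gaugeOf p φ s t + B * gaugeOf p φ s t := (norm_sub_le _ _).trans
          (add_le_add (hY.deriv_incr s t h0 hst hT) (hZ.deriv_incr s t h0 hst hT))
      _ = _ := by ring
  · calc ‖Y t - Z t - (Y s - Z s) - (Y' s - Z' s) (X t - X s)‖
        = ‖(Y t - Y s - Y' s (X t - X s)) - (Z t - Z s - Z' s (X t - X s))‖ := by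
          rw [_root_.sub_apply]; congr 1; abel
      _ ≤ B * gaugeOf p φ s t ^ 2 + B * gaugeOf p φ s t ^ 2 := (norm_sub_le _ _).trans
          (add_le_add (hY.rem s t h0 hst hT) (hZ.rem s t h0 hst hT))
      _ = _ := by ring

/-- A controlled path is controlled by a function of bounded total increment. -/
theorem exists_pathControlled (hp : 0 < p) (hT : 0 ≤ T) (h1 : eVar₂ p 0 T (incr Y') ≠ ∞)
    (h2 : eVar₂ (p / 2) 0 T (remainder X Y Y') ≠ ∞) {Δ : ℝ} (hΔ : 0 < Δ)
    (h : (ctrlNorm p T X Y Y' : ℝ) ≤ Δ) :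
    ∃ φ, Monotone φ ∧ φ T - φ 0 ≤ 2 ∧ PathControlled (2 * Δ) p T φ X Y Y' := by
  simp only [ctrlNorm, var, NNReal.coe_add, coe_nnnorm] at h
  have n1 := norm_nonneg (Y' 0)
  have n2 : (0 : ℝ) ≤ var₂ p T (incr Y') := NNReal.coe_nonneg _
  have n3 : (0 : ℝ) ≤ var₂ (p / 2) T (remainder X Y Y') := NNReal.coe_nonneg _
  obtain ⟨φ₁, m1, w1, c1⟩ := exists_scaled_control hp hT h1 (fun s _ _ => sub_self _) hΔ
    (by linarith)
  obtain ⟨φ₂, m2, w2, c2⟩ := exists_scaled_control (q := p / 2) (by positivity) hT h2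
    (fun s _ _ => by simp [remainder, incr]) hΔ (by linarith)
  have hm : Monotone fun t => φ₁ t + φ₂ t := m1.add m2
  refine ⟨fun t => φ₁ t + φ₂ t, hm, by linarith, fun s h0 hsT => ?_, fun s t h0 hst htT => ?_,
    fun s t h0 hst htT => ?_⟩
  -- The factor 2 in `2 * Δ`: one `Δ` for `Y' 0` and one for the increment of `Y'` from time zero.
  · have e1 := c1 0 s le_rfl h0 hsT
    have e2 : (φ₁ s - φ₁ 0) ^ (1 / p) ≤ 1 := Real.rpow_le_one (sub_nonneg.2 (m1 h0))
      (by linarith [m1 hsT]) (by positivity)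
    calc ‖Y' s‖ = ‖Y' 0 + incr Y' 0 s‖ := by rw [incr]; congr 1; abel
      _ ≤ Δ + Δ * 1 := (norm_add_le _ _).trans
          (add_le_add (by linarith) (e1.trans (by gcongr)))
      _ = _ := by ring
  · have e1 := sub_nonneg.2 (m1 hst)
    have e2 := sub_nonneg.2 (m2 hst)
    rw [gaugeOf, abs_of_nonneg (by linarith)]
    calc _ ≤ Δ * (φ₁ t - φ₁ s) ^ (1 / p) := c1 s t h0 hst htT
      _ ≤ 2 * Δ * (φ₁ t + φ₂ t - (φ₁ s + φ₂ s)) ^ (1 / p) := by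
          refine mul_le_mul (by linarith) ?_ (by positivity) (by positivity)
          exact Real.rpow_le_rpow e1 (by linarith) (by positivity)
  · have e1 := sub_nonneg.2 (m1 hst)
    have e2 := sub_nonneg.2 (m2 hst)
    rw [gaugeOf_sq (φ := fun t => φ₁ t + φ₂ t) (hm hst)]
    calc _ ≤ Δ * (φ₂ t - φ₂ s) ^ (1 / (p / 2)) := c2 s t h0 hst htT
      _ ≤ 2 * Δ * (φ₁ t + φ₂ t - (φ₁ s + φ₂ s)) ^ (1 / (p / 2)) := by
          refine mul_le_mul (by linarith) ?_ (by positivity) (by positivity)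
          exact Real.rpow_le_rpow e2 (by linarith) (by positivity)

theorem IsControlled.exists_pathControlled (hp : 0 < p) (hT : 0 ≤ T)
    (hY : IsControlled p T X Y Y') {Δ : ℝ} (hΔ : 0 < Δ) (h : (ctrlNorm p T X Y Y' : ℝ) ≤ Δ) :
    ∃ φ, Monotone φ ∧ φ T - φ 0 ≤ 2 ∧ PathControlled (2 * Δ) p T φ X Y Y' :=
  RoughPath.exists_pathControlled hp hT hY.deriv.finite_var hY.rem.finite_var hΔ h

/-- A rough path and the times `r i` have a common control of bounded total increment. -/
theorem IsRoughPath.exists_rdeControl (hp : 0 < p) (hp3 : p ≤ 3) (hT : 0 ≤ T)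
    (hX : IsRoughPath p T X 𝕏) (r : Fin ℓ → ℝ) {b : ℝ} (hb : 1 ≤ b)
    (h : (roughNorm p T X 𝕏 : ℝ) ≤ b) :
    ∃ φ, IsRdeControl p T X 𝕏 r φ ∧ φ T - φ 0 ≤ 2 * b ^ 3 + ℓ := by
  simp only [roughNorm, var, NNReal.coe_add] at h
  have n1 : (0 : ℝ) ≤ var₂ p T (incr X) := NNReal.coe_nonneg _
  have n2 : (0 : ℝ) ≤ var₂ (p / 2) T 𝕏 := NNReal.coe_nonneg _
  obtain ⟨φ₁, m1, p1, w1, c1⟩ := exists_control hp hT hX.path.finite_var (fun s _ _ => sub_self _)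
  obtain ⟨φ₂, m2, p2, w2, c2⟩ := exists_control (q := p / 2) (by positivity) hT hX.area.finite_var
    (fun s h0 h1 => hX.area_self h0 h1)
  have b1 := (w1 T).trans (rpow_le_cube hp.le hp3 n1 (by linarith) hb)
  have b2 := (w2 T).trans (rpow_le_cube (by positivity) (by linarith) n2 (by linarith) hb)
  have mc := countUpTo_mono r
  -- The counting function jumps by at least one at each `r i`, which separates these times at a
  -- total cost of at most `ℓ`.
  refine ⟨fun t => φ₁ t + φ₂ t + countUpTo r t, ⟨⟨(m1.add m2).add mc, fun s t h0 hst htT => ?_,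
    fun s t h0 hst htT => ?_⟩, fun s t h0 hst htT hlt i => ?_⟩, ?_⟩
  · refine le_gaugeOf hp (norm_nonneg _) ((c1 s t h0 hst htT).trans ?_)
    linarith [m2 hst, mc hst]
  · refine le_gaugeOf_sq hp (norm_nonneg _) ((c2 s t h0 hst htT).trans ?_)
    linarith [m1 hst, mc hst]
  · by_contra! hcon
    have := countUpTo_add_one_le r hcon.1 hcon.2
    linarith [m1 hst, m2 hst]
  · linarith [p1 0, p2 0, countUpTo_nonneg r 0, countUpTo_le r T]

theorem PathControlled.ctrlNorm_le (hp : 2 ≤ p) (hT : 0 ≤ T) (hφ : Monotone φ) {C W : ℝ}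
    (hC : 0 ≤ C) (hW1 : 1 ≤ W) (hW : φ T - φ 0 ≤ W) (h : PathControlled C p T φ X Y Y') :
    (ctrlNorm p T X Y Y' : ℝ) ≤ C * (1 + 2 * W) := by
  have h1 := h.deriv_le 0 le_rfl hT
  have h2 := var₂_le_of_control (q := p) (G := incr Y') (by linarith) hT hφ hC hW
    fun s t h0 hst htT => by
      have := h.deriv_incr s t h0 hst htT
      rwa [gaugeOf, abs_of_nonneg (sub_nonneg.2 (hφ hst))] at this
  have h3 := var₂_le_of_control (q := p / 2) (G := remainder X Y Y') (by linarith) hT hφ hC hW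
    fun s t h0 hst htT => by
      have := h.rem s t h0 hst htT
      rwa [gaugeOf_sq (hφ hst)] at this
  have e1 : W ^ (1 / p) ≤ W := rpow_inv_le_of_le (by linarith) (by linarith) hW1 le_rfl
  have e2 : W ^ (1 / (p / 2)) ≤ W := rpow_inv_le_of_le (by linarith) (by linarith) hW1 le_rfl
  simp only [ctrlNorm, var, NNReal.coe_add, coe_nnnorm]
  nlinarith [mul_le_mul_of_nonneg_left e1 hC, mul_le_mul_of_nonneg_left e2 hC]

theorem PathControlled.eVar₂_ne_top (hp : 0 < p) (hφ : Monotone φ) {C : ℝ} (hC : 0 ≤ C)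
    (h : PathControlled C p T φ X Y Y') :
    eVar₂ p 0 T (incr Y') ≠ ∞ ∧ eVar₂ (p / 2) 0 T (remainder X Y Y') ≠ ∞ := by
  constructor
  · refine ne_top_of_le_ne_top ENNReal.ofReal_ne_top
      (eVar₂_le_of_control hp hφ hC le_rfl fun s t h0 hst hT => ?_)
    have := h.deriv_incr s t h0 hst hT
    rwa [gaugeOf, abs_of_nonneg (sub_nonneg.2 (hφ hst))] at this
  · refine ne_top_of_le_ne_top ENNReal.ofReal_ne_top
      (eVar₂_le_of_control (by positivity) hφ hC le_rfl fun s t h0 hst hT => ?_)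
    have := h.rem s t h0 hst hT
    rwa [gaugeOf_sq (hφ hst)] at this

/-- Remainders are linear in `(Y, Y')`, so distances can be handled as norms of difference paths. -/
theorem ctrlDist_eq (X : ℝ → Vec d) (Y Z : ℝ → E) (Y' Z' : ℝ → Vec d →L[ℝ] E) :
    ctrlDist p T X Y Y' Z Z' = ctrlNorm p T X (fun t => Y t - Z t) (fun t => Y' t - Z' t) := by
  have : (fun s t => remainder X Y Y' s t - remainder X Z Z' s t) =
      remainder X (fun t => Y t - Z t) (fun t => Y' t - Z' t) := by
    funext s t
    simp only [remainder, incr, _root_.sub_apply]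
    abel
  rw [ctrlDist, ctrlNorm, this]

/-- The real-valued variation is zero when the extended one is infinite, so finiteness for the
difference has to be secured first; it follows from a common control of the two paths. Only then is
the control rescaled to the distance. -/
theorem IsControlled.exists_pathControlled_sub (hp : 0 < p) (hT : 0 ≤ T)
    (hY : IsControlled p T X Y Y') (hZ : IsControlled p T X Z Z') {Δ : ℝ} (hΔ : 0 < Δ)
    (h : (ctrlDist p T X Y Y' Z Z' : ℝ) ≤ Δ) :
    ∃ φ, Monotone φ ∧ φ T - φ 0 ≤ 2 ∧
      PathControlled (2 * Δ) p T φ X (fun t => Y t - Z t) (fun t => Y' t - Z' t) := by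
  have hpos : (0 : ℝ) < ctrlNorm p T X Y Y' + ctrlNorm p T X Z Z' + 1 := by positivity
  obtain ⟨φ₁, m1, -, c1⟩ := hY.exists_pathControlled hp hT hpos
    (by linarith [NNReal.coe_nonneg (ctrlNorm p T X Z Z')])
  obtain ⟨φ₂, m2, -, c2⟩ := hZ.exists_pathControlled hp hT hpos
    (by linarith [NNReal.coe_nonneg (ctrlNorm p T X Y Y')])
  have c := (c1.mono_control hp (by positivity) m1 (φ' := fun t => φ₁ t + φ₂ t)
    fun s t hst => by linarith [m2 hst]).sub
    (c2.mono_control hp (by positivity) m2 (φ' := fun t => φ₁ t + φ₂ t)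
    fun s t hst => by linarith [m1 hst])
  obtain ⟨f1, f2⟩ := c.eVar₂_ne_top hp (m1.add m2) (by positivity)
  rw [ctrlDist_eq] at h
  exact RoughPath.exists_pathControlled hp hT f1 f2 hΔ h

end VariationBounds

/-! ### The estimates for solutions -/

section Main

variable {d k ℓ : ℕ}

theorem exists_isSolution {p T : ℝ} {X : ℝ → Vec d} {𝕏 : ℝ → ℝ → Mat d} {r : Fin ℓ → ℝ}
    {f : BlockVec k ℓ → Vec d →L[ℝ] Vec k} {y : ℝ → Vec k} {y' : ℝ → Vec d →L[ℝ] Vec k}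
    (hp : 2 < p) (hp3 : p < 3) (hD : IsData p T X 𝕏 r f) (hy : IsControlled p T X y y') :
    ∃ Y Y', IsSolution p T X 𝕏 r f y y' Y Y' := by
  have hp0 : 0 < p := by linarith
  have hT := hD.pos.le
  obtain ⟨φ₁, h1, -⟩ := hD.rough.exists_rdeControl hp0 hp3.le hT r (le_max_right _ _)
    (le_max_left _ (1 : ℝ))
  have hpos : (0 : ℝ) < ctrlNorm p T X y y' + 1 := by positivity
  obtain ⟨φ₂, m2, -, h2⟩ := hy.exists_pathControlled hp0 hT hpos (by linarith)
  have h1' := h1.mono_control hp0 (φ' := fun t => φ₁ t + φ₂ t) fun s t hst => by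
    linarith [m2 hst]
  have h2' := h2.mono_control hp0 (by positivity) m2 (φ' := fun t => φ₁ t + φ₂ t)
    fun s t hst => by linarith [h1.mono hst]
  obtain ⟨Y, Y', C, hC, hY, hYC⟩ := exists_isLocalSolution hp hp3 hD h1' h2'
  exact ⟨Y, Y', hY.isSolution hp0 hD h1' hy hC hYC⟩

/-- The data enter only through the integer bound `n`, and `p` only through `κ`, so a single
constant serves all of them. -/
theorem exists_ctrlNorm_bound (d k ℓ n : ℕ) {κ : ℝ} (hκ : 0 ≤ κ) (hκ1 : κ < 1) :
    ∃ C : ℝ, 0 ≤ C ∧ ∀ {p T : ℝ} {X : ℝ → Vec d} {𝕏 : ℝ → ℝ → Mat d} {r : Fin ℓ → ℝ}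
      {f : BlockVec k ℓ → Vec d →L[ℝ] Vec k} {y Y : ℝ → Vec k} {y' Y' : ℝ → Vec d →L[ℝ] Vec k},
      2 < p → p < 3 → 2 ^ (1 - 3 * (1 / p)) ≤ κ → IsData p T X 𝕏 r f → IsControlled p T X y y' →
      IsSolution p T X 𝕏 r f y y' Y Y' → (cbNorm 2 f : ℝ) ≤ n → (ctrlNorm p T X y y' : ℝ) ≤ n →
      -- The bound concerns the solution, whose norm is not among the data.
      (roughNorm p T X 𝕏 : ℝ) ≤ n → (ctrlNorm p T X Y Y' : ℝ) ≤ C := by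
  obtain ⟨b, hb⟩ : ∃ b : ℝ, b = n + 1 := ⟨_, rfl⟩
  have hb1 : 1 ≤ b := by rw [hb]; linarith [(Nat.cast_nonneg n : (0 : ℝ) ≤ n)]
  have hnb : (n : ℝ) ≤ b := by linarith
  have hℓ0 : (0 : ℝ) ≤ ℓ := Nat.cast_nonneg ℓ
  have hb3 : b ≤ b ^ 3 := le_self_pow₀ hb1 (by norm_num)
  obtain ⟨W, hW⟩ : ∃ W : ℝ, W = 2 * b ^ 3 + ℓ + 2 := ⟨_, rfl⟩
  obtain ⟨C, hC, H⟩ := exists_pathControlled_bound d k ℓ (B := W) hκ hκ1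
  refine ⟨C * (1 + 2 * W), mul_nonneg hC (by rw [hW]; positivity), ?_⟩
  intro p T X 𝕏 r f y Y y' Y' hp hp3 hpκ hD hy hY hf hyn hXn
  have hp0 : 0 < p := by linarith
  have hT := hD.pos.le
  obtain ⟨φ₁, h1, w1⟩ := hD.rough.exists_rdeControl hp0 hp3.le hT r hb1 (hXn.trans hnb)
  obtain ⟨φ₂, m2, w2, h2⟩ := hy.exists_pathControlled hp0 hT (by linarith) (hyn.trans hnb)
  -- The control `φ₃` comes with a constant that depends on the unknown norm of the solution. It is
  -- used only for the qualitative local-solution property and does not enter the final bound.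
  have hpos : (0 : ℝ) < ctrlNorm p T X Y Y' + 1 := by positivity
  obtain ⟨φ₃, m3, -, h3⟩ := hY.controlled.exists_pathControlled hp0 hT hpos (by linarith)
  have hloc := hY.isLocalSolution hp hp3 hD
    (h1.mono_control hp0 (φ' := fun t => φ₁ t + φ₃ t) fun s t hst => by linarith [m3 hst])
    (h3.mono_control hp0 (by positivity) m3 (φ' := fun t => φ₁ t + φ₃ t)
      fun s t hst => by linarith [h1.mono hst])
  have hφ := h1.mono_control hp0 (φ' := fun t => φ₁ t + φ₂ t) fun s t hst => by
    linarith [m2 hst]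
  have hyφ := h2.mono_control hp0 (by linarith) m2 (φ' := fun t => φ₁ t + φ₂ t)
    fun s t hst => by linarith [h1.mono hst]
  have hφW : φ₁ T + φ₂ T - (φ₁ 0 + φ₂ 0) ≤ W := by linarith
  have key := H hp hpκ hD ((hD.coeff_mem.bounds₂ hf).mono (by linarith)) hφ hφW
    (hyφ.mono (by linarith)) (h1.mono.add m3) hloc
  exact key.ctrlNorm_le hp.le hT hφ.mono hC (by linarith) hφW

theorem exists_solution_sub_bound (d k ℓ n : ℕ) {κ : ℝ} (hκ : 0 ≤ κ) (hκ1 : κ < 1) :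
    ∃ C : ℝ, 0 ≤ C ∧ ∀ {p T : ℝ} {X : ℝ → Vec d} {𝕏 : ℝ → ℝ → Mat d} {r : Fin ℓ → ℝ}
      {f : BlockVec k ℓ → Vec d →L[ℝ] Vec k} {y Y z Z : ℝ → Vec k}
      {y' Y' z' Z' : ℝ → Vec d →L[ℝ] Vec k},
      2 < p → p < 3 → 2 ^ (1 - 3 * (1 / p)) ≤ κ → IsData p T X 𝕏 r f → IsControlled p T X y y' →
      IsControlled p T X z z' → IsSolution p T X 𝕏 r f y y' Y Y' →
      IsSolution p T X 𝕏 r f z z' Z Z' → (cbNorm 3 f : ℝ) ≤ n → (ctrlNorm p T X Y Y' : ℝ) ≤ n →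
      (ctrlNorm p T X Z Z' : ℝ) ≤ n → (roughNorm p T X 𝕏 : ℝ) ≤ n →
      (∀ s ∈ Icc 0 T, ‖stopped r Y s - stopped r Z s‖ ≤
        C * (‖y 0 - z 0‖ + ctrlDist p T X y y' z z')) ∧
      ‖Y 0 - Z 0‖ + ctrlDist p T X Y Y' Z Z' ≤
        C * (‖y 0 - z 0‖ + ctrlDist p T X y y' z z') := by
  obtain ⟨b, hb⟩ : ∃ b : ℝ, b = n + 1 := ⟨_, rfl⟩
  have hb1 : 1 ≤ b := by rw [hb]; linarith [(Nat.cast_nonneg n : (0 : ℝ) ≤ n)]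
  have hnb : (n : ℝ) ≤ b := by linarith
  have hℓ0 : (0 : ℝ) ≤ ℓ := Nat.cast_nonneg ℓ
  have hb3 : b ≤ b ^ 3 := le_self_pow₀ hb1 (by norm_num)
  -- The control of the driver, plus 2 for each of the two solutions and 2 for the difference of the
  -- initial paths.
  obtain ⟨W, hW⟩ : ∃ W : ℝ, W = 2 * b ^ 3 + ℓ + 6 := ⟨_, rfl⟩
  have hW1 : 1 ≤ W := by linarith
  obtain ⟨C, hC, H⟩ := exists_pathControlled_sub_bound d k ℓ (B := W) hκ hκ1
  refine ⟨1 + C * (ℓ + 2) * (1 + 2 * W), by positivity, ?_⟩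
  intro p T X 𝕏 r f y Y z Z y' Y' z' Z' hp hp3 hpκ hD hy hz hY hZ hf hYn hZn hXn
  have hp0 : 0 < p := by linarith
  have hT := hD.pos.le
  obtain ⟨φ₁, h1, w1⟩ := hD.rough.exists_rdeControl hp0 hp3.le hT r hb1 (hXn.trans hnb)
  obtain ⟨φ₂, m2, w2, h2⟩ := hY.controlled.exists_pathControlled hp0 hT (by linarith)
    (hYn.trans hnb)
  obtain ⟨φ₃, m3, w3, h3⟩ := hZ.controlled.exists_pathControlled hp0 hT (by linarith)
    (hZn.trans hnb)
  -- A strict upper bound `Δ` is positive even for equal data, as the rescaling of controls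
  -- requires; letting `Δ` decrease to the distance gives the claim.
  have main : ∀ Δ, ‖y 0 - z 0‖ + ctrlDist p T X y y' z z' < Δ →
      (∀ s ∈ Icc 0 T, ‖stopped r Y s - stopped r Z s‖ ≤
        (1 + C * (ℓ + 2) * (1 + 2 * W)) * Δ) ∧
      ‖Y 0 - Z 0‖ + ctrlDist p T X Y Y' Z Z' ≤ (1 + C * (ℓ + 2) * (1 + 2 * W)) * Δ := by
    intro Δ hΔ
    have n1 := norm_nonneg (y 0 - z 0)
    have n2 := NNReal.coe_nonneg (ctrlDist p T X y y' z z')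
    have hΔ0 : 0 < Δ := by linarith
    obtain ⟨φ₄, m4, w4, h4⟩ := hy.exists_pathControlled_sub hp0 hT hz hΔ0 (by linarith)
    obtain ⟨φ, hφdef⟩ : ∃ φ : ℝ → ℝ, φ = fun t => φ₁ t + φ₂ t + φ₃ t + φ₄ t := ⟨_, rfl⟩
    have hφ := h1.mono_control hp0 (φ' := φ) fun s t hst => by
      rw [hφdef]; linarith [m2 hst, m3 hst, m4 hst]
    have hYφ := h2.mono_control hp0 (by linarith) m2 (φ' := φ) fun s t hst => by
      rw [hφdef]; linarith [h1.mono hst, m3 hst, m4 hst]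
    have hZφ := h3.mono_control hp0 (by linarith) m3 (φ' := φ) fun s t hst => by
      rw [hφdef]; linarith [h1.mono hst, m2 hst, m4 hst]
    have huφ := h4.mono_control hp0 (by linarith) m4 (φ' := φ) fun s t hst => by
      rw [hφdef]; linarith [h1.mono hst, m2 hst, m3 hst]
    have hφW : φ T - φ 0 ≤ W := by
      rw [hφdef]; simp only; linarith
    have hlY := hY.isLocalSolution hp hp3 hD hφ hYφ
    have hlZ := hZ.isLocalSolution hp hp3 hD hφ hZφ
    have hst := norm_stopped_start_sub r (fun i => (hD.mem i).1) Y Z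
    rw [hlY.start, hlZ.start] at hst
    obtain ⟨key1, key2⟩ := H hp hpκ hD ((hD.coeff_mem.bounds₃ hf).mono (by linarith)) hφ hφW
      (hYφ.mono (by linarith)) (hZφ.mono (by linarith)) hφ.mono hlY hφ.mono hlZ
      (Δ := (ℓ + 2) * Δ) (by positivity) (huφ.mono (by nlinarith))
      (hst.trans (by nlinarith))
    have hnorm := key2.ctrlNorm_le hp.le hT hφ.mono (by positivity) hW1 hφW
    rw [← ctrlDist_eq] at hnorm
    have hCΔ : 0 ≤ C * ((ℓ + 2) * Δ) := by positivity
    refine ⟨fun s hs => (key1 s hs.1 hs.2).trans (by nlinarith), ?_⟩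
    rw [hlY.start, hlZ.start]
    linarith
  have hcont : Continuous fun Δ : ℝ => (1 + C * (ℓ + 2) * (1 + 2 * W)) * Δ := by fun_prop
  have lim : ∀ a D : ℝ, (∀ Δ, D < Δ → a ≤ (1 + C * (ℓ + 2) * (1 + 2 * W)) * Δ) →
      a ≤ (1 + C * (ℓ + 2) * (1 + 2 * W)) * D := fun a D h =>
    ge_of_tendsto ((hcont.tendsto D).mono_left nhdsWithin_le_nhds)
      (by filter_upwards [self_mem_nhdsWithin (s := Ioi D)] with Δ hΔ using h Δ hΔ)
  exact ⟨fun s hs => lim _ _ fun Δ hΔ => (main Δ hΔ).1 s hs, lim _ _ fun Δ hΔ => (main Δ hΔ).2⟩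

/-- The Lipschitz bound with distance zero makes the stopped states agree at every time; the
derivatives then agree through `Y' = y' + f(Ȳ)`. -/
theorem IsSolution.unique {p T : ℝ} {X : ℝ → Vec d} {𝕏 : ℝ → ℝ → Mat d} {r : Fin ℓ → ℝ}
    {f : BlockVec k ℓ → Vec d →L[ℝ] Vec k} {y Y Z : ℝ → Vec k} {y' Y' Z' : ℝ → Vec d →L[ℝ] Vec k}
    (hp : 2 < p) (hp3 : p < 3) (hD : IsData p T X 𝕏 r f) (hy : IsControlled p T X y y')
    (hY : IsSolution p T X 𝕏 r f y y' Y Y') (hZ : IsSolution p T X 𝕏 r f y y' Z Z') :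
    EqOn Z Y (Icc 0 T) ∧ EqOn Z' Y' (Icc 0 T) := by
  obtain ⟨n, hn⟩ := exists_nat_ge ((cbNorm 3 f : ℝ) + ctrlNorm p T X Y Y' + ctrlNorm p T X Z Z'
    + roughNorm p T X 𝕏)
  have n1 := NNReal.coe_nonneg (cbNorm 3 f)
  have n2 := NNReal.coe_nonneg (ctrlNorm p T X Y Y')
  have n3 := NNReal.coe_nonneg (ctrlNorm p T X Z Z')
  have n4 := NNReal.coe_nonneg (roughNorm p T X 𝕏)
  obtain ⟨C, -, H⟩ := exists_solution_sub_bound d k ℓ n (κ := 2 ^ (1 - 3 * (1 / p)))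
    (by positivity) (rpow_sub_lt_one hp hp3)
  obtain ⟨key, -⟩ := H hp hp3 le_rfl hD hy hy hY hZ (by linarith) (by linarith) (by linarith)
    (by linarith)
  have h0 : ctrlDist p T X y y' y y' = 0 := by
    rw [ctrlDist_eq]
    have hz : PathControlled 0 p T (fun _ => 0) X (fun t => y t - y t) (fun t => y' t - y' t) :=
      ⟨fun s _ _ => by simp, fun s t _ _ _ => by simp, fun s t _ _ _ => by simp⟩
    have := hz.ctrlNorm_le hp.le hD.pos.le monotone_const le_rfl le_rfl (by simp)
    rw [zero_mul] at this
    exact NNReal.coe_eq_zero.1 (le_antisymm this (NNReal.coe_nonneg _))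
  have hs : ∀ s ∈ Icc 0 T, stopped r Z s = stopped r Y s := fun s hs => by
    have := key s hs
    rw [sub_self, norm_zero, h0, NNReal.coe_zero, add_zero, mul_zero] at this
    exact (sub_eq_zero.1 (norm_le_zero_iff.1 this)).symm
  refine ⟨fun s h => ?_, fun s h => ?_⟩
  · simpa using congrArg (fun v : BlockVec k ℓ => v 0) (hs s h)
  · rw [hZ.deriv_eq s h, hY.deriv_eq s h, coeff, coeff, hs s h]

/-- A monotone function dominating a doubly indexed family of constants. -/
theorem exists_monotone_bound (c : ℕ → ℕ → ℝ) :
    ∃ S : ℕ → ℝ≥0, Monotone S ∧ ∀ m i j, i ≤ m → j ≤ m → c i j ≤ S m := by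
  refine ⟨fun m => ∑ i ∈ Finset.range (m + 1), ∑ j ∈ Finset.range (m + 1), (c i j).toNNReal,
    fun m m' h => ?_, fun m i j hi hj => ?_⟩
  · have hr : Finset.range (m + 1) ⊆ Finset.range (m' + 1) := Finset.range_mono (by omega)
    exact (Finset.sum_le_sum fun i _ => Finset.sum_le_sum_of_subset hr).trans
      (Finset.sum_le_sum_of_subset hr)
  · refine (Real.le_coe_toNNReal _).trans (NNReal.coe_le_coe.2 ?_)
    exact (Finset.single_le_sum (f := fun j => (c i j).toNNReal) (fun _ _ => zero_le)
      (Finset.mem_range.2 (by omega))).trans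
      (Finset.single_le_sum (f := fun i => ∑ j ∈ Finset.range (m + 1), (c i j).toNNReal)
        (fun _ _ => zero_le) (Finset.mem_range.2 (by omega)))

/-- The constants are available for integer bounds only. Rounding up the sum of the norms and adding
up all constants with smaller indices produces a monotone function. -/
theorem exists_monotone_ctrlNorm_bound (d k : ℕ) {p : ℝ} (hp : 2 < p) (hp3 : p < 3) :
    ∃ K : ℕ × ℝ≥0 × ℝ≥0 × ℝ≥0 → ℝ≥0, Monotone K ∧
      ∀ (T : ℝ) (ℓ : ℕ) (X : ℝ → Vec d) (𝕏 : ℝ → ℝ → Mat d) (r : Fin ℓ → ℝ)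
        (f : BlockVec k ℓ → Vec d →L[ℝ] Vec k) (y : ℝ → Vec k) (y' : ℝ → Vec d →L[ℝ] Vec k)
        (Y : ℝ → Vec k) (Y' : ℝ → Vec d →L[ℝ] Vec k),
        IsData p T X 𝕏 r f → IsControlled p T X y y' →
        IsSolution p T X 𝕏 r f y y' Y Y' →
        ctrlNorm p T X Y Y' ≤ K (ℓ, cbNorm 2 f, ctrlNorm p T X y y', roughNorm p T X 𝕏) := by
  choose c _ hc using fun ℓ n => exists_ctrlNorm_bound d k ℓ n (κ := 2 ^ (1 - 3 * (1 / p)))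
    (by positivity) (rpow_sub_lt_one hp hp3)
  obtain ⟨S, hS, hcS⟩ := exists_monotone_bound c
  refine ⟨fun a => S (a.1 + ⌈a.2.1 + a.2.2.1 + a.2.2.2⌉₊), fun a b hab => hS ?_, ?_⟩
  · exact add_le_add hab.1 (Nat.ceil_mono
      (add_le_add (add_le_add hab.2.1 hab.2.2.1) hab.2.2.2))
  · intro T ℓ X 𝕏 r f y y' Y Y' hD hy hY
    have hle := Nat.le_ceil (cbNorm 2 f + ctrlNorm p T X y y' + roughNorm p T X 𝕏)
    have hle' : (cbNorm 2 f : ℝ) + ctrlNorm p T X y y' + roughNorm p T X 𝕏 ≤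
      ⌈cbNorm 2 f + ctrlNorm p T X y y' + roughNorm p T X 𝕏⌉₊ := by exact_mod_cast hle
    have n1 := NNReal.coe_nonneg (cbNorm 2 f)
    have n2 := NNReal.coe_nonneg (ctrlNorm p T X y y')
    have n3 := NNReal.coe_nonneg (roughNorm p T X 𝕏)
    exact_mod_cast (hc ℓ _ hp hp3 le_rfl hD hy hY (by linarith) (by linarith) (by linarith)).trans
      (hcS _ _ _ (Nat.le_add_right _ _) (Nat.le_add_left _ _))

/-- The constants degenerate only as `p` approaches 3, which is measured by `(3 - p)⁻¹`. Together
with the other parameters this is a continuous, hence bounded, quantity on compact sets of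
admissible parameters. -/
theorem exists_lipschitz_constant (d k : ℕ) :
    ∃ C : ℝ × ℕ × ℝ≥0 × ℝ≥0 × ℝ≥0 → ℝ≥0,
      (∀ A : Set (ℝ × ℕ × ℝ≥0 × ℝ≥0 × ℝ≥0), IsCompact A → (∀ a ∈ A, a.1 ∈ Ioo (2 : ℝ) 3) →
        BddAbove (C '' A)) ∧
      ∀ p ∈ Ioo (2 : ℝ) 3, ∀ (T : ℝ) (ℓ : ℕ) (X : ℝ → Vec d) (𝕏 : ℝ → ℝ → Mat d) (r : Fin ℓ → ℝ)
        (f : BlockVec k ℓ → Vec d →L[ℝ] Vec k)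
        (y z : ℝ → Vec k) (y' z' : ℝ → Vec d →L[ℝ] Vec k)
        (Y Z : ℝ → Vec k) (Y' Z' : ℝ → Vec d →L[ℝ] Vec k) (K : ℝ≥0),
        IsData p T X 𝕏 r f → IsControlled p T X y y' → IsControlled p T X z z' →
        IsSolution p T X 𝕏 r f y y' Y Y' → IsSolution p T X 𝕏 r f z z' Z Z' →
        ctrlNorm p T X Y Y' ≤ K → ctrlNorm p T X Z Z' ≤ K →
        ‖Y 0 - Z 0‖₊ + ctrlDist p T X Y Y' Z Z' ≤
          C (p, ℓ, cbNorm 3 f, K, roughNorm p T X 𝕏) *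
            (‖y 0 - z 0‖₊ + ctrlDist p T X y y' z z') := by
  have hκ : ∀ n : ℕ, (2 : ℝ) ^ (-(1 : ℝ) / (3 * (n + 1))) < 1 := fun n =>
    Real.rpow_lt_one_of_one_lt_of_neg one_lt_two (by
      rw [neg_div]; exact neg_lt_zero.2 (by positivity))
  choose c _ hc using fun ℓ n => exists_solution_sub_bound d k ℓ n
    (κ := 2 ^ (-(1 : ℝ) / (3 * (n + 1)))) (by positivity) (hκ n)
  obtain ⟨S, hS, hcS⟩ := exists_monotone_bound c
  set g : ℝ × ℕ × ℝ≥0 × ℝ≥0 × ℝ≥0 → ℝ := fun a =>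
    (3 - a.1)⁻¹ + a.2.1 + a.2.2.1 + a.2.2.2.1 + a.2.2.2.2 with hg
  refine ⟨fun a => S ⌈g a⌉₊, fun A hA hA3 => ?_, ?_⟩
  · have h1 : ContinuousOn (fun a : ℝ × ℕ × ℝ≥0 × ℝ≥0 × ℝ≥0 => (3 - a.1)⁻¹) A :=
      ContinuousOn.inv₀ (continuous_const.sub continuous_fst).continuousOn fun a ha => by
        have := (hA3 a ha).2
        exact ne_of_gt (by linarith)
    have h2 : Continuous fun a : ℝ × ℕ × ℝ≥0 × ℝ≥0 × ℝ≥0 => (a.2.1 : ℝ) :=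
      (continuous_of_discreteTopology (f := fun n : ℕ => (n : ℝ))).comp
        (continuous_fst.comp continuous_snd)
    have h3 : Continuous fun a : ℝ × ℕ × ℝ≥0 × ℝ≥0 × ℝ≥0 => (a.2.2.1 : ℝ) :=
      NNReal.continuous_coe.comp (continuous_fst.comp (continuous_snd.comp continuous_snd))
    have h4 : Continuous fun a : ℝ × ℕ × ℝ≥0 × ℝ≥0 × ℝ≥0 => (a.2.2.2.1 : ℝ) :=
      NNReal.continuous_coe.comp (continuous_fst.comp (continuous_snd.comp
        (continuous_snd.comp continuous_snd)))
    have h5 : Continuous fun a : ℝ × ℕ × ℝ≥0 × ℝ≥0 × ℝ≥0 => (a.2.2.2.2 : ℝ) :=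
      NNReal.continuous_coe.comp (continuous_snd.comp (continuous_snd.comp
        (continuous_snd.comp continuous_snd)))
    have hcont : ContinuousOn g A :=
      (((h1.add h2.continuousOn).add h3.continuousOn).add h4.continuousOn).add h5.continuousOn
    obtain ⟨M, hM⟩ := (hA.image_of_continuousOn hcont).bddAbove
    refine ⟨S ⌈M⌉₊, ?_⟩
    rintro _ ⟨a, ha, rfl⟩
    exact hS (Nat.ceil_mono (hM (mem_image_of_mem g ha)))
  · rintro p ⟨hp, hp3⟩ T ℓ X 𝕏 r f y z y' z' Y Z Y' Z' K hD hy hz hY hZ hYK hZK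
    obtain ⟨m, hm⟩ : ∃ m, m = ⌈g (p, ℓ, cbNorm 3 f, K, roughNorm p T X 𝕏)⌉₊ := ⟨_, rfl⟩
    have hle : (3 - p)⁻¹ + ℓ + cbNorm 3 f + K + roughNorm p T X 𝕏 ≤ m := by
      rw [hm]; exact Nat.le_ceil _
    have n0 : 0 < (3 - p)⁻¹ := inv_pos.2 (by linarith)
    have nℓ : (0 : ℝ) ≤ ℓ := Nat.cast_nonneg ℓ
    have n1 := NNReal.coe_nonneg (cbNorm 3 f)
    have n2 := NNReal.coe_nonneg K
    have n3 := NNReal.coe_nonneg (roughNorm p T X 𝕏)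
    have hYK' : (ctrlNorm p T X Y Y' : ℝ) ≤ K := by exact_mod_cast hYK
    have hZK' : (ctrlNorm p T X Z Z' : ℝ) ≤ K := by exact_mod_cast hZK
    -- From `(3 - p)⁻¹ ≤ m + 1` and `p < 3` one gets `1 - 3 / p = -(3 - p) / p ≤ -1 / (3 * (m +
    -- 1))`, so the contraction factor is at most the `κ` attached to `m`.
    have hpκ : (2 : ℝ) ^ (1 - 3 * (1 / p)) ≤ 2 ^ (-(1 : ℝ) / (3 * (m + 1))) := by
      refine Real.rpow_le_rpow_of_exponent_le one_le_two ?_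
      have h3p : 0 < 3 - p := by linarith
      have e1 : (3 - p)⁻¹ ≤ (m : ℝ) + 1 := by linarith
      have e2 : 1 ≤ (3 - p) * ((m : ℝ) + 1) := by
        rw [inv_le_iff_one_le_mul₀' h3p] at e1
        exact e1
      have e3 : 1 - 3 * (1 / p) = -(3 - p) / p := by field_simp; ring
      rw [e3, div_le_div_iff₀ (by linarith) (by positivity)]
      nlinarith
    have hℓm : ℓ ≤ m := by
      have : (ℓ : ℝ) ≤ m := by linarith
      exact_mod_cast this
    obtain ⟨-, key⟩ := hc ℓ m hp hp3 hpκ hD hy hz hY hZ (by linarith) (by linarith) (by linarith)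
      (by linarith)
    have hnn : 0 ≤ ‖y 0 - z 0‖ + ctrlDist p T X y y' z z' := by positivity
    have := key.trans (mul_le_mul_of_nonneg_right (hcS m ℓ m hℓm le_rfl) hnn)
    rw [hm] at this
    exact_mod_cast this

end Main

end RoughPath

theorem proposition3p5 (d k : ℕ) :
    -- existence and uniqueness
    (∀ p ∈ Ioo (2 : ℝ) 3, ∀ (T : ℝ) (ℓ : ℕ) (X : ℝ → Vec d) (𝕏 : ℝ → ℝ → Mat d) (r : Fin ℓ → ℝ)
        (f : BlockVec k ℓ → Vec d →L[ℝ] Vec k) (y : ℝ → Vec k) (y' : ℝ → Vec d →L[ℝ] Vec k),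
        IsData p T X 𝕏 r f → IsControlled p T X y y' →
        ∃ (Y : ℝ → Vec k) (Y' : ℝ → Vec d →L[ℝ] Vec k),
          IsSolution p T X 𝕏 r f y y' Y Y' ∧
          ∀ (Z : ℝ → Vec k) (Z' : ℝ → Vec d →L[ℝ] Vec k),
            IsSolution p T X 𝕏 r f y y' Z Z' → EqOn Z Y (Icc 0 T) ∧ EqOn Z' Y' (Icc 0 T)) ∧
    -- a priori bound
    (∀ p ∈ Ioo (2 : ℝ) 3, ∃ K : ℕ × ℝ≥0 × ℝ≥0 × ℝ≥0 → ℝ≥0, Monotone K ∧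
      ∀ (T : ℝ) (ℓ : ℕ) (X : ℝ → Vec d) (𝕏 : ℝ → ℝ → Mat d) (r : Fin ℓ → ℝ)
        (f : BlockVec k ℓ → Vec d →L[ℝ] Vec k) (y : ℝ → Vec k) (y' : ℝ → Vec d →L[ℝ] Vec k)
        (Y : ℝ → Vec k) (Y' : ℝ → Vec d →L[ℝ] Vec k),
        IsData p T X 𝕏 r f → IsControlled p T X y y' →
        IsSolution p T X 𝕏 r f y y' Y Y' →
        ctrlNorm p T X Y Y' ≤ K (ℓ, cbNorm 2 f, ctrlNorm p T X y y', roughNorm p T X 𝕏)) ∧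
    -- local Lipschitz continuity in `(y, y')`, with a locally bounded constant
    (∃ C : ℝ × ℕ × ℝ≥0 × ℝ≥0 × ℝ≥0 → ℝ≥0,
      (∀ A : Set (ℝ × ℕ × ℝ≥0 × ℝ≥0 × ℝ≥0), IsCompact A → (∀ a ∈ A, a.1 ∈ Ioo (2 : ℝ) 3) →
        BddAbove (C '' A)) ∧
      ∀ p ∈ Ioo (2 : ℝ) 3, ∀ (T : ℝ) (ℓ : ℕ) (X : ℝ → Vec d) (𝕏 : ℝ → ℝ → Mat d) (r : Fin ℓ → ℝ)
        (f : BlockVec k ℓ → Vec d →L[ℝ] Vec k)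
        (y z : ℝ → Vec k) (y' z' : ℝ → Vec d →L[ℝ] Vec k)
        (Y Z : ℝ → Vec k) (Y' Z' : ℝ → Vec d →L[ℝ] Vec k) (K : ℝ≥0),
        IsData p T X 𝕏 r f → IsControlled p T X y y' → IsControlled p T X z z' →
        IsSolution p T X 𝕏 r f y y' Y Y' → IsSolution p T X 𝕏 r f z z' Z Z' →
        ctrlNorm p T X Y Y' ≤ K → ctrlNorm p T X Z Z' ≤ K →
        ‖Y 0 - Z 0‖₊ + ctrlDist p T X Y Y' Z Z' ≤
          C (p, ℓ, cbNorm 3 f, K, roughNorm p T X 𝕏) *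
            (‖y 0 - z 0‖₊ + ctrlDist p T X y y' z z')) := by
  refine ⟨?_, fun p hp => exists_monotone_ctrlNorm_bound d k hp.1 hp.2,
    exists_lipschitz_constant d k⟩
  intro p hp T ℓ X 𝕏 r f y y' hD hy
  obtain ⟨Y, Y', hY⟩ := exists_isSolution hp.1 hp.2 hD hy
  exact ⟨Y, Y', hY, fun Z Z' hZ => hY.unique hp.1 hp.2 hD hy hZ⟩
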